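/- Let $K$ be a field of characteristic zero and let $\mathbb I_1=K\langle x,\partial,\int\rangle\subseteq \mathrm{End}_K(K[x])$ be the algebra of polynomial integro-differential operators, generated by multiplication by $x$, $\partial=d/dx$ and $\int:x^n\mapsto x^{n+1}/(n+1)$. Put $H=\partial x$, $e_{ij}=\int^i\partial^j-\int^{i+1}\partial^{j+1}$ for $i,j\ge 0$, $F=\bigoplus_{i,j\ge0}Ke_{ij}$ (an ideal of $\mathbb I_1$), $F_{\le d}=\bigoplus_{i,j\le d}Ke_{ij}$, and for $f\in F$ let $\deg_F(f)$ be the least $n\ge 0$ with $f\in F_{\le n}$ if $f\neq0$, and $\deg_F(0)=-1$. Put $e_d'=1-(e_{00}+\cdots+e_{dd})$ (so $e'_{-1}=1$), $\mathcal H_0=\bigoplus_{i=0}^dKe_{i0}$, $\mathcal V_0=\bigoplus_{j=0}^dKe_{0j}$. Let $v_i=\int^i$ for $i\ge0$ and $v_i=\partial^{|i|}$ for $i<0$. Every $a\in\mathbb I_1$ is a unique finite sum $a=\sum_{i\in\mathbb Z}b_iv_i+\sum\lambda_{ij}e_{ij}$ with $b_i\in K[H]$, $\lambda_{ij}\in K$;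 for $a\notin F$ let $\pi_+(a)$ and $\pi_-(a)$ be the largest and the least $i$ with $b_i\ne0$. For $a\in\mathbb I_1$ let $\mathrm{Cen}(a)=\{b\in\mathbb I_1: ab=ba\}$ and $\mathrm{Cen}_F(a)=F\cap\mathrm{Cen}(a)$; for $g\in\mathbb I_1$ let $\mathrm{Cen}_{F_{\le d}}(g)=F_{\le d}\cap \mathrm{Cen}(g)$. Regard $\mathrm{Cen}(a)$ as a module over $K[a]$, and over the polynomial ring $K[t]$ with $t$ acting as multiplication by $a$; its rank is $\dim_{K(t)}K(t)\otimes_{K[t]}\mathrm{Cen}(a)$ and its torsion is $\mathrm{tor}_{K[a]}(\mathrm{Cen}(a))=\{c: p(a)c=0\text{ for some }0\ne p\in K[t]\}$. For an algebra $A$, $[A,A]$ is the linear span of all $xy-yx$ with $x,y\in A$. 1. Let $a\in\mathbb I_1\setminus(K[H]+F)$. Then: (a) $\mathrm{Cen}(a)$ is a finitely generated $K[a]$-module of finite rank $\rho\ge1$. In particular, $\mathrm{Cen}(a)$ is a finitely generated, left and right Noetherian algebra. (b) There is a $K[a]$-module isomorphism $\mathrm{Cen}(a)\simeq K[a]^\rho\oplus\mathrm{Cen}_F(a)$,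 and if $-n=\pi_-(a)<0$ (respectively $m=\pi_+(a)>0$) then $\rho$ divides $n$ (respectively $m$). (c) $[\mathrm{Cen}(a),\mathrm{Cen}(a)]\subseteq\mathrm{Cen}_F(a)$, $\dim_K\mathrm{Cen}_F(a)<\infty$, and $\mathrm{Cen}_F(a)=\mathrm{tor}_{K[a]}(\mathrm{Cen}(a))$. 2. Let $a\in(K[H]+F)\setminus(K+F)$, i.e. $a=\alpha+f$ with $\alpha\in K[H]\setminus K$ and $f\in F$, and let $d=\deg_F(f)$, $\rho=\deg_H(\alpha)$. Then: (a) $\mathrm{Cen}(a)$ is not a finitely generated $K[a]$-module but has finite rank $\rho$. (b) $\mathrm{Cen}(a)$ is not a finitely generated algebra and is neither left nor right Noetherian. Moreover, it contains infinite direct sums of nonzero left ideals and of nonzero right ideals. (c) There is a $K[a]$-module isomorphism $\mathrm{Cen}(a)\simeq K[a]^\rho\oplus\mathrm{Cen}_F(a)$. (d) $\mathrm{Cen}(a)=e_d'K[H]\oplus\mathrm{Cen}_F(a)$ and $$\mathrm{Cen}_F(a)=\bigoplus_{j>d}Ke_{jj}\oplus C_{\alpha,d}\oplus C_{\alpha,d}^*\oplus\mathrm{Cen}_{F_{\le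 d}}(a_{11})\oplus\bigoplus_{j>d}\ker_{\mathcal H_0}\big((a_{11}-\alpha(j+1))\,\cdot\big)e_{0j}\oplus\bigoplus_{i>d}e_{i0}\ker_{\mathcal V_0}\big(\cdot\,(a_{11}-\alpha(i+1))\big)$$ is an infinite direct sum of $K[a]$-modules, where $a_{11}=\sum_{i=0}^d\alpha(i+1)e_{ii}+f$, $C_{\alpha,d}$ is the direct sum of the $Ke_{i+j,j}$ over all $i\ge1$, $j>d$, $j\geq 0$ such that $j+1$ is a root of the polynomial $\alpha(H+i)-\alpha(H)$, and $C_{\alpha,d}^*$ is the direct sum of the $Ke_{j,i+j}$ over the same $(i,j)$. (e) $[\mathrm{Cen}(a),\mathrm{Cen}(a)]\subseteq\mathrm{Cen}_F(a)$, $\dim_K\mathrm{Cen}_F(a)=\infty$, and $\mathrm{Cen}_F(a)=\mathrm{tor}_{K[a]}(\mathrm{Cen}(a))$. 3. Let $a\in(K+F)\setminus K$, i.e. $a=\lambda+f$ with $\lambda\in K$ and $0\ne f\in F$, and let $d=\deg_F(f)$. Then: (a) $\mathrm{Cen}(a)$ is a finitely generated algebra which is neither left nor right Noetherian. Moreover,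 it contains infinite direct sums of nonzero left ideals and of nonzero right ideals. In particular, $\mathrm{Cen}(a)$ is not a finitely generated $K[a]$-module. (b) $\mathrm{Cen}(a)=\mathrm{Cen}_{F_{\le d}}(f)\oplus\bigoplus_{j>d}\mathcal K e_{0j}\oplus\bigoplus_{i>d}e_{i0}\mathcal K'\oplus e_d'\mathbb I_1e_d'$, where $\mathcal K=\{h\in\mathcal H_0: fh=0\}$ and $\mathcal K'=\{h\in\mathcal V_0: hf=0\}$. (c) $[\mathrm{Cen}(a),\mathrm{Cen}(a)]\not\subseteq\mathrm{Cen}_F(a)$, $\dim_K\mathrm{Cen}_F(a)=\infty$, and $\mathrm{tor}_{K[a]}(\mathrm{Cen}(a))=\mathrm{Cen}(a)\ne\mathrm{Cen}_F(a)$. -/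

import Mathlib

open Polynomial TensorProduct

noncomputable section

namespace IntDiff

universe u

variable (K : Type u) [Field K]

/-! ### The algebra of polynomial integro-differential operators in one variable -/

/-- Integration on `K[x]`: the `K`-linear map with `x ^ n ↦ x ^ (n + 1) / (n + 1)`. -/
def integrate : Module.End K K[X] :=
  Polynomial.lsum fun n => ((n : K) + 1)⁻¹ • Polynomial.monomial (n + 1)

/-- The algebra `𝕀₁ = K⟨x, ∂, ∫⟩`, the subalgebra of `End_K(K[x])` generated by multiplication
by `x`, differentiation and integration. -/
def I₁ : Type u :=
  Algebra.adjoin K {LinearMap.mulLeft K (X : K[X]), Polynomial.derivative, integrate K}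

instance : Ring (I₁ K) := inferInstanceAs (Ring (Algebra.adjoin K
  {LinearMap.mulLeft K (X : K[X]), Polynomial.derivative, integrate K}))

instance : Algebra K (I₁ K) := inferInstanceAs (Algebra K (Algebra.adjoin K
  {LinearMap.mulLeft K (X : K[X]), Polynomial.derivative, integrate K}))

/-- The inclusion of `𝕀₁` in `End_K(K[x])`. -/
def toEnd : I₁ K →ₐ[K] Module.End K K[X] := Subalgebra.val _

/-- Multiplication by `x`, as an element of `𝕀₁`. -/
def xOp : I₁ K := ⟨LinearMap.mulLeft K (X : K[X]), Algebra.subset_adjoin (by simp)⟩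

/-- The derivation `∂`, as an element of `𝕀₁`. -/
def del : I₁ K := ⟨Polynomial.derivative, Algebra.subset_adjoin (by simp)⟩

/-- Integration `∫`, as an element of `𝕀₁`. -/
def int : I₁ K := ⟨integrate K, Algebra.subset_adjoin (by simp)⟩

/-- `H = ∂ x`. -/
def H : I₁ K := del K * xOp K

/-- `e_{ij} = ∫ ^ i ∂ ^ j - ∫ ^ (i + 1) ∂ ^ (j + 1)`. -/
def e (i j : ℕ) : I₁ K := int K ^ i * del K ^ j - int K ^ (i + 1) * del K ^ (j + 1)

/-- The scalars `K` inside `𝕀₁`, as a subspace. -/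
def scalars : Submodule K (I₁ K) := Subalgebra.toSubmodule ⊥

/-- The subalgebra `K[H]` of `𝕀₁`, as a subspace. -/
def KH : Submodule K (I₁ K) := Subalgebra.toSubmodule (Algebra.adjoin K {H K})

/-- `F`, the span of all the `e_{ij}`. -/
def F : Submodule K (I₁ K) := Submodule.span K {b | ∃ i j : ℕ, b = e K i j}

section FisLeftIdeal

variable {K}

lemma integrate_monomial (n : ℕ) (c : K) :
    integrate K (monomial n c) = monomial (n + 1) (((n : K) + 1)⁻¹ * c) := by
  simp [integrate, Polynomial.lsum_apply, Polynomial.smul_monomial]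

lemma toEnd_injective : Function.Injective (toEnd K) := Subtype.val_injective

lemma toEnd_xOp : toEnd K (xOp K) = LinearMap.mulLeft K (X : K[X]) := rfl

lemma toEnd_del : toEnd K (del K) = Polynomial.derivative := rfl

lemma toEnd_int : toEnd K (int K) = integrate K := rfl

lemma ext_monomial {a b : I₁ K}
    (h : ∀ n c, toEnd K a (monomial n c) = toEnd K b (monomial n c)) : a = b :=
  toEnd_injective (Polynomial.lhom_ext' fun n => LinearMap.ext fun c => h n c)

lemma e_eq (i j : ℕ) : e K i j = int K ^ i * (1 - int K * del K) * del K ^ j := by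
  rw [e, pow_succ (int K), pow_succ' (del K)]
  simp only [mul_sub, sub_mul, mul_one, mul_assoc]

lemma int_mul_e (i j : ℕ) : int K * e K i j = e K (i + 1) j := by
  rw [e_eq, e_eq, pow_succ' (int K)]
  simp only [mul_assoc]

variable [CharZero K]

lemma del_mul_int : del K * int K = 1 := by
  refine ext_monomial fun n c => ?_
  have h : (n : K) + 1 ≠ 0 := by exact_mod_cast Nat.succ_ne_zero n
  rw [map_mul, map_one, toEnd_del, toEnd_int, Module.End.mul_apply, Module.End.one_apply,
    integrate_monomial, Polynomial.derivative_monomial]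
  simp only [Nat.add_sub_cancel]
  congr 1
  push_cast
  field_simp

lemma H_mul_int : H K * int K = int K * H K + int K := by
  refine ext_monomial fun n c => ?_
  simp only [H, map_mul, map_add, toEnd_del, toEnd_int, toEnd_xOp, Module.End.mul_apply,
    LinearMap.add_apply, LinearMap.mulLeft_apply]
  rw [integrate_monomial, X_mul_monomial, X_mul_monomial, Polynomial.derivative_monomial,
    Polynomial.derivative_monomial, Nat.add_sub_cancel, Nat.add_sub_cancel, integrate_monomial,
    ← map_add]
  have h : (n : K) + 1 ≠ 0 := by exact_mod_cast Nat.succ_ne_zero n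
  congr 1
  push_cast
  field_simp

lemma xOp_eq : xOp K = int K * H K := by
  refine ext_monomial fun n c => ?_
  simp only [H, map_mul, toEnd_del, toEnd_int, toEnd_xOp, Module.End.mul_apply,
    LinearMap.mulLeft_apply]
  rw [X_mul_monomial, Polynomial.derivative_monomial, Nat.add_sub_cancel, integrate_monomial]
  have h : (n : K) + 1 ≠ 0 := by exact_mod_cast Nat.succ_ne_zero n
  congr 1
  push_cast
  field_simp

lemma H_mul_e00 : H K * (1 - int K * del K) = 1 - int K * del K := by
  refine ext_monomial fun n c => ?_
  simp only [H, map_mul, map_sub, map_one, toEnd_del, toEnd_int, toEnd_xOp, Module.End.mul_apply,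
    LinearMap.mulLeft_apply, LinearMap.sub_apply, Module.End.one_apply]
  rw [Polynomial.derivative_monomial, integrate_monomial]
  rcases n with _ | n
  · simp
  · have h : (n : K) + 1 ≠ 0 := by exact_mod_cast Nat.succ_ne_zero n
    have : ((n : K) + 1)⁻¹ * (c * ((n : K) + 1)) = c := by field_simp
    simp [this]

lemma del_mul_e_succ (i j : ℕ) : del K * e K (i + 1) j = e K i j := by
  rw [← int_mul_e, ← mul_assoc, del_mul_int, one_mul]

lemma del_mul_e_zero (j : ℕ) : del K * e K 0 j = 0 := by
  rw [e_eq, pow_zero, one_mul, ← mul_assoc, mul_sub, mul_one, ← mul_assoc, del_mul_int,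
    one_mul, sub_self, zero_mul]

lemma H_mul_e (i j : ℕ) : H K * e K i j = ((i : K) + 1) • e K i j := by
  induction i with
  | zero => rw [e_eq, pow_zero, one_mul, ← mul_assoc, H_mul_e00]; simp
  | succ i ih =>
    rw [← int_mul_e, ← mul_assoc, H_mul_int, add_mul, mul_assoc, ih, mul_smul_comm]
    push_cast
    rw [add_smul ((i : K) + 1) 1, one_smul]

/-- `F` is a left ideal of `𝕀₁`. -/
lemma mul_mem_F (b : I₁ K) {f : I₁ K} (hf : f ∈ F K) : b * f ∈ F K := by
  have he (i j : ℕ) : e K i j ∈ F K := Submodule.subset_span ⟨i, j, rfl⟩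
  have key (c : I₁ K) (hc : ∀ i j, c * e K i j ∈ F K) {f : I₁ K} (hf : f ∈ F K) :
      c * f ∈ F K := by
    induction hf using Submodule.span_induction with
    | mem y hy => obtain ⟨i, j, rfl⟩ := hy; exact hc i j
    | zero => simp
    | add y z _ _ hy hz => rw [mul_add]; exact add_mem hy hz
    | smul r y _ hy => rw [mul_smul_comm]; exact Submodule.smul_mem _ _ hy
  have main (y : Module.End K K[X]) (hy : y ∈ Algebra.adjoin K
      {LinearMap.mulLeft K (X : K[X]), Polynomial.derivative, integrate K}) :
      ∀ c : I₁ K, toEnd K c = y → ∀ f ∈ F K, c * f ∈ F K := by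
    induction hy using Algebra.adjoin_induction with
    | mem y hy =>
      intro c hc f hf
      rcases hy with rfl | rfl | rfl
      · rw [← toEnd_xOp] at hc
        obtain rfl := toEnd_injective hc
        refine key (xOp K) (fun i j => ?_) hf
        rw [xOp_eq, mul_assoc, H_mul_e, mul_smul_comm, int_mul_e]
        exact Submodule.smul_mem _ _ (he _ _)
      · rw [← toEnd_del] at hc
        obtain rfl := toEnd_injective hc
        refine key (del K) (fun i j => ?_) hf
        rcases i with _ | i
        · rw [del_mul_e_zero]; exact zero_mem _
        · rw [del_mul_e_succ]; exact he _ _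
      · rw [← toEnd_int] at hc
        obtain rfl := toEnd_injective hc
        refine key (int K) (fun i j => ?_) hf
        rw [int_mul_e]; exact he _ _
    | algebraMap r =>
      intro c hc f hf
      rw [← AlgHom.commutes (toEnd K)] at hc
      obtain rfl := toEnd_injective hc
      rw [← Algebra.smul_def]
      exact Submodule.smul_mem _ _ hf
    | add y z hy hz ihy ihz =>
      intro c hc f hf
      obtain ⟨y, rfl⟩ : ∃ y', toEnd K y' = y := ⟨⟨y, hy⟩, rfl⟩
      obtain ⟨z, rfl⟩ : ∃ z', toEnd K z' = z := ⟨⟨z, hz⟩, rfl⟩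
      rw [← map_add] at hc
      obtain rfl := toEnd_injective hc
      rw [add_mul]
      exact add_mem (ihy y rfl f hf) (ihz z rfl f hf)
    | mul y z hy hz ihy ihz =>
      intro c hc f hf
      obtain ⟨y, rfl⟩ : ∃ y', toEnd K y' = y := ⟨⟨y, hy⟩, rfl⟩
      obtain ⟨z, rfl⟩ : ∃ z', toEnd K z' = z := ⟨⟨z, hz⟩, rfl⟩
      rw [← map_mul] at hc
      obtain rfl := toEnd_injective hc
      rw [mul_assoc]
      exact ihy y rfl _ (ihz z rfl f hf)
  exact main (toEnd K b) b.2 b rfl f hf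

end FisLeftIdeal

/-! ### The canonical form and the extreme degrees -/

/-- `v_i = ∫ ^ i` for `i ≥ 0` and `v_i = ∂ ^ |i|` for `i < 0`. -/
def v (i : ℤ) : I₁ K := if 0 ≤ i then int K ^ i.toNat else del K ^ (-i).toNat

/-- The element `∑ b_i(H) v_i + ∑ l_{ij} e_{ij}` with coefficients `b_i ∈ K[H]`, `l_{ij} ∈ K`.
Every element of `𝕀₁` has a unique such presentation. -/
def canonical (b : ℤ →₀ K[X]) (l : ℕ × ℕ →₀ K) : I₁ K :=
  (b.sum fun i p => aeval (H K) p * v K i) + l.sum fun ij c => c • e K ij.1 ij.2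

variable {K}

/-- `π₊(a) = m`: the largest `i` with `b_i ≠ 0` in the canonical form of `a` is `m`. -/
def IsPiPlus (a : I₁ K) (m : ℤ) : Prop :=
  ∃ b l, a = canonical K b l ∧ IsGreatest {i | b i ≠ 0} m

/-- `π₋(a) = m`: the least `i` with `b_i ≠ 0` in the canonical form of `a` is `m`. -/
def IsPiMinus (a : I₁ K) (m : ℤ) : Prop :=
  ∃ b l, a = canonical K b l ∧ IsLeast {i | b i ≠ 0} m

/-! ### Centralizers -/

/-- The centralizer `Cen(a)` of `a` in `𝕀₁`. -/
def Cen (a : I₁ K) : Subalgebra K (I₁ K) := Subalgebra.centralizer K {a}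

/-- `a` as an element of its centralizer. -/
def self (a : I₁ K) : Cen a :=
  ⟨a, Subalgebra.mem_centralizer_iff K |>.2 fun g hg => by rw [Set.mem_singleton_iff.1 hg]⟩

/-- `K[a]`, as a subalgebra of `Cen(a)`; so `Cen(a)` and all of its left ideals are `K[a]`-modules
by multiplication. -/
abbrev Kadj (a : I₁ K) : Subalgebra K (Cen a) := Algebra.adjoin K {self a}

/-- `Cen_F(a) = F ∩ Cen(a)`, as a left ideal of `Cen(a)`. -/
def CenF [CharZero K] (a : I₁ K) : Ideal (Cen a) where
  carrier := {c | (c : I₁ K) ∈ F K}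
  add_mem' := fun hx hy => (F K).add_mem hx hy
  zero_mem' := (F K).zero_mem
  smul_mem' := fun c _ hx => mul_mem_F (c : I₁ K) hx

/-- The `K[t]`-torsion of `Cen(a)`, where `t` acts as multiplication by `a`. -/
def torsion (a : I₁ K) : Set (Cen a) := {c | ∃ p : K[X], p ≠ 0 ∧ aeval (self a) p * c = 0}

/-- The rank of `Cen(a)` as a `K[t]`-module, where `t` acts as multiplication by `a`:
the dimension over `K(t)` of `K(t) ⊗_{K[t]} Cen(a)`. -/
def cenRank (a : I₁ K) : Cardinal.{u} :=
  Module.rank (RatFunc K) (RatFunc K ⊗[K[X]] Module.AEval K (Cen a) (self a))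

/-! ### General notions for a `K`-algebra -/

section General

variable (K) (A : Type u) [Ring A] [Algebra K A]

/-- The commutant `[A, A]`, the linear span of all commutators. -/
def commutant : Submodule K A := Submodule.span K {c | ∃ x y : A, c = x * y - y * x}

/-- `A` contains an infinite direct sum of nonzero left ideals. -/
def HasInfiniteSumOfLeftIdeals : Prop :=
  ∃ I : ℕ → Submodule A A, iSupIndep I ∧ ∀ n, I n ≠ ⊥

/-- `A` contains an infinite direct sum of nonzero right ideals. -/
def HasInfiniteSumOfRightIdeals : Prop :=
  ∃ I : ℕ → Submodule Aᵐᵒᵖ A, iSupIndep I ∧ ∀ n, I n ≠ ⊥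

end General

/-! ### The `F`-degree and the block decomposition -/

section Blocks

variable (K) in
/-- `F_{≤ d}`, the span of the `e_{ij}` with `i, j ≤ d`. -/
def Fle (d : ℤ) : Submodule K (I₁ K) :=
  Submodule.span K {b | ∃ i j : ℕ, (i : ℤ) ≤ d ∧ (j : ℤ) ≤ d ∧ b = e K i j}

open Classical in
/-- The `F`-degree of an element of `F`: the least `n` with `f ∈ F_{≤ n}`, and `-1` for `f = 0`. -/
def degF (f : I₁ K) : ℤ := if f = 0 then -1 else ((sInf {n : ℕ | f ∈ Fle K n} : ℕ) : ℤ)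

variable (K) in
/-- `e_d' = 1 - (e_{00} + ⋯ + e_{dd})`. -/
def ePrime (d : ℤ) : I₁ K := 1 - ∑ i ∈ Finset.range (d + 1).toNat, e K i i

variable (K) in
/-- `𝓗₀`, the span of the `e_{i0}` with `i ≤ d`. -/
def H0 (d : ℤ) : Submodule K (I₁ K) :=
  Submodule.span K {b | ∃ i : ℕ, (i : ℤ) ≤ d ∧ b = e K i 0}

variable (K) in
/-- `𝓥₀`, the span of the `e_{0j}` with `j ≤ d`. -/
def V0 (d : ℤ) : Submodule K (I₁ K) :=
  Submodule.span K {b | ∃ j : ℕ, (j : ℤ) ≤ d ∧ b = e K 0 j}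

/-- `ker_{𝓗₀}(g ·) e_{0j}`. -/
def kerLeft (d : ℤ) (g : I₁ K) (j : ℕ) : Submodule K (I₁ K) :=
  (H0 K d ⊓ LinearMap.ker (LinearMap.mulLeft K g)).map (LinearMap.mulRight K (e K 0 j))

/-- `e_{i0} ker_{𝓥₀}(· g)`. -/
def kerRight (d : ℤ) (g : I₁ K) (i : ℕ) : Submodule K (I₁ K) :=
  (V0 K d ⊓ LinearMap.ker (LinearMap.mulRight K g)).map (LinearMap.mulLeft K (e K i 0))

/-- The centralizer of `g` in `F_{≤ d}`. -/
def CenFle (d : ℤ) (g : I₁ K) : Submodule K (I₁ K) :=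
  Fle K d ⊓ Subalgebra.toSubmodule (Cen g)

/-- `a₁₁ = ∑_{i ≤ d} α(i + 1) e_{ii} + f`. -/
def a₁₁ (d : ℤ) (α : K[X]) (f : I₁ K) : I₁ K :=
  (∑ i ∈ Finset.range (d + 1).toNat, α.eval ((i : K) + 1) • e K i i) + f

/-- `e_d' K[H]`. -/
def ePrimeKH (d : ℤ) : Submodule K (I₁ K) := (KH K).map (LinearMap.mulLeft K (ePrime K d))

/-- `e_d' 𝕀₁ e_d'`. -/
def ePrimeI (d : ℤ) : Submodule K (I₁ K) :=
  LinearMap.range (LinearMap.mulLeft K (ePrime K d) ∘ₗ LinearMap.mulRight K (ePrime K d))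

/-- `j + 1` is a root of `τ ^ i (α) - α`, where `τ(H) = H + 1`. -/
def IsShiftRoot (α : K[X]) (i j : ℕ) : Prop :=
  (α.comp (X + C (i : K)) - α).IsRoot ((j : K) + 1)

/-- Indices of the summands of `Cen_F(a)` for `a = α + f`. -/
inductive Index₂ (d : ℤ) (α : K[X]) : Type u
  | diag (j : ℕ) (hj : d < j)
  | lower (i j : ℕ) (hi : 1 ≤ i) (hj : d < j) (h : IsShiftRoot α i j)
  | upper (i j : ℕ) (hi : 1 ≤ i) (hj : d < j) (h : IsShiftRoot α i j)
  | corner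
  | left (j : ℕ) (hj : d < j)
  | right (i : ℕ) (hi : d < i)

/-- The summands of `Cen_F(a)` for `a = α + f`. The sum of the `lower` ones is `C_{α, d}`, the sum
of the `upper` ones is its image `C_{α, d}^*` under the involution `e_{ij} ↦ e_{ji}`. -/
def summand₂ (d : ℤ) (α : K[X]) (f : I₁ K) : Index₂ d α → Submodule K (I₁ K)
  | .diag j _ => Submodule.span K {e K j j}
  | .lower i j _ _ _ => Submodule.span K {e K (i + j) j}
  | .upper i j _ _ _ => Submodule.span K {e K j (i + j)}
  | .corner => CenFle d (a₁₁ d α f)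
  | .left j _ => kerLeft d (a₁₁ d α f - algebraMap K (I₁ K) (α.eval ((j : K) + 1))) j
  | .right i _ => kerRight d (a₁₁ d α f - algebraMap K (I₁ K) (α.eval ((i : K) + 1))) i

/-- Indices of the summands of `Cen(a)` for `a = c + f` with `c ∈ K`. -/
inductive Index₃ (d : ℤ) : Type
  | corner
  | left (j : ℕ) (hj : d < j)
  | right (i : ℕ) (hi : d < i)
  | big

/-- The summands of `Cen(a)` for `a = c + f` with `c ∈ K`. -/
def summand₃ (d : ℤ) (f : I₁ K) : Index₃ d → Submodule K (I₁ K)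
  | .corner => CenFle d f
  | .left j _ => kerLeft d f j
  | .right i _ => kerRight d f i
  | .big => ePrimeI d

end Blocks

end IntDiff

end

open IntDiff

/-! In the divided power basis x^n/n! the elements of 𝕀₁ become infinite matrices: ∫ and ∂ are the
two shifts, H is diagonal with entries n + 1, and the e_{ij} are the matrix units. So F consists of
the finitely supported matrices, and every element of 𝕀₁ is a band matrix whose k-th diagonal i - j
= k is, up to finitely many entries, i ↦ b_k(i + 1) for a polynomial b_k. In characteristic zero
such values determine b_k.

The free part of Cen(a) comes from one abstract statement, `IsLevel.exists_basis`. Suppose levels in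
ℕ add up under multiplication, elements of equal level are proportional modulo lower levels and an
ideal I, and s is central of level m > 0. The classes of levels modulo m form a subgroup of ℤ/m, of
order ρ say. One element of least level in each class gives a basis over K[s] modulo I, hence ρ
divides m. The subgroup is cyclic, so every element depends over K[s], modulo I, on the powers of a
single x; as levels leave no zero divisors modulo I, commutators lie in I. This is applied with s =
a and I = Cen_F(a).

For a ∉ K[H] + F, after a transposition if necessary, a has positive top degree m and so raises the
degree of every polynomial of large degree by m. An element commuting with a cannot have negative
top degree: a power of it would lower degrees by more than the dimension of its kernel permits
(`HasTop.nonneg_of_commute`). The quotient of the leading coefficients of two such elements of equal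
top degree is m-periodic, hence constant (`HasTop.proportional`). So the top degree is a level.
Degree raising also bounds Cen_F(a): its elements have image in bounded degree and are determined by
their values in bounded degree.

For a = α + f the matrix is block diagonal: a finite corner, and the diagonal matrix with entries
α(i + 1) outside it. The Peirce decomposition with respect to the corner idempotent gives all the
summands. If α is not constant, comparing entries gives Cen(a) ⊆ K[H] + F; the degree of the
K[H]-part is a level and takes every value, so ρ = deg α. If α is constant, the outer block of
Cen(a) is the whole of e_d' 𝕀₁ e_d', a copy of 𝕀₁, which yields finite generation and a commutator
outside F. In both cases the e_{jj} with j > d are orthogonal idempotents in Cen(a) and give the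
infinite direct sums of one-sided ideals. -/

namespace IntDiff

/-! ### Matrices in the divided power basis, and existence of the canonical form -/

section Representation

variable {K : Type*} [Field K]

lemma exists_abs_le_of_finsupp (p : ℤ →₀ K[X]) : ∃ B : ℕ, ∀ k : ℤ, (B : ℤ) < |k| → p k = 0 := by
  refine ⟨p.support.sup Int.natAbs, fun k hk => ?_⟩
  by_contra h
  have := Finset.le_sup (f := Int.natAbs) (Finsupp.mem_support_iff.2 h)
  rw [Int.abs_eq_natAbs] at hk
  omega

/-- Induction on the generators of `𝕀₁`. -/
lemma generator_induction {P : I₁ K → Prop} (hx : P (xOp K)) (hd : P (del K)) (hi : P (int K))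
    (hs : ∀ c, P (algebraMap K (I₁ K) c)) (hadd : ∀ b c, P b → P c → P (b + c))
    (hmul : ∀ b c, P b → P c → P (b * c)) (b : I₁ K) : P b := by
  have main (y : Module.End K K[X]) (hy : y ∈ Algebra.adjoin K
      {LinearMap.mulLeft K (X : K[X]), Polynomial.derivative, integrate K}) :
      ∀ c : I₁ K, toEnd K c = y → P c := by
    induction hy using Algebra.adjoin_induction with
    | mem y hy =>
      intro c hc
      rcases hy with rfl | rfl | rfl
      · rw [← toEnd_xOp] at hc
        rwa [toEnd_injective hc]
      · rw [← toEnd_del] at hc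
        rwa [toEnd_injective hc]
      · rw [← toEnd_int] at hc
        rwa [toEnd_injective hc]
    | algebraMap r =>
      intro c hc
      rw [← AlgHom.commutes (toEnd K)] at hc
      rw [toEnd_injective hc]
      exact hs r
    | add y z hy hz ihy ihz =>
      intro c hc
      obtain ⟨y, rfl⟩ : ∃ y', toEnd K y' = y := ⟨⟨y, hy⟩, rfl⟩
      obtain ⟨z, rfl⟩ : ∃ z', toEnd K z' = z := ⟨⟨z, hz⟩, rfl⟩
      rw [← map_add] at hc
      rw [toEnd_injective hc]
      exact hadd _ _ (ihy y rfl) (ihz z rfl)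
    | mul y z hy hz ihy ihz =>
      intro c hc
      obtain ⟨y, rfl⟩ : ∃ y', toEnd K y' = y := ⟨⟨y, hy⟩, rfl⟩
      obtain ⟨z, rfl⟩ : ∃ z', toEnd K z' = z := ⟨⟨z, hz⟩, rfl⟩
      rw [← map_mul] at hc
      rw [toEnd_injective hc]
      exact hmul _ _ (ihy y rfl) (ihz z rfl)
  exact main (toEnd K b) b.2 b rfl

variable [CharZero K]

variable (K) in
/-- The rescaling `x ^ n ↦ n! x ^ n` of `K[x]`. -/
noncomputable def factorialScale : K[X] ≃ₗ[K] K[X] :=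
  LinearEquiv.ofLinearMap
    (Polynomial.lsum fun n => (n.factorial : K) • Polynomial.monomial n)
    (Polynomial.lsum fun n => (n.factorial : K)⁻¹ • Polynomial.monomial n)
    (Polynomial.lhom_ext' fun n => LinearMap.ext fun c => by
      have h : (n.factorial : K) ≠ 0 := by exact_mod_cast n.factorial_ne_zero
      simp [Polynomial.lsum_apply, Polynomial.smul_monomial, h])
    (Polynomial.lhom_ext' fun n => LinearMap.ext fun c => by
      have h : (n.factorial : K) ≠ 0 := by exact_mod_cast n.factorial_ne_zero
      simp [Polynomial.lsum_apply, Polynomial.smul_monomial, h])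

lemma factorialScale_monomial (n : ℕ) (c : K) :
    factorialScale K (monomial n c) = monomial n (n.factorial * c) := by
  simp [factorialScale, Polynomial.lsum_apply, Polynomial.smul_monomial]

lemma factorialScale_symm_monomial (n : ℕ) (c : K) :
    (factorialScale K).symm (monomial n c) = monomial n ((n.factorial : K)⁻¹ * c) := by
  simp [factorialScale, Polynomial.lsum_apply, Polynomial.smul_monomial]

variable (K) in
/-- The action of `𝕀₁` on `K[x]`, written in the divided power basis. -/
noncomputable def rep : I₁ K →ₐ[K] Module.End K K[X] :=
  ((factorialScale K).conjAlgEquiv K).toAlgHom.comp (toEnd K)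

lemma rep_apply (b : I₁ K) (p : K[X]) :
    rep K b p = factorialScale K (toEnd K b ((factorialScale K).symm p)) := rfl

lemma rep_injective : Function.Injective (rep K) :=
  ((factorialScale K).conjAlgEquiv K).injective.comp toEnd_injective

lemma rep_int (n : ℕ) (c : K) : rep K (int K) (monomial n c) = monomial (n + 1) c := by
  rw [rep_apply, factorialScale_symm_monomial, toEnd_int, integrate_monomial,
    factorialScale_monomial]
  have h : (n.factorial : K) ≠ 0 := by exact_mod_cast n.factorial_ne_zero
  have h' : (n : K) + 1 ≠ 0 := by exact_mod_cast n.succ_ne_zero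
  congr 1
  rw [Nat.factorial_succ]
  push_cast
  field_simp

lemma rep_del_succ (n : ℕ) (c : K) : rep K (del K) (monomial (n + 1) c) = monomial n c := by
  rw [← rep_int, ← Module.End.mul_apply, ← map_mul, del_mul_int, map_one, Module.End.one_apply]

lemma rep_del_zero (c : K) : rep K (del K) (monomial 0 c) = 0 := by
  rw [rep_apply, factorialScale_symm_monomial, toEnd_del]
  simp

lemma rep_H (n : ℕ) (c : K) :
    rep K (H K) (monomial n c) = monomial n (((n : K) + 1) * c) := by
  have h : (n.factorial : K) ≠ 0 := by exact_mod_cast n.factorial_ne_zero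
  rw [rep_apply, factorialScale_symm_monomial, H, map_mul, Module.End.mul_apply, toEnd_xOp,
    toEnd_del, LinearMap.mulLeft_apply, X_mul_monomial, derivative_monomial,
    factorialScale_monomial]
  congr 1
  push_cast
  field_simp

/-- The matrix entries of `b ∈ 𝕀₁` in the divided power basis. -/
noncomputable def entry (i j : ℕ) : I₁ K →ₗ[K] K :=
  Polynomial.lcoeff K i ∘ₗ LinearMap.applyₗ (monomial j (1 : K)) ∘ₗ (rep K).toLinearMap

lemma entry_apply (i j : ℕ) (b : I₁ K) : entry i j b = (rep K b (monomial j 1)).coeff i := rfl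

lemma rep_monomial (b : I₁ K) (j : ℕ) (c : K) :
    rep K b (monomial j c) = c • rep K b (monomial j 1) := by
  rw [← map_smul, smul_monomial, smul_eq_mul, mul_one]

lemma coeff_rep (b : I₁ K) (p : K[X]) (i : ℕ) :
    (rep K b p).coeff i = p.sum fun j c => entry i j b * c := by
  conv_lhs => rw [← sum_monomial_eq p]
  rw [Polynomial.sum_def, map_sum, finsetSum_coeff, Polynomial.sum_def]
  refine Finset.sum_congr rfl fun j _ => ?_
  rw [rep_monomial, coeff_smul, smul_eq_mul, mul_comm, entry_apply]

lemma ext_entry {b c : I₁ K} (h : ∀ i j, entry i j b = entry i j c) : b = c :=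
  rep_injective <| Polynomial.lhom_ext' fun j => LinearMap.ext_ring <| Polynomial.ext fun i => h i j

/-- The k-th column of c is the coefficient sequence of a polynomial, so the sum has finite support
and the `finsum` does not take its default value. -/
lemma entry_mul (b c : I₁ K) (i k : ℕ) :
    entry i k (b * c) = ∑ᶠ j, entry i j b * entry j k c := by
  rw [entry_apply, map_mul, Module.End.mul_apply, coeff_rep, Polynomial.sum_def,
    finsum_eq_sum_of_support_subset]
  · rfl
  · intro j hj
    simp only [Function.mem_support] at hj
    exact mem_support_iff.2 (right_ne_zero_of_mul hj)

lemma entry_one (i j : ℕ) : entry i j (1 : I₁ K) = if i = j then 1 else 0 := by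
  rw [entry_apply, map_one, Module.End.one_apply, coeff_monomial]
  simp [eq_comm]

lemma entry_zero_int_mul (b : I₁ K) (j : ℕ) : entry 0 j (int K * b) = 0 := by
  have h (p : K[X]) : (rep K (int K) p).coeff 0 = 0 := by
    rw [coeff_rep]
    refine Finset.sum_eq_zero fun j _ => ?_
    simp [entry_apply, rep_int, coeff_monomial]
  rw [entry_apply, map_mul, Module.End.mul_apply, h]

lemma entry_del_mul (b : I₁ K) (i j : ℕ) : entry i j (del K * b) = entry (i + 1) j b := by
  rw [entry_mul, finsum_eq_single _ (i + 1)]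
  · simp [entry_apply i, rep_del_succ]
  · rintro (_ | k) hk
    · rw [entry_apply i, rep_del_zero, coeff_zero, zero_mul]
    · rw [entry_apply i, rep_del_succ, coeff_monomial, if_neg (by omega), zero_mul]

lemma entry_succ_int_mul (b : I₁ K) (i j : ℕ) : entry (i + 1) j (int K * b) = entry i j b := by
  rw [← entry_del_mul, ← mul_assoc, del_mul_int, one_mul]

lemma entry_H (i j : ℕ) : entry i j (H K) = if i = j then (j : K) + 1 else 0 := by
  rw [entry_apply, rep_H, coeff_monomial, mul_one]
  simp [eq_comm]

lemma rep_aeval_H (p : K[X]) (n : ℕ) (c : K) :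
    rep K (aeval (H K) p) (monomial n c) = monomial n (p.eval ((n : K) + 1) * c) := by
  induction p using Polynomial.induction_on' with
  | add p q hp hq => simp [hp, hq, add_mul]
  | monomial k r =>
    have h : ∀ k, rep K (H K ^ k) (monomial n c) = monomial n (((n : K) + 1) ^ k * c) := by
      intro k
      induction k with
      | zero => simp
      | succ k ih =>
        rw [pow_succ', map_mul, Module.End.mul_apply, ih, rep_H, pow_succ', mul_assoc]
    rw [aeval_monomial, ← Algebra.smul_def, map_smul, LinearMap.smul_apply, h, eval_monomial,
      smul_monomial, smul_eq_mul, mul_assoc]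

lemma entry_aeval_H (p : K[X]) (i j : ℕ) :
    entry i j (aeval (H K) p) = if i = j then p.eval ((i : K) + 1) else 0 := by
  rw [entry_apply, rep_aeval_H, coeff_monomial, mul_one]
  split_ifs with h1 h2 h2
  · rw [h1]
  · exact absurd h1.symm h2
  · exact absurd h2.symm h1
  · rfl

lemma entry_aeval_H_mul (p : K[X]) (b : I₁ K) (i j : ℕ) :
    entry i j (aeval (H K) p * b) = p.eval ((i : K) + 1) * entry i j b := by
  rw [entry_mul, finsum_eq_single _ i]
  · rw [entry_aeval_H, if_pos rfl]
  · intro k hk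
    rw [entry_aeval_H, if_neg hk.symm, zero_mul]

lemma entry_mul_aeval_H (p : K[X]) (b : I₁ K) (i j : ℕ) :
    entry i j (b * aeval (H K) p) = entry i j b * p.eval ((j : K) + 1) := by
  rw [entry_mul, finsum_eq_single _ j]
  · rw [entry_aeval_H, if_pos rfl]
  · intro k hk
    rw [entry_aeval_H, if_neg hk, mul_zero]

lemma entry_algebraMap (c : K) (i j : ℕ) :
    entry i j (algebraMap K (I₁ K) c) = if i = j then c else 0 := by
  rw [Algebra.algebraMap_eq_smul_one, map_smul, entry_one, smul_eq_mul, mul_ite, mul_one, mul_zero]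

lemma entry_int_pow (k i j : ℕ) : entry i j (int K ^ k) = if i = j + k then 1 else 0 := by
  induction k generalizing i with
  | zero => rw [pow_zero, entry_one]; rfl
  | succ k ih =>
    rw [pow_succ']
    rcases i with _ | i
    · rw [entry_zero_int_mul, if_neg (by omega)]
    · rw [entry_succ_int_mul, ih]
      exact if_congr (by omega) rfl rfl

lemma entry_del_pow (k i j : ℕ) : entry i j (del K ^ k) = if i + k = j then 1 else 0 := by
  induction k generalizing i with
  | zero => rw [pow_zero, entry_one]; rfl
  | succ k ih =>
    rw [pow_succ', entry_del_mul, ih]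
    exact if_congr (by omega) rfl rfl

lemma entry_int_pow_mul_del_pow (k l i j : ℕ) :
    entry i j (int K ^ k * del K ^ l) = if k ≤ i ∧ l ≤ j ∧ i + l = j + k then 1 else 0 := by
  induction k generalizing i with
  | zero =>
    rw [pow_zero, one_mul, entry_del_pow]
    exact if_congr (by omega) rfl rfl
  | succ k ih =>
    rw [pow_succ', mul_assoc]
    rcases i with _ | i
    · rw [entry_zero_int_mul, if_neg (by omega)]
    · rw [entry_succ_int_mul, ih]
      exact if_congr (by omega) rfl rfl

lemma entry_e (k l i j : ℕ) : entry i j (e K k l) = if i = k ∧ j = l then 1 else 0 := by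
  rw [e, map_sub, entry_int_pow_mul_del_pow, entry_int_pow_mul_del_pow]
  by_cases h : i = k ∧ j = l
  · rw [if_pos (by omega), if_neg (by omega), if_pos h, sub_zero]
  · rw [if_neg h]
    by_cases h' : k + 1 ≤ i ∧ l + 1 ≤ j ∧ i + (l + 1) = j + (k + 1)
    · rw [if_pos (by omega), if_pos h', sub_self]
    · rw [if_neg (by omega), if_neg h', sub_self]

lemma entry_v (k : ℤ) (i j : ℕ) : entry i j (v K k) = if (i : ℤ) - j = k then 1 else 0 := by
  rw [v]
  split_ifs with h1 h2 h2
  · rw [entry_int_pow, if_pos (by omega)]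
  · rw [entry_int_pow, if_neg (by omega)]
  · rw [entry_del_pow, if_pos (by omega)]
  · rw [entry_del_pow, if_neg (by omega)]

/-- Since v_k is the indicator of the diagonal i - j = k and K[H] acts diagonally, each entry sees a
single b_k. The polynomial is evaluated at the row index because it stands to the left of v_k. -/
lemma entry_canonical (p : ℤ →₀ K[X]) (l : ℕ × ℕ →₀ K) (i j : ℕ) :
    entry i j (canonical K p l) = (p ((i : ℤ) - j)).eval ((i : K) + 1) + l (i, j) := by
  rw [canonical, map_add, Finsupp.sum, Finsupp.sum, map_sum, map_sum]
  congr 1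
  · rw [Finset.sum_eq_single ((i : ℤ) - j)]
    · rw [entry_aeval_H_mul, entry_v, if_pos rfl, mul_one]
    · intro k _ hk
      rw [entry_aeval_H_mul, entry_v, if_neg hk.symm, mul_zero]
    · intro h
      rw [Finsupp.notMem_support_iff.1 h]
      simp
  · rw [Finset.sum_eq_single (i, j)]
    · rw [map_smul, entry_e, if_pos ⟨rfl, rfl⟩, smul_eq_mul, mul_one]
    · intro k _ hk
      rw [map_smul, entry_e, if_neg, smul_zero]
      rintro ⟨rfl, rfl⟩
      exact hk rfl
    · intro h
      rw [Finsupp.notMem_support_iff.1 h, zero_smul, map_zero]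

/-- An element whose matrix agrees with that of `∑ p_k(H) v_k` at all but finitely many places
has the canonical form `∑ p_k(H) v_k + ∑ l_{ij} e_{ij}`. -/
lemma exists_eq_canonical_of_eventually {b : I₁ K} (p : ℤ → K[X]) (B N : ℕ)
    (hp : ∀ k : ℤ, (B : ℤ) < |k| → p k = 0)
    (h : ∀ i j : ℕ, N ≤ i + j → entry i j b = (p ((i : ℤ) - j)).eval ((i : K) + 1)) :
    ∃ q l, (∀ k, q k = p k) ∧ b = canonical K q l := by
  classical
  refine ⟨Finsupp.onFinset (Finset.Icc (-(B : ℤ)) B) p ?_,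
    Finsupp.onFinset (Finset.range N ×ˢ Finset.range N)
    (fun ij => entry ij.1 ij.2 b - (p ((ij.1 : ℤ) - ij.2)).eval ((ij.1 : K) + 1)) ?_,
    fun k => rfl, ?_⟩
  · intro k hk
    rw [Finset.mem_Icc, ← abs_le]
    exact not_lt.1 fun h => hk (hp k h)
  · rintro ⟨i, j⟩ hij
    by_contra hN
    refine hij (sub_eq_zero.2 (h i j ?_))
    simp only [Finset.mem_product, Finset.mem_range, not_and_or, not_lt] at hN
    omega
  · refine ext_entry fun i j => ?_
    rw [entry_canonical]
    simp

lemma canonical_eventually (p : ℤ →₀ K[X]) (l : ℕ × ℕ →₀ K) :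
    ∃ N : ℕ, ∀ i j : ℕ, N ≤ i + j →
      entry i j (canonical K p l) = (p ((i : ℤ) - j)).eval ((i : K) + 1) := by
  refine ⟨l.support.sup (fun ij => ij.1 + ij.2) + 1, fun i j hij => ?_⟩
  rw [entry_canonical, show l (i, j) = 0 from ?_, add_zero]
  by_contra hl
  replace hl := Finsupp.mem_support_iff.2 hl
  have := Finset.le_sup (f := fun ij : ℕ × ℕ => ij.1 + ij.2) hl
  simp only at this
  omega

/-- Every element of `𝕀₁` has a canonical form. -/
theorem exists_canonical (b : I₁ K) : ∃ p l, b = canonical K p l := by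
  -- P says that the matrix is a band of polynomial diagonals up to finitely many entries. It holds
  -- for 1 and is stable under left multiplication by the generators, hence holds for all of 𝕀₁.
  let P (b : I₁ K) : Prop := ∃ (p : ℤ → K[X]) (B N : ℕ), (∀ k : ℤ, (B : ℤ) < |k| → p k = 0) ∧
    ∀ i j : ℕ, N ≤ i + j → entry i j b = (p ((i : ℤ) - j)).eval ((i : K) + 1)
  have hint (c : I₁ K) (hc : P c) : P (int K * c) := by
    obtain ⟨p, B, N, hp, h⟩ := hc
    refine ⟨fun k => (p (k - 1)).comp (X - C 1), B + 1, N + B + 1, fun k hk => ?_,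
      fun i j hij => ?_⟩
    · simp only
      rw [hp _ (by rw [lt_abs] at *; omega), zero_comp]
    · rcases i with _ | i
      -- Row 0 is new after the shift and vanishes; the predicted value vanishes too, because in row
      -- 0 a large i + j lies outside the band.
      · rw [entry_zero_int_mul]
        simp only
        rw [hp _ (by rw [lt_abs]; omega), zero_comp, eval_zero]
      · rw [entry_succ_int_mul, h i j (by omega)]
        have : ((i + 1 : ℕ) : ℤ) - j - 1 = i - j := by push_cast; ring
        simp only [this, eval_comp]
        simp
  have hdel (c : I₁ K) (hc : P c) : P (del K * c) := by
    obtain ⟨p, B, N, hp, h⟩ := hc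
    refine ⟨fun k => (p (k + 1)).comp (X + C 1), B + 1, N, fun k hk => ?_, fun i j hij => ?_⟩
    · simp only
      rw [hp _ (by rw [lt_abs] at *; omega), zero_comp]
    · rw [entry_del_mul, h (i + 1) j (by omega)]
      have : ((i + 1 : ℕ) : ℤ) - j = i - j + 1 := by push_cast; ring
      simp only [this, eval_comp]
      simp
  have hH (c : I₁ K) (hc : P c) : P (H K * c) := by
    obtain ⟨p, B, N, hp, h⟩ := hc
    refine ⟨fun k => X * p k, B, N, fun k hk => ?_, fun i j hij => ?_⟩
    · simp only
      rw [hp _ hk, mul_zero]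
    · have := entry_aeval_H_mul X c i j
      rw [aeval_X] at this
      simp only
      rw [this, h i j hij, eval_mul]
  have hsmul (r : K) (c : I₁ K) (hc : P c) : P (algebraMap K _ r * c) := by
    obtain ⟨p, B, N, hp, h⟩ := hc
    refine ⟨fun k => r • p k, B, N, fun k hk => ?_, fun i j hij => ?_⟩
    · simp only
      rw [hp _ hk, smul_zero]
    · simp only
      rw [← Algebra.smul_def, map_smul, h i j hij, eval_smul]
  have hadd (c c' : I₁ K) (hc : P c) (hc' : P c') : P (c + c') := by
    obtain ⟨p, B, N, hp, h⟩ := hc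
    obtain ⟨p', B', N', hp', h'⟩ := hc'
    refine ⟨fun k => p k + p' k, B + B', N + N', fun k hk => ?_, fun i j hij => ?_⟩
    · simp only
      rw [hp _ (by omega), hp' _ (by omega), add_zero]
    · simp only
      rw [map_add, h i j (by omega), h' i j (by omega), eval_add]
  have hone : P 1 := by
    refine ⟨fun k => if k = 0 then 1 else 0, 0, 0, fun k hk => ?_, fun i j _ => ?_⟩
    · simp only
      rw [if_neg]
      rintro rfl
      simp at hk
    · rw [entry_one]
      simp only
      by_cases hij : i = j
      · simp [hij]
      · rw [if_neg hij, if_neg (by omega), eval_zero]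
  have hmul (b : I₁ K) : ∀ c, P c → P (b * c) := by
    induction b using generator_induction with
    | hx => intro c hc; rw [xOp_eq, mul_assoc]; exact hint _ (hH _ hc)
    | hd => exact hdel
    | hi => exact hint
    | hs r => exact hsmul r
    | hadd b b' hb hb' => intro c hc; rw [add_mul]; exact hadd _ _ (hb c hc) (hb' c hc)
    | hmul b b' hb hb' => intro c hc; rw [mul_assoc]; exact hb _ (hb' c hc)
  obtain ⟨p, B, N, hp, h⟩ := hmul b 1 hone
  rw [mul_one] at h
  obtain ⟨q, l, -, hb⟩ := exists_eq_canonical_of_eventually p B N hp h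
  exact ⟨q, l, hb⟩

end Representation

/-! ### F as the ideal of finitely supported matrices -/

section Ideal

variable {K : Type*} [Field K] [CharZero K]

omit [CharZero K] in
lemma e_mem_F (i j : ℕ) : e K i j ∈ F K := Submodule.subset_span ⟨i, j, rfl⟩

omit [CharZero K] in
lemma e_mem_Fle {d : ℤ} {i j : ℕ} (hi : (i : ℤ) ≤ d) (hj : (j : ℤ) ≤ d) : e K i j ∈ Fle K d :=
  Submodule.subset_span ⟨i, j, hi, hj, rfl⟩

lemma eq_sum_e {b : I₁ K} (m n : ℕ) (h : ∀ i j : ℕ, m ≤ i ∨ n ≤ j → entry i j b = 0) :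
    b = ∑ i ∈ Finset.range m, ∑ j ∈ Finset.range n, entry i j b • e K i j := by
  refine ext_entry fun i j => ?_
  simp only [map_sum, map_smul, entry_e, smul_eq_mul, mul_ite, mul_one, mul_zero]
  by_cases hi : i < m
  · rw [Finset.sum_eq_single i (fun k _ hk => Finset.sum_eq_zero fun l _ => if_neg (by omega))
      (fun h => absurd (Finset.mem_range.2 hi) h)]
    by_cases hj : j < n
    · rw [Finset.sum_eq_single j (fun l _ hl => if_neg (by omega))
        (fun h => absurd (Finset.mem_range.2 hj) h), if_pos ⟨rfl, rfl⟩]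
    · rw [h i j (by omega), Finset.sum_eq_zero]
      intro l hl
      rw [if_neg]
      rintro ⟨-, rfl⟩
      exact hj (Finset.mem_range.1 hl)
  · rw [h i j (by omega), Finset.sum_eq_zero]
    intro k hk
    refine Finset.sum_eq_zero fun l _ => if_neg ?_
    rintro ⟨rfl, -⟩
    exact hi (Finset.mem_range.1 hk)

lemma mem_Fle_iff {d : ℤ} {b : I₁ K} :
    b ∈ Fle K d ↔ ∀ i j : ℕ, d < i ∨ d < j → entry i j b = 0 := by
  constructor
  · intro h i j hij
    induction h using Submodule.span_induction with
    | mem y hy =>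
      obtain ⟨k, l, hk, hl, rfl⟩ := hy
      rw [entry_e, if_neg]
      omega
    | zero => simp
    | add y z _ _ hy hz => rw [map_add, hy, hz, add_zero]
    | smul r y _ hy => rw [map_smul, hy, smul_zero]
  · intro h
    -- `(d + 1).toNat` is the number of indices at most d; it is 0 for d = -1, where F_{≤ d} = 0.
    rw [eq_sum_e (d + 1).toNat (d + 1).toNat (b := b) fun i j hij => h i j (by omega)]
    refine Submodule.sum_mem _ fun i hi => Submodule.sum_mem _ fun j hj =>
      Submodule.smul_mem _ _ (e_mem_Fle ?_ ?_)
    · rw [Finset.mem_range] at hi; omega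
    · rw [Finset.mem_range] at hj; omega

omit [CharZero K] in
lemma Fle_le_F (d : ℤ) : Fle K d ≤ F K :=
  Submodule.span_mono fun _ ⟨i, j, _, _, h⟩ => ⟨i, j, h⟩

omit [CharZero K] in
lemma Fle_mono {d d' : ℤ} (h : d ≤ d') : Fle K d ≤ Fle K d' :=
  Submodule.span_mono fun _ ⟨i, j, hi, hj, hb⟩ => ⟨i, j, hi.trans h, hj.trans h, hb⟩

omit [CharZero K] in
lemma exists_mem_Fle {b : I₁ K} (hb : b ∈ F K) : ∃ n : ℕ, b ∈ Fle K n := by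
  induction hb using Submodule.span_induction with
  | mem y hy =>
    obtain ⟨i, j, rfl⟩ := hy
    exact ⟨i + j, e_mem_Fle (by push_cast; omega) (by push_cast; omega)⟩
  | zero => exact ⟨0, zero_mem _⟩
  | add y z _ _ hy hz =>
    obtain ⟨m, hm⟩ := hy
    obtain ⟨n, hn⟩ := hz
    exact ⟨m + n, add_mem (Fle_mono (by push_cast; omega) hm) (Fle_mono (by push_cast; omega) hn)⟩
  | smul r y _ hy =>
    obtain ⟨m, hm⟩ := hy
    exact ⟨m, Submodule.smul_mem _ _ hm⟩

lemma mem_F_iff {b : I₁ K} : b ∈ F K ↔ ∃ N : ℕ, ∀ i j : ℕ, N ≤ i + j → entry i j b = 0 := by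
  constructor
  · intro h
    obtain ⟨n, hn⟩ := exists_mem_Fle h
    exact ⟨2 * n + 1, fun i j hij => mem_Fle_iff.1 hn i j (by omega)⟩
  · rintro ⟨N, h⟩
    exact Fle_le_F N (mem_Fle_iff.2 fun i j hij => h i j (by omega))

instance Fle_finiteDimensional (d : ℤ) : FiniteDimensional K (Fle K d) := by
  refine FiniteDimensional.span_of_finite K (Set.Finite.subset (Set.Finite.image
    (fun ij : ℕ × ℕ => e K ij.1 ij.2)
    (Finset.finite_toSet (Finset.range (d + 1).toNat ×ˢ Finset.range (d + 1).toNat))) ?_)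
  rintro _ ⟨i, j, hi, hj, rfl⟩
  refine ⟨(i, j), ?_, rfl⟩
  simp only [Finset.coe_product, Finset.coe_range, Set.mem_prod, Set.mem_Iio]
  omega

/-- Entries far from the diagonal have large i + j, so the same bound also takes care of the
finitely many exceptional entries. -/
lemma entry_band (b : I₁ K) :
    ∃ B : ℕ, ∀ i j : ℕ, (B : ℤ) < |(i : ℤ) - j| → entry i j b = 0 := by
  obtain ⟨p, l, rfl⟩ := exists_canonical b
  obtain ⟨N, hN⟩ := canonical_eventually p l
  obtain ⟨B, hB⟩ := exists_abs_le_of_finsupp p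
  refine ⟨B + N, fun i j hij => ?_⟩
  rw [hN i j (by rw [lt_abs] at hij; omega), hB _ (by omega), eval_zero]

/-- A finite matrix times a band matrix is finite. With `mul_mem_F` this makes F two-sided. -/
lemma mem_F_mul {f : I₁ K} (hf : f ∈ F K) (b : I₁ K) : f * b ∈ F K := by
  obtain ⟨n, hn⟩ := exists_mem_Fle hf
  obtain ⟨B, hB⟩ := entry_band b
  rw [mem_Fle_iff] at hn
  refine mem_F_iff.2 ⟨2 * n + B + 1, fun i k hik => ?_⟩
  rw [entry_mul]
  refine finsum_eq_zero_of_forall_eq_zero fun j => ?_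
  by_cases h : (n : ℤ) < i ∨ (n : ℤ) < j
  · rw [hn i j h, zero_mul]
  · rw [hB j k (by rw [lt_abs]; omega), mul_zero]

lemma one_notMem_F : (1 : I₁ K) ∉ F K := by
  intro h
  obtain ⟨N, hN⟩ := mem_F_iff.1 h
  have := hN N N (by omega)
  rw [entry_one, if_pos rfl] at this
  exact one_ne_zero this

lemma eq_of_eventually_eval_eq {p q : K[X]} (N : ℕ)
    (h : ∀ n : ℕ, N ≤ n → p.eval ((n : K) + 1) = q.eval ((n : K) + 1)) : p = q := by
  refine eq_of_infinite_eval_eq p q (Set.Infinite.mono (s := Set.range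
    fun n : ℕ => ((n + N : ℕ) : K) + 1) ?_ (Set.infinite_range_of_injective ?_))
  · rintro _ ⟨n, rfl⟩
    exact h _ (by omega)
  · intro m n hmn
    have : ((m + N : ℕ) : K) = ((n + N : ℕ) : K) := add_right_cancel hmn
    have := Nat.cast_injective this
    omega

lemma mem_F_of_canonical_zero (l : ℕ × ℕ →₀ K) : canonical K 0 l ∈ F K := by
  obtain ⟨N, hN⟩ := canonical_eventually (0 : ℤ →₀ K[X]) l
  exact mem_F_iff.2 ⟨N, fun i j hij => by rw [hN i j hij]; simp⟩

lemma canonical_sub_mem_F {p : ℤ →₀ K[X]} (l : ℕ × ℕ →₀ K) (h : ∀ i, i ≠ 0 → p i = 0) :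
    canonical K p l - aeval (H K) (p 0) ∈ F K := by
  obtain ⟨N, hN⟩ := canonical_eventually p l
  refine mem_F_iff.2 ⟨N, fun i j hij => ?_⟩
  rw [map_sub, hN i j hij, entry_aeval_H]
  by_cases hij : i = j
  · rw [if_pos hij, hij, sub_self, sub_self]
  · rw [if_neg hij, h _ (by omega), eval_zero, sub_zero]

end Ideal

/-! ### Top degree and leading coefficient modulo F -/

section Top

variable {K : Type*} [Field K] [CharZero K]

omit [CharZero K] in
lemma comp_X_sub_C_ne_zero {β : K[X]} (hβ : β ≠ 0) (c : K) : β.comp (X - C c) ≠ 0 := by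
  rw [Ne, comp_eq_zero_iff, not_or]
  refine ⟨hβ, fun h => ?_⟩
  have := congrArg natDegree h.2
  rw [natDegree_X_sub_C, natDegree_C] at this
  omega

/-- Modulo `F`, the element `b` is `β(H) v_k` plus terms of lower degree. -/
def HasTop (b : I₁ K) (k : ℤ) (β : K[X]) : Prop :=
  ∃ N : ℕ, ∀ i j : ℕ, N ≤ i + j → (k < (i : ℤ) - j → entry i j b = 0) ∧
    ((i : ℤ) - j = k → entry i j b = β.eval ((i : K) + 1))

lemma HasTop.add {b c : I₁ K} {k : ℤ} {β γ : K[X]} (hb : HasTop b k β) (hc : HasTop c k γ) :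
    HasTop (b + c) k (β + γ) := by
  obtain ⟨M, hM⟩ := hb
  obtain ⟨N, hN⟩ := hc
  refine ⟨M + N, fun i j hij => ⟨fun h => ?_, fun h => ?_⟩⟩
  · rw [map_add, (hM i j (by omega)).1 h, (hN i j (by omega)).1 h, add_zero]
  · rw [map_add, (hM i j (by omega)).2 h, (hN i j (by omega)).2 h, eval_add]

lemma HasTop.smul {b : I₁ K} {k : ℤ} {β : K[X]} (hb : HasTop b k β) (c : K) :
    HasTop (c • b) k (c • β) := by
  obtain ⟨N, hN⟩ := hb
  refine ⟨N, fun i j hij => ⟨fun h => ?_, fun h => ?_⟩⟩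
  · rw [map_smul, (hN i j hij).1 h, smul_zero]
  · rw [map_smul, (hN i j hij).2 h, eval_smul]

lemma HasTop.of_lt {b : I₁ K} {k l : ℤ} {β : K[X]} (hb : HasTop b k β) (h : k < l) :
    HasTop b l 0 := by
  obtain ⟨N, hN⟩ := hb
  refine ⟨N, fun i j hij => ⟨fun h' => (hN i j hij).1 (h.trans h'), fun h' => ?_⟩⟩
  rw [(hN i j hij).1 (by omega), eval_zero]

lemma hasTop_of_mem_F {b : I₁ K} (hb : b ∈ F K) (k : ℤ) : HasTop b k 0 := by
  obtain ⟨N, hN⟩ := mem_F_iff.1 hb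
  exact ⟨N, fun i j hij => ⟨fun _ => hN i j hij, fun _ => by rw [hN i j hij, eval_zero]⟩⟩

lemma hasTop_one : HasTop (1 : I₁ K) 0 1 := by
  refine ⟨0, fun i j _ => ⟨fun h => ?_, fun h => ?_⟩⟩
  · rw [entry_one, if_neg (by omega)]
  · rw [entry_one, if_pos (by omega), eval_one]

/-- The twist of γ is the relation v_k γ(H) = γ(H - k) v_k, valid modulo F. -/
lemma HasTop.mul {b c : I₁ K} {k l : ℤ} {β γ : K[X]} (hb : HasTop b k β) (hc : HasTop c l γ) :
    HasTop (b * c) (k + l) (β * γ.comp (X - C (k : K))) := by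
  obtain ⟨M, hM⟩ := hb
  obtain ⟨N, hN⟩ := hc
  -- As i - n = (i - j) + (j - n) is at least k + l, one factor lies above its top diagonal, except
  -- when i - j = k and j - n = l. The bound on i + n forces i ≥ M + N, and j + n ≥ N whenever i - j
  -- ≤ k, so both hypotheses on tops are available.
  have key (i n j : ℕ) (hin : 2 * M + 2 * N + k.natAbs + l.natAbs ≤ i + n)
      (h : k + l ≤ (i : ℤ) - n) (hj : k + l < (i : ℤ) - n ∨ (j : ℤ) ≠ i - k) :
      entry i j b * entry j n c = 0 := by
    by_cases hij : k < (i : ℤ) - j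
    · rw [(hM i j (by omega)).1 hij, zero_mul]
    · rw [(hN j n (by omega)).1 (by omega), mul_zero]
  refine ⟨2 * M + 2 * N + 2 * k.natAbs + 2 * l.natAbs, fun i n hin => ⟨fun h => ?_, fun h => ?_⟩⟩
  · rw [entry_mul]
    exact finsum_eq_zero_of_forall_eq_zero fun j => key i n j (by omega) h.le (Or.inl h)
  · obtain ⟨j, hj⟩ := Int.eq_ofNat_of_zero_le (a := (i : ℤ) - k) (by omega)
    rw [entry_mul,
        finsum_eq_single _ j fun j' hj' => key i n j' (by omega) h.ge (Or.inr (by omega)),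
      (hM i j (by omega)).2 (by omega), (hN j n (by omega)).2 (by omega), eval_mul, eval_comp]
    have : (j : K) = (i : K) - (k : K) := by exact_mod_cast congrArg (Int.cast (R := K)) hj.symm
    rw [this]
    congr 2
    simp
    ring

/-- If l < k, the diagonal k would vanish eventually, although it is given there by β ≠ 0. -/
lemma HasTop.eq_of_le {b : I₁ K} {k l : ℤ} {β γ : K[X]} (hb : HasTop b k β) (hβ : β ≠ 0)
    (hc : HasTop b l γ) : k ≤ l := by
  by_contra! h
  obtain ⟨M, hM⟩ := hb
  obtain ⟨N, hN⟩ := hc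
  refine hβ (eq_of_eventually_eval_eq (M + N + k.natAbs) fun i hi => ?_)
  obtain ⟨j, hj⟩ := Int.eq_ofNat_of_zero_le (a := (i : ℤ) - k) (by omega)
  rw [← (hM i j (by omega)).2 (by omega), (hN i j (by omega)).1 (by omega), eval_zero]

lemma HasTop.unique {b : I₁ K} {k : ℤ} {β γ : K[X]} (hb : HasTop b k β) (hc : HasTop b k γ) :
    β = γ := by
  obtain ⟨M, hM⟩ := hb
  obtain ⟨N, hN⟩ := hc
  refine eq_of_eventually_eval_eq (M + N + k.natAbs) fun i hi => ?_
  obtain ⟨j, hj⟩ := Int.eq_ofNat_of_zero_le (a := (i : ℤ) - k) (by omega)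
  rw [← (hM i j (by omega)).2 (by omega), (hN i j (by omega)).2 (by omega)]

lemma HasTop.notMem_F {b : I₁ K} {k : ℤ} {β : K[X]} (hb : HasTop b k β) (hβ : β ≠ 0) :
    b ∉ F K := fun h => hβ (hb.unique (hasTop_of_mem_F h k))

lemma hasTop_canonical {p : ℤ →₀ K[X]} (l : ℕ × ℕ →₀ K) {k : ℤ} (h : ∀ i, k < i → p i = 0) :
    HasTop (canonical K p l) k (p k) := by
  obtain ⟨N, hN⟩ := canonical_eventually p l
  refine ⟨N, fun i j hij => ⟨fun h' => ?_, fun h' => ?_⟩⟩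
  · rw [hN i j hij, h _ h', eval_zero]
  · rw [hN i j hij, h']

lemma exists_hasTop {b : I₁ K} (hb : b ∉ F K) : ∃ k β, β ≠ 0 ∧ HasTop b k β := by
  obtain ⟨p, l, rfl⟩ := exists_canonical b
  have hp : p.support.Nonempty := by
    rw [Finset.nonempty_iff_ne_empty, Ne, Finsupp.support_eq_empty]
    rintro rfl
    exact hb (mem_F_of_canonical_zero l)
  refine ⟨p.support.max' hp, _, Finsupp.mem_support_iff.1 (p.support.max'_mem hp),
    hasTop_canonical l fun i hi => ?_⟩
  by_contra h
  exact absurd (p.support.le_max' i (Finsupp.mem_support_iff.2 h)) (not_le.2 hi)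

lemma HasTop.exists_lt {b : I₁ K} {k : ℤ} (hb : HasTop b k 0) :
    b ∈ F K ∨ ∃ l β, l < k ∧ β ≠ 0 ∧ HasTop b l β := by
  refine or_iff_not_imp_left.2 fun h => ?_
  obtain ⟨l, β, hβ, hl⟩ := exists_hasTop h
  refine ⟨l, β, lt_of_le_of_ne (hl.eq_of_le hβ hb) ?_, hβ, hl⟩
  rintro rfl
  exact hβ (hl.unique hb)

lemma IsPiPlus.hasTop {a : I₁ K} {m : ℤ} (h : IsPiPlus a m) : ∃ β, β ≠ 0 ∧ HasTop a m β := by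
  obtain ⟨p, l, rfl, hm, hp⟩ := h
  refine ⟨p m, hm, hasTop_canonical l fun i hi => ?_⟩
  by_contra h
  exact absurd (hp h) (not_le.2 hi)

end Top

/-! ### Transposition, which exchanges positive and negative degrees -/

section Transpose

variable {K : Type*} [Field K] [CharZero K]

/-- Only generators matter: ∫ and ∂ are transposes of each other, H is diagonal and x = ∫H. Products
reverse because K is commutative. -/
lemma exists_transpose (b : I₁ K) : ∃ c : I₁ K, ∀ i j, entry i j c = entry j i b := by
  have hmul (b c : I₁ K) (hb : ∃ b' : I₁ K, ∀ i j, entry i j b' = entry j i b)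
      (hc : ∃ c' : I₁ K, ∀ i j, entry i j c' = entry j i c) :
      ∃ c' : I₁ K, ∀ i j, entry i j c' = entry j i (b * c) := by
    obtain ⟨b', hb⟩ := hb
    obtain ⟨c', hc⟩ := hc
    refine ⟨c' * b', fun i j => ?_⟩
    rw [entry_mul, entry_mul]
    simp only [hb, hc, mul_comm]
  have hint : ∃ c : I₁ K, ∀ i j, entry i j c = entry j i (int K) := by
    refine ⟨del K, fun i j => ?_⟩
    have h1 := entry_del_pow (K := K) 1 i j
    have h2 := entry_int_pow (K := K) 1 j i
    rw [pow_one] at h1 h2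
    rw [h1, h2]
    exact if_congr (by omega) rfl rfl
  induction b using generator_induction with
  | hx =>
    rw [xOp_eq]
    refine hmul _ _ hint ⟨H K, fun i j => ?_⟩
    rw [entry_H, entry_H]
    by_cases h : i = j
    · simp [h]
    · rw [if_neg h, if_neg (Ne.symm h)]
  | hd =>
    refine ⟨int K, fun i j => ?_⟩
    have h1 := entry_del_pow (K := K) 1 j i
    have h2 := entry_int_pow (K := K) 1 i j
    rw [pow_one] at h1 h2
    rw [h1, h2]
    exact if_congr (by omega) rfl rfl
  | hi => exact hint
  | hs r =>
    refine ⟨algebraMap K _ r, fun i j => ?_⟩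
    rw [entry_algebraMap, entry_algebraMap]
    exact if_congr eq_comm rfl rfl
  | hadd b c hb hc =>
    obtain ⟨b', hb⟩ := hb
    obtain ⟨c', hc⟩ := hc
    exact ⟨b' + c', fun i j => by rw [map_add, map_add, hb, hc]⟩
  | hmul b c hb hc => exact hmul b c hb hc

/-- The involution of `𝕀₁` that exchanges `∂` and `∫`: transposition of matrices. -/
noncomputable def transpose : I₁ K →ₗ[K] I₁ K where
  toFun b := (exists_transpose b).choose
  map_add' b c := ext_entry fun i j => by
    rw [map_add, (exists_transpose b).choose_spec, (exists_transpose c).choose_spec,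
      (exists_transpose (b + c)).choose_spec, map_add]
  map_smul' r b := ext_entry fun i j => by
    rw [map_smul, (exists_transpose b).choose_spec, (exists_transpose (r • b)).choose_spec,
      map_smul, RingHom.id_apply]

lemma entry_transpose (b : I₁ K) (i j : ℕ) : entry i j (transpose b) = entry j i b :=
  (exists_transpose b).choose_spec i j

lemma transpose_transpose (b : I₁ K) : transpose (transpose b) = b :=
  ext_entry fun i j => by rw [entry_transpose, entry_transpose]

lemma transpose_mul (b c : I₁ K) : transpose (b * c) = transpose c * transpose b :=
  ext_entry fun i j => by
    rw [entry_transpose, entry_mul, entry_mul]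
    simp only [entry_transpose, mul_comm]

lemma transpose_one : transpose (1 : I₁ K) = 1 :=
  ext_entry fun i j => by
    rw [entry_transpose, entry_one, entry_one]
    exact if_congr eq_comm rfl rfl

lemma transpose_mem_F {b : I₁ K} : transpose b ∈ F K ↔ b ∈ F K := by
  rw [mem_F_iff, mem_F_iff]
  constructor <;> rintro ⟨N, h⟩ <;> refine ⟨N, fun i j hij => ?_⟩
  · rw [← entry_transpose, h j i (by omega)]
  · rw [entry_transpose, h j i (by omega)]

/-- The lowest diagonal becomes the highest one. Its polynomial is now evaluated at the old row j =
i - m, hence the argument shift. -/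
lemma IsPiMinus.hasTop_transpose {a : I₁ K} {m : ℤ} (h : IsPiMinus a (-m)) :
    ∃ β, β ≠ 0 ∧ HasTop (transpose a) m β := by
  obtain ⟨p, l, rfl, hm, hp⟩ := h
  obtain ⟨N, hN⟩ := canonical_eventually p l
  refine ⟨(p (-m)).comp (X - C (m : K)), comp_X_sub_C_ne_zero hm _, N,
    fun i j hij => ⟨fun h => ?_, fun h => ?_⟩⟩
  · rw [entry_transpose, hN j i (by omega)]
    have : p ((j : ℤ) - i) = 0 := by
      by_contra h'
      have := hp h'
      omega
    rw [this, eval_zero]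
  · rw [entry_transpose, hN j i (by omega), eval_comp]
    have h1 : (j : ℤ) - i = -m := by omega
    have h2 : (j : K) = (i : K) - (m : K) := by
      have : (j : ℤ) = i - m := by omega
      exact_mod_cast congrArg (Int.cast (R := K)) this
    rw [h1, h2]
    congr 1
    simp
    ring

/-- An element outside `K[H] + F` has a positive degree or a negative one. -/
lemma exists_pos_hasTop_or_transpose {a : I₁ K} (ha : a ∉ KH K ⊔ F K) :
    ∃ m : ℕ, 0 < m ∧ ((∃ β, β ≠ 0 ∧ HasTop a m β) ∨ ∃ β, β ≠ 0 ∧ HasTop (transpose a) m β) := by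
  obtain ⟨p, l, hpl⟩ := exists_canonical a
  have hi : ∃ i, i ≠ 0 ∧ p i ≠ 0 := by
    by_contra! h
    refine ha ?_
    have : a - aeval (H K) (p 0) ∈ F K := hpl ▸ canonical_sub_mem_F l h
    rw [← sub_add_cancel a (aeval (H K) (p 0)), add_comm]
    exact Submodule.add_mem_sup (aeval_mem_adjoin_singleton K (H K)) this
  obtain ⟨i, hi0, hi⟩ := hi
  have hne : p.support.Nonempty := ⟨i, Finsupp.mem_support_iff.2 hi⟩
  rcases lt_or_gt_of_ne hi0 with hneg | hpos
  · have hle : p.support.min' hne ≤ i := p.support.min'_le i (Finsupp.mem_support_iff.2 hi)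
    obtain ⟨m, hm⟩ := Int.eq_ofNat_of_zero_le (a := -p.support.min' hne) (by omega)
    refine ⟨m, by omega, Or.inr (IsPiMinus.hasTop_transpose ⟨p, l, hpl, ?_⟩)⟩
    rw [← hm, neg_neg]
    exact ⟨Finsupp.mem_support_iff.1 (p.support.min'_mem hne),
      fun j hj => p.support.min'_le j (Finsupp.mem_support_iff.2 hj)⟩
  · have hle : i ≤ p.support.max' hne := p.support.le_max' i (Finsupp.mem_support_iff.2 hi)
    obtain ⟨m, hm⟩ := Int.eq_ofNat_of_zero_le (a := p.support.max' hne) (by omega)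
    refine ⟨m, by omega, Or.inl (IsPiPlus.hasTop ⟨p, l, hpl, ?_⟩)⟩
    rw [← hm]
    exact ⟨Finsupp.mem_support_iff.1 (p.support.max'_mem hne),
      fun j hj => p.support.le_max' j (Finsupp.mem_support_iff.2 hj)⟩

end Transpose

/-! ### Level functions on an algebra and bases over K[s] -/

/-- A level function on a `K`-algebra `A`, given by its graph: every `x ∉ I` has a level, levels
add up under multiplication, and two elements of the same level are proportional up to elements of
lower level and elements of `I`. -/
structure IsLevel (K : Type*) {A : Type*} [Field K] [Ring A] [Algebra K A] (I : Ideal A)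
    (L : A → ℕ → Prop) : Prop where
  mul_mem_right : ∀ {x}, x ∈ I → ∀ y, x * y ∈ I
  exists_level : ∀ {x}, x ∉ I → ∃ n, L x n
  notMem : ∀ {x n}, L x n → x ∉ I
  one : L 1 0
  mul : ∀ {x y m n}, L x m → L y n → L (x * y) (m + n)
  smul : ∀ {x n} {c : K}, c ≠ 0 → L x n → L (c • x) n
  add_lt : ∀ {x y m n}, L x m → L y n → n < m → L (x + y) m
  sub_smul : ∀ {x y n}, L x n → L y n →
    ∃ c : K, x - c • y ∈ I ∨ ∃ n', n' < n ∧ L (x - c • y) n'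

section Level

variable {K A : Type*} [Field K] [Ring A] [Algebra K A] {I : Ideal A} {L : A → ℕ → Prop}

lemma IsLevel.pow (h : IsLevel K I L) {x : A} {m : ℕ} (hm : L x m) (k : ℕ) :
    L (x ^ k) (m * k) := by
  induction k with
  | zero => rw [pow_zero, mul_zero]; exact h.one
  | succ k ih => rw [pow_succ, mul_add, mul_one]; exact h.mul ih hm

lemma IsLevel.mem_or_mem (h : IsLevel K I L) {x y : A} (hxy : x * y ∈ I) : x ∈ I ∨ y ∈ I := by
  by_contra! hn
  obtain ⟨m, hm⟩ := h.exists_level hn.1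
  obtain ⟨n, hn⟩ := h.exists_level hn.2
  exact h.notMem (h.mul hm hn) hxy

/-- As m > 0, the powers of s have strictly increasing levels, so the leading term of p(s)
dominates. -/
lemma IsLevel.aeval (h : IsLevel K I L) {s : A} {m : ℕ} (hs : L s m) (hm : 0 < m) {p : K[X]}
    (hp : p ≠ 0) : L (aeval s p) (m * p.natDegree) := by
  induction hd : p.natDegree using Nat.strong_induction_on generalizing p with
  | _ n ih =>
    have hlead : L (Polynomial.aeval s (monomial p.natDegree p.leadingCoeff)) (m * n) := by
      rw [aeval_monomial, ← Algebra.smul_def, hd]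
      exact h.smul (leadingCoeff_ne_zero.2 hp) (h.pow hs n)
    have hsum : Polynomial.aeval s p = Polynomial.aeval s (monomial p.natDegree p.leadingCoeff) +
        Polynomial.aeval s p.eraseLead := by
      rw [← map_add, add_comm, eraseLead_add_monomial_natDegree_leadingCoeff]
    rw [hsum]
    by_cases h0 : p.eraseLead = 0
    · rw [h0, map_zero, add_zero]
      exact hlead
    · have hlt : p.eraseLead.natDegree < n := by
        rw [← hd]
        exact (eraseLead_natDegree_lt_or_eraseLead_eq_zero p).resolve_right h0
      exact h.add_lt hlead (ih _ hlt h0 rfl) (Nat.mul_lt_mul_of_pos_left hlt hm)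

lemma IsLevel.aeval_notMem (h : IsLevel K I L) {s : A} {m : ℕ} (hs : L s m) (hm : 0 < m)
    {p : K[X]} (hp : p ≠ 0) : Polynomial.aeval s p ∉ I :=
  h.notMem (h.aeval hs hm hp)

lemma IsLevel.sum (h : IsLevel K I L) {ι : Type*} {f : ι → A} {lev : ι → ℕ} (S : Finset ι)
    (hS : S.Nonempty) (hf : ∀ i ∈ S, L (f i) (lev i)) (hlev : Set.InjOn lev S) :
    ∃ i ∈ S, L (∑ i ∈ S, f i) (lev i) := by
  classical
  induction hS using Finset.Nonempty.cons_induction with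
  | singleton i => exact ⟨i, by simp, by simpa using hf i (by simp)⟩
  | cons i S hi hS ih =>
    obtain ⟨j, hj, hjS⟩ := ih (fun k hk => hf k (Finset.mem_cons_of_mem hk))
      (hlev.mono fun k hk => Finset.mem_coe.2 (Finset.mem_cons_of_mem hk))
    have hi' := hf i (Finset.mem_cons_self i S)
    have hne : lev i ≠ lev j := fun h' => hi (hlev (Finset.mem_coe.2 (Finset.mem_cons_self i S))
      (Finset.mem_coe.2 (Finset.mem_cons_of_mem hj)) h' ▸ hj)
    rw [Finset.sum_cons]
    rcases lt_or_gt_of_ne hne with hlt | hlt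
    · refine ⟨j, Finset.mem_cons_of_mem hj, ?_⟩
      rw [add_comm]
      exact h.add_lt hjS hi' hlt
    · exact ⟨i, Finset.mem_cons_self i S, h.add_lt hi' hjS hlt⟩

/-- Elements whose levels are distinct modulo the level of `s` are independent over `K[s]`
modulo `I`. -/
lemma IsLevel.independent (h : IsLevel K I L) {s : A} {m : ℕ} (hs : L s m) (hm : 0 < m)
    {ι : Type*} [Fintype ι] {b : ι → A} {lev : ι → ℕ} (hb : ∀ i, L (b i) (lev i))
    (hlev : Function.Injective fun i => (lev i : ZMod m)) {p : ι → K[X]}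
    (hp : ∑ i, Polynomial.aeval s (p i) * b i ∈ I) : p = 0 := by
  classical
  by_contra hne
  obtain ⟨i, hi⟩ := Function.ne_iff.1 hne
  have hsum : ∑ i, Polynomial.aeval s (p i) * b i =
      ∑ i with p i ≠ 0, Polynomial.aeval s (p i) * b i := by
    refine (Finset.sum_filter_of_ne (p := fun i => p i ≠ 0) fun j _ hj hpj => hj ?_).symm
    rw [hpj, map_zero, zero_mul]
  obtain ⟨j, -, hj⟩ := h.sum (f := fun i => Polynomial.aeval s (p i) * b i)
    (lev := fun i => m * (p i).natDegree + lev i) (Finset.univ.filter fun i => p i ≠ 0)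
    ⟨i, by simpa using hi⟩
    (fun j hj => h.mul (h.aeval hs hm (by simpa using hj)) (hb j)) (fun j _ k _ hjk => by
      apply hlev
      have := congrArg (Nat.cast (R := ZMod m)) hjk
      simpa using this)
  rw [← hsum] at hj
  exact h.notMem hj hp

/-- The classes of the levels modulo `m`. -/
def IsLevel.classes (h : IsLevel K I L) (m : ℕ) [NeZero m] : AddSubgroup (ZMod m) where
  carrier := {z | ∃ x n, L x n ∧ (n : ZMod m) = z}
  add_mem' := by
    rintro _ _ ⟨x, n, hx, rfl⟩ ⟨y, k, hy, rfl⟩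
    exact ⟨x * y, n + k, h.mul hx hy, by push_cast; rfl⟩
  zero_mem' := ⟨1, 0, h.one, by simp⟩
  neg_mem' := by
    rintro _ ⟨x, n, hx, rfl⟩
    -- Modulo m the level n(m - 1) is -n, so inverses come from powers.
    refine ⟨x ^ (m - 1), n * (m - 1), h.pow hx _, ?_⟩
    rw [Nat.cast_mul, Nat.cast_sub (NeZero.one_le), ZMod.natCast_self]
    simp

/-- An algebra with levels is free modulo `I` over the polynomials in a central element `s` of
positive level `m`, of rank dividing `m`, and commutative modulo `I`. -/
theorem IsLevel.exists_basis (h : IsLevel K I L) {s : A} (hcomm : ∀ x, s * x = x * s) {m : ℕ}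
    (hs : L s m) (hm : 0 < m) :
    ∃ (ρ : ℕ) (b : Fin ρ → A), 1 ≤ ρ ∧ ρ ∣ m ∧ ((∀ n, ∃ x, L x n) → ρ = m) ∧
      (∀ x, ∃ p : Fin ρ → K[X], x - ∑ i, Polynomial.aeval s (p i) * b i ∈ I) ∧
      (∀ p : Fin ρ → K[X], ∑ i, Polynomial.aeval s (p i) * b i ∈ I → p = 0) ∧
      ∀ x y, x * y - y * x ∈ I := by
  classical
  have : NeZero m := ⟨hm.ne'⟩
  let G := h.classes m
  -- The basis: an element of least level in every class.
  have hmin (g : G) : ∃ n x, L x n ∧ (n : ZMod m) = g ∧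
      ∀ n' x', L x' n' → (n' : ZMod m) = g → n ≤ n' := by
    have hex : ∃ n : ℕ, ∃ x, L x n ∧ (n : ZMod m) = g := by
      obtain ⟨x, n, hx, hn⟩ := g.2
      exact ⟨n, x, hx, hn⟩
    obtain ⟨x, hx, hn⟩ := Nat.find_spec hex
    exact ⟨Nat.find hex, x, hx, hn, fun n' x' hx' hn' => Nat.find_min' hex ⟨x', hx', hn'⟩⟩
  choose lev c hc hlev hle using hmin
  let E := Finite.equivFin G
  -- The level of x exceeds that of the chosen c_g in its class by a multiple tm of m, so s^t c_g
  -- has the level of x, and subtracting a scalar multiple of it lowers the level.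
  have hspan (n : ℕ) : ∀ x, L x n →
      ∃ p : G → K[X], x - ∑ g, Polynomial.aeval s (p g) * c g ∈ I := by
    induction n using Nat.strong_induction_on with
    | _ n ih =>
      intro x hx
      let g : G := ⟨n, x, n, hx, rfl⟩
      have hgn : lev g ≤ n := hle g n x hx rfl
      have hdvd : m ∣ n - lev g := by
        rw [← ZMod.natCast_eq_zero_iff, Nat.cast_sub hgn, hlev g, sub_self]
      obtain ⟨t, ht⟩ := hdvd
      have hy : L (s ^ t * c g) n := by
        have := h.mul (h.pow hs t) (hc g)
        rwa [← ht, Nat.sub_add_cancel hgn] at this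
      obtain ⟨r, hr⟩ := h.sub_smul hx hy
      have hsingle : ∑ g', Polynomial.aeval s ((Pi.single g (C r * X ^ t) : G → K[X]) g') * c g' =
          r • (s ^ t * c g) := by
        rw [Finset.sum_eq_single g]
        · rw [Pi.single_eq_same, map_mul, aeval_C, map_pow, aeval_X, ← Algebra.smul_def,
            smul_mul_assoc]
        · intro g' _ hg'
          rw [Pi.single_eq_of_ne hg', map_zero, zero_mul]
        · simp
      rcases hr with hr | ⟨n', hn', hr⟩
      · exact ⟨Pi.single g (C r * X ^ t), by rwa [hsingle]⟩
      · obtain ⟨p, hp⟩ := ih n' hn' _ hr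
        refine ⟨Pi.single g (C r * X ^ t) + p, ?_⟩
        simp only [Pi.add_apply, map_add, add_mul, Finset.sum_add_distrib]
        rwa [hsingle, ← sub_sub]
  have hspan' (x : A) : ∃ p : Fin (Nat.card G) → K[X],
      x - ∑ i, Polynomial.aeval s (p i) * c (E.symm i) ∈ I := by
    by_cases hx : x ∈ I
    · exact ⟨0, by simpa using hx⟩
    · obtain ⟨n, hn⟩ := h.exists_level hx
      obtain ⟨p, hp⟩ := hspan n x hn
      refine ⟨p ∘ E.symm, ?_⟩
      rwa [← Equiv.sum_comp E.symm fun g => Polynomial.aeval s (p g) * c g] at hp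
  refine ⟨Nat.card G, fun i => c (E.symm i), Nat.card_pos, ?_, ?_, hspan', ?_, ?_⟩
  · have := G.card_addSubgroup_dvd_card
    rwa [Nat.card_zmod] at this
  · intro hall
    have : G = ⊤ := by
      refine eq_top_iff.2 fun z _ => ?_
      obtain ⟨x, hx⟩ := hall z.val
      exact ⟨x, z.val, hx, ZMod.natCast_zmod_val z⟩
    rw [this, AddSubgroup.card_top, Nat.card_zmod]
  · intro p hp
    refine h.independent hs hm (lev := fun i => lev (E.symm i)) (fun i => hc _) ?_ hp
    intro i j hij
    simp only [hlev] at hij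
    exact E.symm.injective (Subtype.ext hij)
  -- Commutativity modulo I: x has a level whose class generates G, so the powers x^i with i < |G|
  -- have pairwise distinct classes and are independent over K[s] modulo I.
  · obtain ⟨g, hg⟩ := IsAddCyclic.exists_generator (α := G)
    obtain ⟨x, n, hx, hn⟩ := g.2
    have hord : addOrderOf g = Nat.card G := addOrderOf_eq_card_of_forall_mem_zmultiples hg
    have hpow : Function.Injective fun i : Fin (Nat.card G) => ((n * (i : ℕ) : ℕ) : ZMod m) := by
      intro i j hij
      refine Fin.ext (nsmul_injOn_Iio_addOrderOf (x := g) ?_ ?_ (Subtype.ext ?_))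
      · rw [hord]; exact i.2
      · rw [hord]; exact j.2
      · simp only [Nat.cast_mul, hn] at hij
        simpa [mul_comm] using hij
    have hcs (p : K[X]) (y : A) : Polynomial.aeval s p * y = y * Polynomial.aeval s p := by
      induction p using Polynomial.induction_on' with
      | add p q hp hq => rw [map_add, add_mul, mul_add, hp, hq]
      | monomial k r =>
        have : Commute s y := hcomm y
        rw [aeval_monomial, ← Algebra.smul_def, smul_mul_assoc, mul_smul_comm, (this.pow_left k).eq]
    -- Together with y the powers of x form |G| + 1 elements; their coordinate vectors in K[t]^|G|
    -- are dependent. The coefficient of y is nonzero because the powers alone are independent.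
    have hrel (y : A) : ∃ (q : K[X]) (r : Fin (Nat.card G) → K[X]), q ≠ 0 ∧
        Polynomial.aeval s q * y + ∑ i, Polynomial.aeval s (r i) * x ^ (i : ℕ) ∈ I := by
      let f : Option (Fin (Nat.card G)) → A := fun o => o.elim y fun i => x ^ (i : ℕ)
      choose P hP using fun o => hspan' (f o)
      have hdep : ¬ LinearIndependent K[X] P := by
        intro hli
        have := hli.fintype_card_le_finrank
        simp at this
      obtain ⟨q, hq, o, ho⟩ := Fintype.not_linearIndependent_iff.1 hdep
      have hmem : ∑ o, Polynomial.aeval s (q o) * f o ∈ I := by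
        have h1 : ∑ o, Polynomial.aeval s (q o) *
            (f o - ∑ i, Polynomial.aeval s (P o i) * c (E.symm i)) ∈ I :=
          I.sum_mem fun o _ => I.mul_mem_left _ (hP o)
        have h2 : ∑ o, Polynomial.aeval s (q o) * ∑ i, Polynomial.aeval s (P o i) * c (E.symm i) =
            0 := by
          simp only [Finset.mul_sum, ← mul_assoc, ← map_mul]
          rw [Finset.sum_comm]
          refine Finset.sum_eq_zero fun i _ => ?_
          rw [← Finset.sum_mul, ← map_sum]
          have := congrFun hq i
          simp only [Finset.sum_apply, Pi.smul_apply, smul_eq_mul, Pi.zero_apply] at this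
          rw [this, map_zero, zero_mul]
        simp only [mul_sub, Finset.sum_sub_distrib] at h1
        rwa [h2, sub_zero] at h1
      rw [Fintype.sum_option] at hmem
      refine ⟨q none, fun i => q (some i), fun h0 => ?_, hmem⟩
      rw [h0, map_zero, zero_mul, zero_add] at hmem
      have hz := h.independent hs hm (fun i : Fin (Nat.card G) => h.pow hx (i : ℕ)) hpow hmem
      rcases o with _ | i
      · exact ho h0
      · exact ho (congrFun hz i)
    -- If z commutes with x modulo I, the relation for y gives q(s)(yz - zy) ∈ I, and q(s) ∉ I can
    -- be cancelled.
    have hcx (y z : A) (hz : x * z - z * x ∈ I) : y * z - z * y ∈ I := by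
      obtain ⟨q, r, hq, hI⟩ := hrel y
      refine (h.mem_or_mem (x := Polynomial.aeval s q) ?_).resolve_left (h.aeval_notMem hs hm hq)
      have hxz (i : ℕ) : x ^ i * z - z * x ^ i ∈ I := by
        induction i with
        | zero => simp
        | succ i ih =>
          have : x ^ (i + 1) * z - z * x ^ (i + 1) =
              x ^ i * (x * z - z * x) + (x ^ i * z - z * x ^ i) * x := by
            rw [pow_succ]; noncomm_ring
          rw [this]
          exact add_mem (I.mul_mem_left _ hz) (h.mul_mem_right ih _)
      set w := Polynomial.aeval s q * y + ∑ i, Polynomial.aeval s (r i) * x ^ (i : ℕ) with hw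
      have : Polynomial.aeval s q * (y * z - z * y) = w * z - z * w -
          ∑ i, Polynomial.aeval s (r i) * (x ^ (i : ℕ) * z - z * x ^ (i : ℕ)) := by
        rw [hw]
        simp only [add_mul, mul_add, mul_sub, Finset.sum_mul, Finset.mul_sum, ← mul_assoc,
          Finset.sum_sub_distrib, ← hcs _ z]
        abel
      rw [this]
      exact sub_mem (sub_mem (h.mul_mem_right hI z) (I.mul_mem_left z hI))
        (I.sum_mem fun i _ => I.mul_mem_left _ (hxz i))
    -- Two applications: x commutes with itself, hence with every z; then every z commutes with
    -- every y.
    intro y z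
    refine hcx y z ?_
    have := hcx z x (by simp)
    rw [← neg_sub]
    exact neg_mem this

end Level

/-! ### Splitting off a free module, and its rank -/

/-- A module that is generated, modulo a submodule `N`, by a family independent modulo `N` is the
direct sum of a free module and `N`. -/
lemma nonempty_equiv_prod_of_basis_mod {R M : Type*} [Ring R] [AddCommGroup M] [Module R M]
    (N : Submodule R M) {ρ : ℕ} (b : Fin ρ → M)
    (hspan : ∀ x, ∃ p : Fin ρ → R, x - ∑ i, p i • b i ∈ N)
    (hind : ∀ p : Fin ρ → R, ∑ i, p i • b i ∈ N → p = 0) :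
    Nonempty (M ≃ₗ[R] (Fin ρ → R) × N) := by
  refine ⟨(LinearEquiv.ofBijective
    ((Fintype.linearCombination R b).coprod N.subtype) ⟨?_, ?_⟩).symm⟩
  · rw [← LinearMap.ker_eq_bot, LinearMap.ker_eq_bot']
    rintro ⟨p, n⟩ hpn
    rw [LinearMap.coprod_apply, Fintype.linearCombination_apply, Submodule.subtype_apply] at hpn
    have hp : p = 0 := by
      refine hind p ?_
      rw [eq_neg_of_add_eq_zero_left hpn]
      exact neg_mem n.2
    subst hp
    simpa using hpn
  · intro x
    obtain ⟨p, hp⟩ := hspan x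
    refine ⟨(p, ⟨_, hp⟩), ?_⟩
    rw [LinearMap.coprod_apply, Fintype.linearCombination_apply, Submodule.subtype_apply]
    exact add_sub_cancel _ _

/-- The rank of a free module does not change if torsion is added. -/
lemma rank_eq_of_equiv_prod {R M N : Type*} [CommRing R] [IsDomain R] [AddCommGroup M] [Module R M]
    [AddCommGroup N] [Module R N] {ρ : ℕ} (E : M ≃ₗ[R] (Fin ρ → R) × N)
    (htor : ∀ n : N, ∃ p : R, p ≠ 0 ∧ p • n = 0) : Module.rank R M = ρ := by
  let f : M →ₗ[R] (Fin ρ → R) := LinearMap.fst R (Fin ρ → R) N ∘ₗ E.toLinearMap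
  have hf : Function.Surjective f :=
    (LinearMap.fst_surjective (R := R) (M := Fin ρ → R) (M₂ := N)).comp E.surjective
  have hker : LinearMap.ker f ≤ Submodule.torsion R M := by
    intro x hx
    obtain ⟨p, hp0, hp⟩ := htor (E x).2
    refine (Submodule.mem_torsion_iff _).2 ⟨⟨p, mem_nonZeroDivisors_of_ne_zero hp0⟩, ?_⟩
    refine E.injective ?_
    rw [Submonoid.mk_smul, map_smul, map_zero]
    refine Prod.ext ?_ hp
    rw [Prod.smul_fst, show (E x).1 = 0 from hx, smul_zero]
    rfl
  rw [← rank_quotient_eq_of_le_torsion hker]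
  have := (f.quotKerEquivOfSurjective hf).lift_rank_eq
  rw [rank_fin_fun, Cardinal.lift_natCast] at this
  exact Cardinal.lift_eq_nat_iff.1 this

/-! ### Centralizers as K[a]-modules; Noetherian properties -/

section Centralizer

universe u

variable {K : Type u} [Field K]

lemma mem_Cen_iff {a b : I₁ K} : b ∈ Cen a ↔ a * b = b * a := by
  rw [Cen, Subalgebra.mem_centralizer_iff]
  simp

lemma coe_aeval_self (a : I₁ K) (p : K[X]) : ((aeval (self a) p : Cen a) : I₁ K) = aeval a p :=
  (aeval_algHom_apply (Cen a).val (self a) p).symm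

lemma self_mul_comm (a : I₁ K) (x : Cen a) : self a * x = x * self a :=
  Subtype.ext (mem_Cen_iff.1 x.2)

lemma aeval_self_mul_comm (a : I₁ K) (p : K[X]) (x : Cen a) :
    aeval (self a) p * x = x * aeval (self a) p := by
  induction p using Polynomial.induction_on' with
  | add p q hp hq => rw [map_add, add_mul, mul_add, hp, hq]
  | monomial k r =>
    have : Commute (self a) x := self_mul_comm a x
    rw [aeval_monomial, ← Algebra.smul_def, smul_mul_assoc, mul_smul_comm, (this.pow_left k).eq]

lemma exists_aeval_eq_of_Kadj {a : I₁ K} (y : Kadj a) :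
    ∃ p : K[X], aeval (self a) p = (y : Cen a) := by
  have : (y : Cen a) ∈ Algebra.adjoin K {self a} := y.2
  rwa [Algebra.adjoin_singleton_eq_range_aeval] at this

/-- An element of a finite dimensional `a`-invariant subspace is a torsion element. -/
lemma mem_torsion_of_mem_invariant {a : I₁ K} (W : Submodule K (I₁ K)) [FiniteDimensional K W]
    (hW : ∀ w ∈ W, a * w ∈ W) {c : Cen a} (hc : (c : I₁ K) ∈ W) : c ∈ torsion a := by
  have hmem (p : K[X]) : aeval a p * (c : I₁ K) ∈ W := by
    induction p using Polynomial.induction_on' with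
    | add p q hp hq => rw [map_add, add_mul]; exact add_mem hp hq
    | monomial k r =>
      rw [aeval_monomial, ← Algebra.smul_def, smul_mul_assoc]
      refine Submodule.smul_mem _ _ ?_
      induction k with
      | zero => simpa using hc
      | succ k ih => rw [pow_succ', mul_assoc]; exact hW _ ih
  -- The map p ↦ p(a)c goes from an infinite dimensional space to W, so it has a nonzero kernel.
  let φ : K[X] →ₗ[K] W := LinearMap.codRestrict W
    (LinearMap.mulRight K (c : I₁ K) ∘ₗ (aeval a).toLinearMap) hmem
  have hφ : ¬ Function.Injective φ := by
    intro hinj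
    have := Module.Finite.of_injective φ hinj
    exact Polynomial.not_finite this
  rw [← LinearMap.ker_eq_bot, LinearMap.ker_eq_bot'] at hφ
  push Not at hφ
  obtain ⟨p, hp, hp0⟩ := hφ
  refine ⟨p, hp0, Subtype.ext ?_⟩
  rw [MulMemClass.coe_mul, coe_aeval_self]
  exact congrArg Subtype.val hp

instance Kadj_isNoetherianRing (a : I₁ K) : IsNoetherianRing (Kadj a) := by
  have hmem (p : K[X]) : aeval (self a) p ∈ Kadj a := by
    rw [Kadj, Algebra.adjoin_singleton_eq_range_aeval]
    exact ⟨p, rfl⟩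
  exact isNoetherianRing_of_surjective K[X] (Kadj a)
    (((aeval (self a)).codRestrict (Kadj a) hmem : K[X] →ₐ[K] Kadj a) : K[X] →+* Kadj a)
    (fun y => (exists_aeval_eq_of_Kadj y).imp fun p hp => Subtype.ext hp)

lemma Kadj_smul_comm {a : I₁ K} (y : Kadj a) (x : Cen a) : (y : Cen a) * x = x * y := by
  obtain ⟨p, hp⟩ := exists_aeval_eq_of_Kadj y
  rw [← hp, aeval_self_mul_comm]

lemma isNoetherianRing_of_finite (a : I₁ K) [Module.Finite (Kadj a) (Cen a)] :
    IsNoetherianRing (Cen a) := by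
  have : IsNoetherian (Kadj a) (Cen a) := inferInstance
  exact isNoetherian_of_tower (Kadj a) this

lemma isNoetherianRing_op_of_finite (a : I₁ K) [Module.Finite (Kadj a) (Cen a)] :
    IsNoetherianRing (Cen a)ᵐᵒᵖ := by
  have h1 : IsNoetherian (Kadj a) (Cen a) := inferInstance
  have h2 : IsNoetherian (Kadj a) (Cen a)ᵐᵒᵖ :=
    isNoetherian_of_linearEquiv (MulOpposite.opLinearEquiv (Kadj a))
  -- On the opposite side this compatibility is exactly the centrality of K[a] in Cen(a).
  have h3 : IsScalarTower (Kadj a) (Cen a)ᵐᵒᵖ (Cen a)ᵐᵒᵖ := by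
    refine ⟨fun y x z => MulOpposite.unop_injective ?_⟩
    change z.unop * ((y : Cen a) * x.unop) = (y : Cen a) * (z.unop * x.unop)
    rw [← mul_assoc, ← mul_assoc, Kadj_smul_comm]
  exact isNoetherian_of_tower (Kadj a) h2

lemma finiteType_of_finite (a : I₁ K) [Module.Finite (Kadj a) (Cen a)] :
    Algebra.FiniteType K (Cen a) := by
  classical
  obtain ⟨S, hS⟩ := Module.finite_def.1 (show Module.Finite (Kadj a) (Cen a) from inferInstance)
  refine ⟨⟨insert (self a) S, eq_top_iff.2 fun x _ => ?_⟩⟩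
  have hx : x ∈ Submodule.span (Kadj a) (S : Set (Cen a)) := by rw [hS]; trivial
  induction hx using Submodule.span_induction with
  | mem y hy => exact Algebra.subset_adjoin (by simp [Finset.mem_coe.1 hy])
  | zero => exact zero_mem _
  | add y z _ _ hy hz => exact add_mem (hy trivial) (hz trivial)
  | smul r y _ hy =>
    refine mul_mem (Algebra.adjoin_mono ?_ r.2) (hy trivial)
    simp

section InfiniteSums

variable {A : Type u} [Ring A]

lemma not_isNoetherianRing_of_left (h : HasInfiniteSumOfLeftIdeals A) : ¬ IsNoetherianRing A := by
  intro hA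
  obtain ⟨I, hI, hne⟩ := h
  have : WellFoundedGT (Submodule A A) := hA.wellFoundedGT
  exact Infinite.not_finite (WellFoundedGT.finite_of_iSupIndep hI hne)

lemma not_isNoetherianRing_op_of_right (h : HasInfiniteSumOfRightIdeals A) :
    ¬ IsNoetherianRing Aᵐᵒᵖ := by
  intro hA
  obtain ⟨I, hI, hne⟩ := h
  let E : A ≃ₗ[Aᵐᵒᵖ] Aᵐᵒᵖ :=
    { MulOpposite.opAddEquiv with map_smul' := fun _ _ => rfl }
  have : IsNoetherian Aᵐᵒᵖ A := isNoetherian_of_linearEquiv E.symm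
  exact Infinite.not_finite (WellFoundedGT.finite_of_iSupIndep hI hne)

/-- Orthogonal idempotents generate infinite direct sums of left ideals. -/
lemma hasInfiniteSumOfLeftIdeals_of_orthogonal (ε : ℕ → A) (hne : ∀ n, ε n ≠ 0)
    (hid : ∀ n, ε n * ε n = ε n) (hort : ∀ m n, m ≠ n → ε m * ε n = 0) :
    HasInfiniteSumOfLeftIdeals A := by
  refine ⟨fun n => Submodule.span A {ε n}, ?_, fun n => ?_⟩
  · rw [iSupIndep_def]
    intro n
    rw [Submodule.disjoint_def]
    intro x hx hx'
    obtain ⟨y, rfl⟩ := Submodule.mem_span_singleton.1 hx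
    -- Right multiplication by ε n kills all the other left ideals and is the identity on its own.
    have hker : (⨆ j, ⨆ (_ : j ≠ n), Submodule.span A {ε j}) ≤
        LinearMap.ker (LinearMap.toSpanSingleton A A (ε n)) := by
      refine iSup₂_le fun j hj => ?_
      rw [Submodule.span_singleton_le_iff_mem, LinearMap.mem_ker,
        LinearMap.toSpanSingleton_apply, smul_eq_mul]
      exact hort j n hj
    have := hker hx'
    rwa [LinearMap.mem_ker, LinearMap.toSpanSingleton_apply, smul_eq_mul, smul_eq_mul, mul_assoc,
      hid] at this
  · rw [Ne, Submodule.span_singleton_eq_bot]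
    exact hne n

/-- Orthogonal idempotents generate infinite direct sums of right ideals. -/
lemma hasInfiniteSumOfRightIdeals_of_orthogonal (ε : ℕ → A) (hne : ∀ n, ε n ≠ 0)
    (hid : ∀ n, ε n * ε n = ε n) (hort : ∀ m n, m ≠ n → ε m * ε n = 0) :
    HasInfiniteSumOfRightIdeals A := by
  refine ⟨fun n => Submodule.span Aᵐᵒᵖ {ε n}, ?_, fun n => ?_⟩
  · rw [iSupIndep_def]
    intro n
    rw [Submodule.disjoint_def]
    intro x hx hx'
    obtain ⟨y, rfl⟩ := Submodule.mem_span_singleton.1 hx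
    let φ : A →ₗ[Aᵐᵒᵖ] A :=
      { toFun := fun z => ε n * z
        map_add' := mul_add _
        map_smul' := fun r z => by simp [← mul_assoc] }
    have hker : (⨆ j, ⨆ (_ : j ≠ n), Submodule.span Aᵐᵒᵖ {ε j}) ≤ LinearMap.ker φ := by
      refine iSup₂_le fun j hj => ?_
      rw [Submodule.span_singleton_le_iff_mem, LinearMap.mem_ker]
      exact hort n j hj.symm
    have := LinearMap.mem_ker.1 (hker hx')
    rwa [map_smul, show φ (ε n) = ε n from hid n] at this
  · rw [Ne, Submodule.span_singleton_eq_bot]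
    exact hne n

end InfiniteSums

variable [CharZero K]

lemma mem_CenF_iff {a : I₁ K} {x : Cen a} : x ∈ CenF a ↔ (x : I₁ K) ∈ F K := Iff.rfl

/-- The rank of `Cen(a)` from a basis modulo `Cen_F(a)`, if the latter is torsion. -/
lemma cenRank_eq_of_basis_mod {a : I₁ K} (htor : ∀ x ∈ CenF a, x ∈ torsion a) {ρ : ℕ}
    (b : Fin ρ → Cen a)
    (hspan : ∀ x, ∃ p : Fin ρ → K[X], x - ∑ i, aeval (self a) (p i) * b i ∈ CenF a)
    (hind : ∀ p : Fin ρ → K[X], ∑ i, aeval (self a) (p i) * b i ∈ CenF a → p = 0) :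
    cenRank a = ρ := by
  let M := Module.AEval K (Cen a) (self a)
  let o : Cen a ≃ₗ[K] M := Module.AEval.of K (Cen a) (self a)
  let N : Submodule K[X] M :=
    { carrier := {x | o.symm x ∈ CenF a}
      add_mem' := fun {x y} hx hy => by
        rw [Set.mem_ofPred_eq, map_add]
        exact add_mem hx hy
      zero_mem' := by
        rw [Set.mem_ofPred_eq, map_zero]
        exact zero_mem _
      smul_mem' := fun p x hx => (CenF a).smul_mem (aeval (self a) p) hx }
  have hsum (p : Fin ρ → K[X]) :
      o (∑ i, aeval (self a) (p i) * b i) = ∑ i, p i • o (b i) := by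
    rw [map_sum]
    rfl
  obtain ⟨E⟩ := nonempty_equiv_prod_of_basis_mod N (fun i => o (b i))
    (fun x => (hspan (o.symm x)).imp fun p hp => by
      change o.symm (x - ∑ i, p i • o (b i)) ∈ CenF a
      rwa [← hsum, map_sub, o.symm_apply_apply])
    (fun p hp => hind p (by
      change o.symm (∑ i, p i • o (b i)) ∈ CenF a at hp
      rwa [← hsum, o.symm_apply_apply] at hp))
  have hrank : Module.rank K[X] M = ρ := by
    refine rank_eq_of_equiv_prod (N := N) E fun n => ?_
    obtain ⟨p, hp0, hp⟩ := htor _ n.2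
    refine ⟨p, hp0, Subtype.ext (o.symm.injective ?_)⟩
    exact hp.trans (map_zero o.symm).symm
  -- Passing to K(t) is a localization at the nonzero polynomials, which preserves rank; so the rank
  -- over K[t] suffices.
  rw [cenRank, IsLocalization.rank_eq (RatFunc K) (nonZeroDivisors K[X]) le_rfl,
    IsLocalizedModule.rank_eq (nonZeroDivisors K[X]) le_rfl (TensorProduct.mk K[X] (RatFunc K) M 1)]
  exact hrank

lemma CenF_mul_mem {a : I₁ K} {x : Cen a} (hx : x ∈ CenF a) (y : Cen a) : x * y ∈ CenF a :=
  mem_F_mul hx (y : I₁ K)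

/-- The structure of the centralizer of `a` if there is a level function for which `a` has
positive level. -/
theorem centralizer_structure_of_level {a : I₁ K} {L : Cen a → ℕ → Prop}
    (h : IsLevel K (CenF a) L) {m : ℕ} (hs : L (self a) m) (hm : 0 < m)
    (htor : ∀ x ∈ CenF a, x ∈ torsion a) :
    ∃ ρ : ℕ, 1 ≤ ρ ∧ ρ ∣ m ∧ ((∀ n, ∃ x, L x n) → ρ = m) ∧ cenRank a = ρ ∧
      Nonempty (Cen a ≃ₗ[Kadj a] (Fin ρ → Kadj a) × CenF a) ∧
      commutant K (Cen a) ≤ (CenF a).restrictScalars K ∧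
      (CenF a : Set (Cen a)) = torsion a := by
  obtain ⟨ρ, b, h1, hdvd, hall, hspan, hind, hcomm⟩ := h.exists_basis (self_mul_comm a) hs hm
  refine ⟨ρ, h1, hdvd, hall, cenRank_eq_of_basis_mod htor b hspan hind, ?_, ?_, ?_⟩
  · refine nonempty_equiv_prod_of_basis_mod ((CenF a).restrictScalars (Kadj a)) b (fun x => ?_)
      (fun p hp => ?_)
    · obtain ⟨p, hp⟩ := hspan x
      have hmem (i : Fin ρ) : aeval (self a) (p i) ∈ Kadj a := by
        rw [Kadj, Algebra.adjoin_singleton_eq_range_aeval]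
        exact ⟨p i, rfl⟩
      exact ⟨fun i => ⟨_, hmem i⟩, hp⟩
    · choose q hq using fun i => exists_aeval_eq_of_Kadj (p i)
      have : ∑ i, aeval (self a) (q i) * b i ∈ CenF a := by
        simp only [hq]
        exact hp
      have hq0 := hind q this
      ext1 i
      exact Subtype.ext (by rw [← hq, hq0, Pi.zero_apply, map_zero]; rfl)
  · refine Submodule.span_le.2 ?_
    rintro _ ⟨x, y, rfl⟩
    exact hcomm x y
  · refine Set.Subset.antisymm (fun x hx => htor x hx) ?_
    rintro x ⟨p, hp0, hp⟩
    refine (h.mem_or_mem (x := aeval (self a) p) ?_).resolve_left (h.aeval_notMem hs hm hp0)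
    rw [hp]
    exact zero_mem _

lemma finite_of_equiv {a : I₁ K} {ρ : ℕ}
    (E : Nonempty (Cen a ≃ₗ[Kadj a] (Fin ρ → Kadj a) × CenF a)) [FiniteDimensional K (CenF a)] :
    Module.Finite (Kadj a) (Cen a) := by
  obtain ⟨E⟩ := E
  have : IsScalarTower K (Kadj a) (CenF a) :=
    ⟨fun r y x => Subtype.ext (smul_mul_assoc r (y : Cen a) (x : Cen a))⟩
  have : Module.Finite (Kadj a) (CenF a) := Module.Finite.of_restrictScalars_finite K _ _
  exact Module.Finite.equiv E.symm

end Centralizer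

/-! ### Linear operators on K[x] that raise degrees -/

section DegreeRaising

variable {K : Type*} [Field K]

lemma mem_degreeLT_of_natDegree_lt {p : K[X]} {n : ℕ} (h : p.natDegree < n) :
    p ∈ degreeLT K n :=
  mem_degreeLT.2 (lt_of_le_of_lt degree_le_natDegree (by exact_mod_cast h))

lemma natDegree_lt_of_mem_degreeLT {p : K[X]} {n : ℕ} (hn : 0 < n) (h : p ∈ degreeLT K n) :
    p.natDegree < n := by
  by_cases hp : p = 0
  · rwa [hp, natDegree_zero]
  · exact (natDegree_lt_iff_degree_lt hp).2 (mem_degreeLT.1 h)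

instance degreeLT_finiteDimensional (n : ℕ) : FiniteDimensional K (degreeLT K n) :=
  Module.Finite.equiv (degreeLTEquiv K n).symm

lemma finrank_degreeLT (n : ℕ) : Module.finrank K (degreeLT K n) = n := by
  rw [(degreeLTEquiv K n).finrank_eq, Module.finrank_fin_fun]

lemma exists_le_degreeLT (W : Submodule K K[X]) [FiniteDimensional K W] :
    ∃ n, W ≤ degreeLT K n := by
  obtain ⟨s, hs⟩ := Module.Finite.iff_fg.1 (inferInstance : FiniteDimensional K W)
  refine ⟨s.sup natDegree + 1, hs ▸ Submodule.span_le.2 fun p hp =>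
    mem_degreeLT_of_natDegree_lt (Nat.lt_succ_of_le (Finset.le_sup (f := natDegree) hp))⟩

/-- A finite dimensional invariant subspace of an operator that raises all large degrees consists
of polynomials of small degree. -/
lemma le_degreeLT_of_invariant {S : Module.End K K[X]} {N : ℕ}
    (hS : ∀ p : K[X], N ≤ p.natDegree → p.natDegree < (S p).natDegree)
    (W : Submodule K K[X]) [FiniteDimensional K W] (hW : ∀ p ∈ W, S p ∈ W) :
    W ≤ degreeLT K N := by
  obtain ⟨D, hD⟩ := exists_le_degreeLT W
  intro p hp
  by_contra hpN
  have hN : N ≤ p.natDegree := not_lt.1 fun h => hpN (mem_degreeLT_of_natDegree_lt h)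
  -- A single p ∈ W of degree at least N would have iterates of unbounded degree in W.
  have hiter (n : ℕ) : (S ^ n) p ∈ W ∧ N + n ≤ ((S ^ n) p).natDegree := by
    induction n with
    | zero => exact ⟨hp, hN⟩
    | succ n ih =>
      rw [pow_succ', Module.End.mul_apply]
      have := hS _ (le_trans (Nat.le_add_right _ _) ih.2)
      exact ⟨hW _ ih.1, by omega⟩
  have h0 := natDegree_lt_of_mem_degreeLT (n := D + 1) (by omega)
    (degreeLT_mono (Nat.le_succ D) (hD (hiter (D + 1)).1))
  have := (hiter (D + 1)).2
  omega

/-- An operator that commutes with a degree raising one, has a finite dimensional kernel, and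
lowers degrees, cannot lower them by much. -/
lemma le_add_of_commute_of_lowers {S T : Module.End K K[X]} (hST : ∀ p, S (T p) = T (S p)) {N : ℕ}
    (hS : ∀ p : K[X], N ≤ p.natDegree → p.natDegree < (S p).natDegree)
    (hT : ∃ M, LinearMap.ker T ≤ degreeLT K M) {D D' : ℕ}
    (hD : ∀ p ∈ degreeLT K D, T p ∈ degreeLT K D') : D ≤ D' + N := by
  obtain ⟨M, hM⟩ := hT
  have hfin : FiniteDimensional K (LinearMap.ker T) := Submodule.finiteDimensional_of_le hM
  -- The kernel of T is finite dimensional and S-invariant, so its dimension is at most N.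
  -- Rank-nullity for T on the polynomials of degree less than D then gives the bound.
  have hker : LinearMap.ker T ≤ degreeLT K N :=
    le_degreeLT_of_invariant hS _ fun p hp => by
      rw [LinearMap.mem_ker] at hp ⊢
      rw [← hST, hp, map_zero]
  have hdim := LinearMap.finrank_range_add_finrank_ker (T.domRestrict (degreeLT K D))
  have h1 : Module.finrank K (LinearMap.range (T.domRestrict (degreeLT K D))) ≤ D' := by
    rw [← finrank_degreeLT (K := K) D']
    refine Submodule.finrank_mono ?_
    rintro _ ⟨p, rfl⟩
    exact hD p.1 p.2
  have h2 : Module.finrank K (LinearMap.ker (T.domRestrict (degreeLT K D))) ≤ N := by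
    rw [← finrank_degreeLT (K := K) N,
      ← Submodule.finrank_map_subtype_eq (degreeLT K D) (LinearMap.ker (T.domRestrict _))]
    refine Submodule.finrank_mono ?_
    rintro _ ⟨p, hp, rfl⟩
    exact hker (LinearMap.mem_ker.2 (by simpa using hp))
  rw [finrank_degreeLT] at hdim
  omega

/-- An operator that commutes with a degree raising one is determined by its values on
polynomials of small degree. -/
lemma eq_zero_of_commute_of_degreeLT {S T : Module.End K K[X]} (hST : ∀ p, S (T p) = T (S p))
    {N m : ℕ} (hm : 0 < m)
    (hS : ∀ p : K[X], N ≤ p.natDegree → p ≠ 0 → (S p).natDegree = p.natDegree + m)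
    (hT : ∀ p ∈ degreeLT K (N + m), T p = 0) : T = 0 := by
  suffices h : ∀ (n : ℕ) (p : K[X]), p.natDegree = n → T p = 0 from
    LinearMap.ext fun p => h _ p rfl
  intro n
  induction n using Nat.strong_induction_on with
  | _ n ih =>
    intro p hp
    by_cases hn : n < N + m
    · exact hT p (mem_degreeLT_of_natDegree_lt (hp ▸ hn))
    -- S q has the degree n of p, and T(S q) = S(T q) = 0 by induction. Subtracting a multiple of S
    -- q from p lowers the degree without changing the value of T.
    · set q : K[X] := monomial (n - m) 1 with hq
      have hqd : q.natDegree = n - m := natDegree_monomial_eq _ one_ne_zero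
      have hSq : (S q).natDegree = n := by
        rw [hS q (by omega) (by simp [hq]), hqd]
        omega
      have hSq0 : S q ≠ 0 := fun h => by
        rw [h, natDegree_zero] at hSq
        omega
      have hTSq : T (S q) = 0 := by
        rw [← hST, ih (n - m) (by omega) q hqd, map_zero]
      have hp0 : p ≠ 0 := fun h => by
        rw [h, natDegree_zero] at hp
        omega
      set c := p.leadingCoeff / (S q).leadingCoeff with hc
      have hc0 : c ≠ 0 := div_ne_zero (leadingCoeff_ne_zero.2 hp0) (leadingCoeff_ne_zero.2 hSq0)
      have hlt : (p - c • S q).degree < p.degree := by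
        refine degree_sub_lt_left ?_ hp0 ?_
        · rw [degree_smul_of_smul_regular _ (IsSMulRegular.of_ne_zero hc0),
            degree_eq_natDegree hp0, degree_eq_natDegree hSq0, hp, hSq]
        · rw [leadingCoeff_smul_of_smul_regular _ (IsSMulRegular.of_ne_zero hc0), smul_eq_mul, hc,
            div_mul_cancel₀ _ (leadingCoeff_ne_zero.2 hSq0)]
      have h0 : T (p - c • S q) = 0 := by
        by_cases hz : p - c • S q = 0
        · rw [hz, map_zero]
        · refine ih _ ?_ _ rfl
          rw [← hp]
          exact natDegree_lt_natDegree hz hlt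
      rwa [map_sub, map_smul, hTSq, smul_zero, sub_zero] at h0

end DegreeRaising

/-! ### Centralizers of elements of positive top degree -/

section TopDegree

variable {K : Type*} [Field K] [CharZero K]

lemma exists_forall_eval_ne_zero {β : K[X]} (hβ : β ≠ 0) :
    ∃ N : ℕ, ∀ n : ℕ, N ≤ n → β.eval ((n : K) + 1) ≠ 0 := by
  have hfin : {n : ℕ | β.eval ((n : K) + 1) = 0}.Finite := by
    refine Set.Finite.of_finite_image (f := fun n : ℕ => (n : K) + 1)
      ((finite_setOfPred_isRoot hβ).subset ?_) ?_
    · rintro _ ⟨n, hn, rfl⟩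
      exact hn
    · intro m _ n _ hmn
      exact Nat.cast_injective (add_right_cancel (hmn : (m : K) + 1 = n + 1))
  obtain ⟨N, hN⟩ := hfin.bddAbove
  refine ⟨N + 1, fun n hn h => ?_⟩
  have := hN h
  omega

lemma coeff_rep_eq_sum (b : I₁ K) (p : K[X]) (i : ℕ) :
    (rep K b p).coeff i = ∑ j ∈ Finset.range (p.natDegree + 1), entry i j b * p.coeff j := by
  rw [coeff_rep, p.sum_over_range fun j => mul_zero _]

/-- In degree deg p + k only the leading coefficient of p contributes, with a factor β(deg p + k +
1), which is nonzero for large degrees. -/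
lemma HasTop.natDegree_rep {b : I₁ K} {k : ℤ} {β : K[X]} (hb : HasTop b k β) (hβ : β ≠ 0) :
    ∃ N : ℕ, ∀ p : K[X], N ≤ p.natDegree → p ≠ 0 →
      rep K b p ≠ 0 ∧ ((rep K b p).natDegree : ℤ) = p.natDegree + k := by
  obtain ⟨M, hM⟩ := hb
  obtain ⟨M', hM'⟩ := exists_forall_eval_ne_zero hβ
  refine ⟨M + M' + k.natAbs, fun p hp hp0 => ?_⟩
  obtain ⟨n, hn⟩ := Int.eq_ofNat_of_zero_le (a := (p.natDegree : ℤ) + k) (by omega)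
  have hcoeff : (rep K b p).coeff n ≠ 0 := by
    rw [coeff_rep_eq_sum, Finset.sum_eq_single p.natDegree]
    · rw [(hM n _ (by omega)).2 (by omega)]
      exact mul_ne_zero (hM' n (by omega)) (leadingCoeff_ne_zero.2 hp0)
    · intro j hj hne
      rw [Finset.mem_range] at hj
      rw [(hM n j (by omega)).1 (by omega), zero_mul]
    · simp
  have hle : (rep K b p).natDegree ≤ n := by
    refine natDegree_le_iff_coeff_eq_zero.2 fun i hi => ?_
    rw [coeff_rep_eq_sum]
    refine Finset.sum_eq_zero fun j hj => ?_
    rw [Finset.mem_range] at hj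
    rw [(hM i j (by omega)).1 (by omega), zero_mul]
  refine ⟨fun h => hcoeff (by rw [h, coeff_zero]), ?_⟩
  rw [le_antisymm hle (le_natDegree_of_ne_zero hcoeff), hn]

lemma HasTop.rep_mem_degreeLT {b : I₁ K} {k : ℤ} {β : K[X]} (hb : HasTop b k β) :
    ∃ N : ℕ, ∀ D D' : ℕ, N ≤ D → (D' : ℤ) = D + k → ∀ p ∈ degreeLT K D,
      rep K b p ∈ degreeLT K D' := by
  obtain ⟨M, hM⟩ := hb
  refine ⟨M + k.natAbs + 1, fun D D' hD hD' p hp => mem_degreeLT.2 ?_⟩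
  have hp := natDegree_lt_of_mem_degreeLT (by omega) hp
  refine (degree_lt_iff_coeff_zero _ _).2 fun i hi => ?_
  rw [coeff_rep_eq_sum]
  refine Finset.sum_eq_zero fun j hj => ?_
  rw [Finset.mem_range] at hj
  rw [(hM i j (by omega)).1 (by omega), zero_mul]

lemma rep_comm {a b : I₁ K} (h : a * b = b * a) (p : K[X]) :
    rep K a (rep K b p) = rep K b (rep K a p) := by
  rw [← Module.End.mul_apply, ← Module.End.mul_apply, ← map_mul, ← map_mul, h]

lemma HasTop.raises {a : I₁ K} {m : ℕ} {α : K[X]} (ha : HasTop a m α) (hα : α ≠ 0) (hm : 0 < m) :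
    ∃ N : ℕ, (∀ p : K[X], N ≤ p.natDegree → p ≠ 0 →
      (rep K a p).natDegree = p.natDegree + m) ∧
      ∀ p : K[X], N ≤ p.natDegree → p.natDegree < (rep K a p).natDegree := by
  obtain ⟨N, hN⟩ := ha.natDegree_rep hα
  have h1 (p : K[X]) (hp : N + 1 ≤ p.natDegree) (hp0 : p ≠ 0) :
      (rep K a p).natDegree = p.natDegree + m := by
    have := (hN p (by omega) hp0).2
    omega
  refine ⟨N + 1, h1, fun p hp => ?_⟩
  rw [h1 p hp fun h => by rw [h, natDegree_zero] at hp; omega]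
  omega

lemma hasTop_pow {b : I₁ K} {k : ℤ} {β : K[X]} (hb : HasTop b k β) (hβ : β ≠ 0) (r : ℕ) :
    ∃ γ, γ ≠ 0 ∧ HasTop (b ^ r) (r * k) γ := by
  induction r with
  | zero => exact ⟨1, one_ne_zero, by simpa using hasTop_one⟩
  | succ r ih =>
    obtain ⟨γ, hγ, h⟩ := ih
    refine ⟨_, mul_ne_zero hγ (comp_X_sub_C_ne_zero hβ ((r * k : ℤ) : K)), ?_⟩
    have := h.mul hb
    rw [← pow_succ] at this
    convert this using 1
    push_cast
    ring

/-- An element that commutes with an element of positive top degree has non-negative top degree. -/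
lemma HasTop.nonneg_of_commute {a b : I₁ K} {m : ℕ} {k : ℤ} {α β : K[X]} (ha : HasTop a m α)
    (hα : α ≠ 0) (hm : 0 < m) (hab : a * b = b * a) (hb : HasTop b k β) (hβ : β ≠ 0) : 0 ≤ k := by
  by_contra! hk
  obtain ⟨N, -, hN⟩ := ha.raises hα hm
  -- The power N + 1 lowers large degrees by at least N + 1, whereas an operator commuting with a
  -- can lower them by at most N.
  obtain ⟨γ, hγ, hc⟩ := hasTop_pow hb hβ (N + 1)
  have hcomm : a * b ^ (N + 1) = b ^ (N + 1) * a := ((show Commute a b from hab).pow_right _).eq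
  obtain ⟨M, hM⟩ := hc.natDegree_rep hγ
  obtain ⟨D, hD⟩ := hc.rep_mem_degreeLT
  have hneg : ((N + 1 : ℕ) : ℤ) * k ≤ -(N + 1) := by
    push_cast
    nlinarith
  set l := ((N + 1 : ℕ) : ℤ) * k with hl
  have := le_add_of_commute_of_lowers (rep_comm hcomm) hN
    ⟨M, fun p hp => by
      by_contra h
      refine (hM p (not_lt.1 fun h' => h (mem_degreeLT_of_natDegree_lt h')) ?_).1
        (LinearMap.mem_ker.1 hp)
      rintro rfl
      exact h (zero_mem _)⟩
    (D := D + l.natAbs) (D' := D) (hD _ _ (by omega) (by omega))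
  omega

variable (K) in
/-- `F ∩ Cen(a)` as a subspace of `𝕀₁`. -/
noncomputable abbrev FCen (a : I₁ K) : Submodule K (I₁ K) := F K ⊓ Subalgebra.toSubmodule (Cen a)

omit [CharZero K] in
lemma mem_FCen {a b : I₁ K} : b ∈ FCen K a ↔ b ∈ F K ∧ a * b = b * a := by
  rw [FCen, Submodule.mem_inf, Subalgebra.mem_toSubmodule, mem_Cen_iff]

lemma range_rep_le_of_mem_Fle {n : ℕ} {c : I₁ K} (hc : c ∈ Fle K n) :
    LinearMap.range (rep K c) ≤ degreeLT K (n + 1) := by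
  rintro _ ⟨p, rfl⟩
  refine mem_degreeLT.2 ((degree_lt_iff_coeff_zero _ _).2 fun i hi => ?_)
  rw [coeff_rep_eq_sum]
  exact Finset.sum_eq_zero fun j _ => by rw [mem_Fle_iff.1 hc i j (by omega), zero_mul]

/-- `Cen_F(a)` is finite dimensional if `a` has positive top degree. -/
lemma HasTop.finiteDimensional_FCen {a : I₁ K} {m : ℕ} {α : K[X]} (ha : HasTop a m α) (hα : α ≠ 0)
    (hm : 0 < m) : FiniteDimensional K (FCen K a) := by
  obtain ⟨N, hN, hN'⟩ := ha.raises hα hm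
  -- The image of c is finite dimensional since c ∈ F, and a-invariant since c commutes with a.
  have hrange (c : FCen K a) (p : K[X]) : rep K (c : I₁ K) p ∈ degreeLT K N := by
    obtain ⟨n, hn⟩ := exists_mem_Fle (mem_FCen.1 c.2).1
    have := Submodule.finiteDimensional_of_le (range_rep_le_of_mem_Fle hn)
    refine le_degreeLT_of_invariant hN' (LinearMap.range (rep K (c : I₁ K))) ?_ ⟨p, rfl⟩
    rintro _ ⟨q, rfl⟩
    exact ⟨rep K a q, (rep_comm (mem_FCen.1 c.2).2 q).symm⟩
  -- Restriction to degrees below N + m is injective by `eq_zero_of_commute_of_degreeLT`, and its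
  -- target is finite dimensional.
  let Φ : FCen K a →ₗ[K] degreeLT K (N + m) →ₗ[K] degreeLT K N :=
    { toFun := fun c => (rep K (c : I₁ K)).restrict fun p _ => hrange c p
      map_add' := fun c c' => LinearMap.ext fun p => Subtype.ext (by simp)
      map_smul' := fun r c => LinearMap.ext fun p => Subtype.ext (by simp) }
  refine Module.Finite.of_injective Φ ?_
  refine (injective_iff_map_eq_zero Φ).2 fun c hc => Subtype.ext (rep_injective ?_)
  rw [Submodule.coe_zero, map_zero]
  refine eq_zero_of_commute_of_degreeLT (rep_comm (mem_FCen.1 c.2).2) hm hN fun p hp => ?_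
  exact congrArg Subtype.val (LinearMap.congr_fun hc ⟨p, hp⟩)

/-- The rational function β/γ has period m, so it takes one value on an infinite arithmetic
progression and is constant. The progression starts beyond the zeros of γ. -/
lemma eq_smul_of_shift_eq {β γ : K[X]} {m : ℕ} (hm : 0 < m) (hγ : γ ≠ 0)
    (h : β.comp (X - C (m : K)) * γ = β * γ.comp (X - C (m : K))) : ∃ c : K, β = c • γ := by
  obtain ⟨N, hN⟩ := exists_forall_eval_ne_zero hγ
  have heval (n : ℕ) (hn : N ≤ n) : β.eval ((n : K) + 1) * γ.eval (((n + m : ℕ) : K) + 1) =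
      β.eval (((n + m : ℕ) : K) + 1) * γ.eval ((n : K) + 1) := by
    have := congrArg (eval (((n + m : ℕ) : K) + 1)) h
    simp only [eval_mul, eval_comp, eval_sub, eval_X, eval_C] at this
    have h' : ((n + m : ℕ) : K) + 1 - m = n + 1 := by push_cast; ring
    rwa [h'] at this
  refine ⟨β.eval ((N : K) + 1) / γ.eval ((N : K) + 1), ?_⟩
  set c := β.eval ((N : K) + 1) / γ.eval ((N : K) + 1) with hc
  have key (t : ℕ) : β.eval (((N + t * m : ℕ) : K) + 1) =
      c * γ.eval (((N + t * m : ℕ) : K) + 1) := by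
    induction t with
    | zero =>
      rw [zero_mul, add_zero, hc, div_mul_cancel₀ _ (hN N le_rfl)]
    | succ t ih =>
      have h1 := heval (N + t * m) (Nat.le_add_right _ _)
      rw [ih] at h1
      have h2 := hN (N + t * m) (Nat.le_add_right _ _)
      have h3 : N + (t + 1) * m = N + t * m + m := by ring
      rw [h3]
      refine mul_right_cancel₀ h2 ?_
      rw [← h1]
      ring
  refine eq_of_infinite_eval_eq β (c • γ) (Set.Infinite.mono (s := Set.range
    fun t : ℕ => ((N + t * m : ℕ) : K) + 1) ?_ (Set.infinite_range_of_injective ?_))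
  · rintro _ ⟨t, rfl⟩
    rw [Set.mem_ofPred_eq, eval_smul, smul_eq_mul]
    exact key t
  · intro t t' ht
    have : ((N + t * m : ℕ) : K) = ((N + t' * m : ℕ) : K) := add_right_cancel ht
    have := Nat.cast_injective this
    exact Nat.eq_of_mul_eq_mul_right hm (by omega)

/-- Two elements of the same top degree in the centralizer of an element of positive top degree
have proportional leading coefficients. -/
lemma HasTop.proportional {a b c : I₁ K} {m : ℕ} {n : ℤ} {α β γ : K[X]} (ha : HasTop a m α)
    (hα : α ≠ 0) (hm : 0 < m) (hb : HasTop b n β) (hab : a * b = b * a) (hc : HasTop c n γ)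
    (hac : a * c = c * a) (hγ : γ ≠ 0) : ∃ r : K, β = r • γ := by
  -- Leading coefficients of ab = ba. The same relation for c has the same factor α(H - n);
  -- eliminating it leaves an m-periodic quotient β/γ.
  have hB : α * β.comp (X - C (m : K)) = β * α.comp (X - C (n : K)) := by
    have h1 := ha.mul hb
    rw [hab, add_comm, Int.cast_natCast] at h1
    exact h1.unique (hb.mul ha)
  have hC : α * γ.comp (X - C (m : K)) = γ * α.comp (X - C (n : K)) := by
    have h1 := ha.mul hc
    rw [hac, add_comm, Int.cast_natCast] at h1
    exact h1.unique (hc.mul ha)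
  refine eq_smul_of_shift_eq hm hγ (mul_left_cancel₀ hα ?_)
  calc α * (β.comp (X - C (m : K)) * γ) = (α * β.comp (X - C (m : K))) * γ := by ring
    _ = β * (γ * α.comp (X - C (n : K))) := by rw [hB]; ring
    _ = α * (β * γ.comp (X - C (m : K))) := by rw [← hC]; ring

/-- The level function of the case `a ∉ K[H] + F`: the top degree of `σ(x)`, where `σ` is the
identity or the transposition. -/
lemma isLevel_top (σ : I₁ K →ₗ[K] I₁ K) (hone : σ 1 = 1) (hF : ∀ x, σ x ∈ F K ↔ x ∈ F K)
    (hσ : (∀ x y, σ (x * y) = σ x * σ y) ∨ ∀ x y, σ (x * y) = σ y * σ x)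
    {a : I₁ K} {m : ℕ} {α : K[X]} (ha : HasTop (σ a) m α) (hα : α ≠ 0) (hm : 0 < m) :
    IsLevel K (CenF a) fun x n => ∃ β, β ≠ 0 ∧ HasTop (σ (x : I₁ K)) n β := by
  have hcomm (x : Cen a) : σ a * σ x = σ x * σ a := by
    have := mem_Cen_iff.1 x.2
    rcases hσ with h | h
    · rw [← h, ← h, this]
    · rw [← h, ← h, this]
  constructor
  · exact fun hx y => CenF_mul_mem hx y
  · intro x hx
    obtain ⟨k, β, hβ, h⟩ := exists_hasTop fun h => hx ((hF _).1 h)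
    obtain ⟨n, rfl⟩ := Int.eq_ofNat_of_zero_le (ha.nonneg_of_commute hα hm (hcomm x) h hβ)
    exact ⟨n, β, hβ, h⟩
  · rintro x n ⟨β, hβ, h⟩ hx
    exact h.notMem_F hβ ((hF _).2 hx)
  · refine ⟨1, one_ne_zero, ?_⟩
    rw [OneMemClass.coe_one, hone]
    exact hasTop_one
  · rintro x y k l ⟨β, hβ, hx⟩ ⟨γ, hγ, hy⟩
    rw [MulMemClass.coe_mul]
    rcases hσ with h | h
    · rw [h, Nat.cast_add]
      exact ⟨_, mul_ne_zero hβ (comp_X_sub_C_ne_zero hγ _), hx.mul hy⟩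
    · rw [h, add_comm k, Nat.cast_add]
      exact ⟨_, mul_ne_zero hγ (comp_X_sub_C_ne_zero hβ _), hy.mul hx⟩
  · rintro x n c hc ⟨β, hβ, hx⟩
    refine ⟨c • β, smul_ne_zero hc hβ, ?_⟩
    have := hx.smul c
    rwa [← map_smul] at this
  · rintro x y k l ⟨β, hβ, hx⟩ ⟨γ, hγ, hy⟩ hlt
    refine ⟨β, hβ, ?_⟩
    have := hx.add (hy.of_lt (Nat.cast_lt.2 hlt))
    rwa [add_zero, ← map_add] at this
  -- The difference has lower top degree or lies in F. Its top degree is again non-negative, as the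
  -- difference commutes with a.
  · rintro x y n ⟨β, hβ, hx⟩ ⟨γ, hγ, hy⟩
    obtain ⟨c, rfl⟩ := ha.proportional hα hm hx (hcomm x) hy (hcomm y) hγ
    refine ⟨c, ?_⟩
    have h0 : HasTop (σ ((x - c • y : Cen a) : I₁ K)) n 0 := by
      have := hx.add (hy.smul (-c))
      rw [← map_smul, ← map_add, neg_smul, neg_smul, ← sub_eq_add_neg, add_neg_cancel] at this
      exact this
    rcases h0.exists_lt with h | ⟨l, δ, hl, hδ, h⟩
    · exact Or.inl ((hF _).1 h)
    · obtain ⟨k, rfl⟩ := Int.eq_ofNat_of_zero_le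
        (ha.nonneg_of_commute hα hm (hcomm (x - c • y)) h hδ)
      exact Or.inr ⟨k, Nat.cast_lt.1 hl, δ, hδ, h⟩

end TopDegree

/-! ### The case a ∉ K[H] + F -/

section OutsideKH

universe u

variable {K : Type u} [Field K] [CharZero K]

/-- The structure of `Cen(a)` for `a ∉ K[H] + F`, if `σ(a)` has positive top degree, where `σ` is
the identity or the transposition. -/
theorem centralizer_structure_of_hasTop (σ : I₁ K →ₗ[K] I₁ K) (hone : σ 1 = 1)
    (hF : ∀ x, σ x ∈ F K ↔ x ∈ F K) (hinj : Function.Injective σ)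
    (hσ : (∀ x y, σ (x * y) = σ x * σ y) ∨ ∀ x y, σ (x * y) = σ y * σ x)
    {a : I₁ K} {m : ℕ} {α : K[X]} (ha : HasTop (σ a) m α) (hα : α ≠ 0) (hm : 0 < m) :
    FiniteDimensional K (CenF a) ∧
    ∃ ρ : ℕ, 1 ≤ ρ ∧ ρ ∣ m ∧ cenRank a = ρ ∧
      Nonempty (Cen a ≃ₗ[Kadj a] (Fin ρ → Kadj a) × CenF a) ∧
      commutant K (Cen a) ≤ (CenF a).restrictScalars K ∧
      (CenF a : Set (Cen a)) = torsion a := by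
  have hfin' := ha.finiteDimensional_FCen hα hm
  -- σ embeds F ∩ Cen(a) into F ∩ Cen(σ(a)), whose dimension is finite by degree raising.
  have hfin : FiniteDimensional K (FCen K a) := by
    have hmem (x : FCen K a) : (σ ∘ₗ (FCen K a).subtype) x ∈ FCen K (σ a) := by
      obtain ⟨h1, h2⟩ := mem_FCen.1 x.2
      refine mem_FCen.2 ⟨(hF _).2 h1, ?_⟩
      rw [LinearMap.comp_apply, Submodule.subtype_apply]
      rcases hσ with h | h
      · rw [← h, ← h, h2]
      · rw [← h, ← h, h2]
    refine Module.Finite.of_injective (LinearMap.codRestrict _ _ hmem) fun x y hxy => ?_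
    exact Subtype.ext (hinj (congrArg Subtype.val hxy))
  obtain ⟨ρ, h1, h2, -, h3⟩ := centralizer_structure_of_level
    (isLevel_top σ hone hF hσ ha hα hm) ⟨α, hα, ha⟩ hm fun x hx =>
      mem_torsion_of_mem_invariant (FCen K a) (fun w hw => mem_FCen.2
        ⟨mul_mem_F a (mem_FCen.1 hw).1, by rw [mul_assoc, (mem_FCen.1 hw).2]⟩)
        (mem_FCen.2 ⟨hx, mem_Cen_iff.1 x.2⟩)
  refine ⟨?_, ρ, h1, h2, h3⟩
  let φ : CenF a →ₗ[K] FCen K a :=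
    { toFun := fun x => ⟨x.1, mem_FCen.2 ⟨x.2, mem_Cen_iff.1 x.1.2⟩⟩
      map_add' := fun _ _ => rfl
      map_smul' := fun _ _ => rfl }
  exact Module.Finite.of_injective φ fun x y hxy =>
    Subtype.ext (Subtype.ext (Subtype.ext_iff.1 hxy :))

/-- The number ρ is the rank of Cen(a), so it does not depend on whether a or its transpose supplied
the level function. This is why one ρ divides both -π₋(a) and π₊(a) when both levels are available.
-/
theorem centralizer_of_notMem_KH_sup_F (a : I₁ K) (ha : a ∉ KH K ⊔ F K) :
    ∃ ρ : ℕ, 1 ≤ ρ ∧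
      Module.Finite (Kadj a) (Cen a) ∧ cenRank a = (ρ : Cardinal) ∧
      Algebra.FiniteType K (Cen a) ∧
      IsNoetherianRing (Cen a) ∧ IsNoetherianRing (Cen a)ᵐᵒᵖ ∧
      Nonempty (Cen a ≃ₗ[Kadj a] (Fin ρ → Kadj a) × CenF a) ∧
      (∀ n : ℕ, 0 < n → IsPiMinus a (-(n : ℤ)) → ρ ∣ n) ∧
      (∀ m : ℕ, 0 < m → IsPiPlus a (m : ℤ) → ρ ∣ m) ∧
      commutant K (Cen a) ≤ (CenF a).restrictScalars K ∧
      FiniteDimensional K (CenF a) ∧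
      (CenF a : Set (Cen a)) = torsion a := by
  have hid := fun (m : ℕ) (hm : 0 < m) (h : ∃ α, α ≠ 0 ∧ HasTop a m α) =>
    centralizer_structure_of_hasTop LinearMap.id rfl (fun _ => Iff.rfl)
      Function.injective_id (Or.inl fun _ _ => rfl) h.choose_spec.2 h.choose_spec.1 hm
  have htr := fun (m : ℕ) (hm : 0 < m) (h : ∃ α, α ≠ 0 ∧ HasTop (transpose a) m α) =>
    centralizer_structure_of_hasTop transpose transpose_one (fun _ => transpose_mem_F)
      (Function.LeftInverse.injective transpose_transpose) (Or.inr transpose_mul)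
      h.choose_spec.2 h.choose_spec.1 hm
  obtain ⟨hfd, ρ, h1, hrank, hiso, hcomm, htor⟩ : FiniteDimensional K (CenF a) ∧
      ∃ ρ : ℕ, 1 ≤ ρ ∧ cenRank a = ρ ∧
      Nonempty (Cen a ≃ₗ[Kadj a] (Fin ρ → Kadj a) × CenF a) ∧
      commutant K (Cen a) ≤ (CenF a).restrictScalars K ∧
      (CenF a : Set (Cen a)) = torsion a := by
    obtain ⟨m, hm, h | h⟩ := exists_pos_hasTop_or_transpose ha
    · obtain ⟨hfd, ρ, h1, -, h2⟩ := hid m hm h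
      exact ⟨hfd, ρ, h1, h2⟩
    · obtain ⟨hfd, ρ, h1, -, h2⟩ := htr m hm h
      exact ⟨hfd, ρ, h1, h2⟩
  have hfinite := finite_of_equiv hiso
  refine ⟨ρ, h1, hfinite, hrank, finiteType_of_finite a, isNoetherianRing_of_finite a,
    isNoetherianRing_op_of_finite a, hiso, fun n hn h => ?_, fun m hm h => ?_, hcomm, hfd, htor⟩
  · obtain ⟨-, ρ', -, hdvd, hrank', -⟩ := htr n hn h.hasTop_transpose
    rw [hrank, Nat.cast_inj] at hrank'
    rwa [hrank']
  · obtain ⟨-, ρ', -, hdvd, hrank', -⟩ := hid m hm h.hasTop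
    rw [hrank, Nat.cast_inj] at hrank'
    rwa [hrank']

end OutsideKH

/-! ### Matrix units, the corner idempotent and the Peirce decomposition -/

section Units

variable {K : Type*} [Field K] [CharZero K]

lemma entry_e_mul (p q : ℕ) (b : I₁ K) (i j : ℕ) :
    entry i j (e K p q * b) = if i = p then entry q j b else 0 := by
  rw [entry_mul, finsum_eq_single _ q fun k hk => by rw [entry_e, if_neg (by omega), zero_mul],
    entry_e]
  by_cases h : i = p
  · rw [if_pos ⟨h, rfl⟩, if_pos h, one_mul]
  · rw [if_neg fun h' => h h'.1, if_neg h, zero_mul]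

lemma entry_mul_e (p q : ℕ) (b : I₁ K) (i j : ℕ) :
    entry i j (b * e K p q) = if j = q then entry i p b else 0 := by
  rw [entry_mul, finsum_eq_single _ p fun k hk => by rw [entry_e, if_neg (by omega), mul_zero],
    entry_e]
  by_cases h : j = q
  · rw [if_pos ⟨rfl, h⟩, if_pos h, mul_one]
  · rw [if_neg fun h' => h h'.2, if_neg h, mul_zero]

lemma e_mul_e (i j l : ℕ) : e K i j * e K j l = e K i l := by
  refine ext_entry fun p q => ?_
  rw [entry_e_mul, entry_e, entry_e]
  by_cases h : p = i
  · rw [if_pos h]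
    exact if_congr (by omega) rfl rfl
  · rw [if_neg h, if_neg (by omega)]

lemma e_mul_e_of_ne {j k : ℕ} (h : j ≠ k) (i l : ℕ) : e K i j * e K k l = 0 := by
  refine ext_entry fun p q => ?_
  rw [entry_e_mul, entry_e, map_zero, if_neg (c := j = k ∧ q = l) (by omega), ite_self]

lemma e_ne_zero (i j : ℕ) : e K i j ≠ 0 := by
  intro h
  have := entry_e (K := K) i j i j
  rw [h, map_zero, if_pos ⟨rfl, rfl⟩] at this
  exact zero_ne_one this

lemma e_mul_mul_e (i j : ℕ) (b : I₁ K) : e K i i * b * e K j j = entry i j b • e K i j := by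
  refine ext_entry fun p q => ?_
  rw [entry_mul_e, entry_e_mul, map_smul, entry_e]
  by_cases hp : p = i <;> by_cases hq : q = j <;> simp [hp, hq]

lemma aeval_H_mul_e (p : K[X]) (i j : ℕ) :
    aeval (H K) p * e K i j = p.eval ((i : K) + 1) • e K i j := by
  refine ext_entry fun k l => ?_
  rw [entry_aeval_H_mul, map_smul, entry_e, smul_eq_mul]
  by_cases h : k = i ∧ l = j
  · rw [h.1]
  · rw [if_neg h, mul_zero, mul_zero]

lemma e_mul_aeval_H (p : K[X]) (i j : ℕ) :
    e K i j * aeval (H K) p = p.eval ((j : K) + 1) • e K i j := by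
  refine ext_entry fun k l => ?_
  rw [entry_mul_aeval_H, map_smul, entry_e, smul_eq_mul]
  by_cases h : k = i ∧ l = j
  · rw [h.2, mul_comm]
  · rw [if_neg h, mul_zero, zero_mul]

variable (K) in
/-- The idempotent `e_{00} + ⋯ + e_{dd}`. -/
noncomputable def corner (d : ℤ) : I₁ K := ∑ i ∈ Finset.range (d + 1).toNat, e K i i

omit [CharZero K] in
lemma ePrime_eq (d : ℤ) : ePrime K d = 1 - corner K d := rfl

lemma entry_corner_mul (d : ℤ) (b : I₁ K) (i j : ℕ) :
    entry i j (corner K d * b) = if (i : ℤ) ≤ d then entry i j b else 0 := by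
  rw [corner, Finset.sum_mul, map_sum]
  simp only [entry_e_mul]
  rw [Finset.sum_ite_eq]
  exact if_congr (by rw [Finset.mem_range]; omega) rfl rfl

lemma entry_mul_corner (d : ℤ) (b : I₁ K) (i j : ℕ) :
    entry i j (b * corner K d) = if (j : ℤ) ≤ d then entry i j b else 0 := by
  rw [corner, Finset.mul_sum, map_sum]
  simp only [entry_mul_e]
  rw [Finset.sum_ite_eq]
  exact if_congr (by rw [Finset.mem_range]; omega) rfl rfl

lemma entry_ePrime_mul (d : ℤ) (b : I₁ K) (i j : ℕ) :
    entry i j (ePrime K d * b) = if d < (i : ℤ) then entry i j b else 0 := by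
  rw [ePrime_eq, sub_mul, one_mul, map_sub, entry_corner_mul]
  by_cases h : (i : ℤ) ≤ d
  · rw [if_pos h, if_neg (by omega), sub_self]
  · rw [if_neg h, if_pos (by omega), sub_zero]

lemma entry_mul_ePrime (d : ℤ) (b : I₁ K) (i j : ℕ) :
    entry i j (b * ePrime K d) = if d < (j : ℤ) then entry i j b else 0 := by
  rw [ePrime_eq, mul_sub, mul_one, map_sub, entry_mul_corner]
  by_cases h : (j : ℤ) ≤ d
  · rw [if_pos h, if_neg (by omega), sub_self]
  · rw [if_neg h, if_pos (by omega), sub_zero]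

lemma corner_mul_eq_iff {d : ℤ} {b : I₁ K} :
    corner K d * b = b ↔ ∀ i j : ℕ, d < i → entry i j b = 0 := by
  constructor
  · intro h i j hi
    rw [← h, entry_corner_mul, if_neg (by omega)]
  · intro h
    refine ext_entry fun i j => ?_
    rw [entry_corner_mul]
    split_ifs with hi
    · rfl
    · rw [h i j (by omega)]

lemma mul_corner_eq_iff {d : ℤ} {b : I₁ K} :
    b * corner K d = b ↔ ∀ i j : ℕ, d < j → entry i j b = 0 := by
  constructor
  · intro h i j hj
    rw [← h, entry_mul_corner, if_neg (by omega)]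
  · intro h
    refine ext_entry fun i j => ?_
    rw [entry_mul_corner]
    split_ifs with hi
    · rfl
    · rw [h i j (by omega)]

/-- Turns a condition on entries into equations with an idempotent, so that later arguments are
algebraic. -/
lemma mem_Fle_iff_corner {d : ℤ} {b : I₁ K} :
    b ∈ Fle K d ↔ corner K d * b = b ∧ b * corner K d = b := by
  rw [mem_Fle_iff, corner_mul_eq_iff, mul_corner_eq_iff]
  exact ⟨fun h => ⟨fun i j hi => h i j (Or.inl hi), fun i j hj => h i j (Or.inr hj)⟩,
    fun h i j hij => hij.elim (h.1 i j) (h.2 i j)⟩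

lemma corner_mul_corner (d : ℤ) : corner K d * corner K d = corner K d :=
  corner_mul_eq_iff.2 fun i j hi => by
    rw [← mul_one (corner K d), entry_corner_mul, if_neg (by omega)]

lemma corner_mem_Fle (d : ℤ) : corner K d ∈ Fle K d :=
  mem_Fle_iff_corner.2 ⟨corner_mul_corner d, corner_mul_corner d⟩

lemma corner_mem_F (d : ℤ) : corner K d ∈ F K := Fle_le_F d (corner_mem_Fle d)

lemma corner_mul_e_of_lt {d : ℤ} {i : ℕ} (hi : d < i) (j : ℕ) : corner K d * e K i j = 0 := by
  refine ext_entry fun k l => ?_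
  rw [entry_corner_mul, entry_e, map_zero]
  split_ifs <;> first | rfl | omega

lemma e_mul_corner_of_lt {d : ℤ} {j : ℕ} (hj : d < j) (i : ℕ) : e K i j * corner K d = 0 := by
  refine ext_entry fun k l => ?_
  rw [entry_mul_corner, entry_e, map_zero]
  split_ifs <;> first | rfl | omega

lemma corner_aeval_H_comm (d : ℤ) (p : K[X]) :
    corner K d * aeval (H K) p = aeval (H K) p * corner K d := by
  rw [corner, Finset.sum_mul, Finset.mul_sum]
  exact Finset.sum_congr rfl fun i _ => by rw [aeval_H_mul_e, e_mul_aeval_H]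

lemma ePrime_mul_ePrime (d : ℤ) : ePrime K d * ePrime K d = ePrime K d := by
  rw [ePrime_eq, mul_sub, sub_mul, sub_mul, corner_mul_corner]
  simp

/-- Formally e_d' is the infinite sum of the e_{jj} with j > d; it becomes finite against an element
with finitely many nonzero columns. -/
lemma mul_ePrime_eq_sum {d : ℤ} {n : ℕ} {b : I₁ K} (hb : ∀ i j : ℕ, n < j → entry i j b = 0) :
    b * ePrime K d = ∑ j ∈ (Finset.range (n + 1)).filter (fun j : ℕ => d < j), b * e K j j := by
  refine ext_entry fun i j => ?_
  rw [entry_mul_ePrime, map_sum]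
  simp only [entry_mul_e]
  rw [Finset.sum_ite_eq]
  by_cases hj : n < j
  · rw [hb i j hj, ite_self, ite_self]
  · exact if_congr (by rw [Finset.mem_filter, Finset.mem_range]; omega) rfl rfl

lemma ePrime_mul_eq_sum {d : ℤ} {n : ℕ} {b : I₁ K} (hb : ∀ i j : ℕ, n < i → entry i j b = 0) :
    ePrime K d * b = ∑ i ∈ (Finset.range (n + 1)).filter (fun i : ℕ => d < i), e K i i * b := by
  refine ext_entry fun i j => ?_
  rw [entry_ePrime_mul, map_sum]
  simp only [entry_e_mul]
  rw [Finset.sum_ite_eq]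
  by_cases hi : n < i
  · rw [hb i j hi, ite_self, ite_self]
  · exact if_congr (by rw [Finset.mem_filter, Finset.mem_range]; omega) rfl rfl

omit [CharZero K] in
/-- Peirce decomposition. -/
lemma peirce (d : ℤ) (b : I₁ K) : b = corner K d * b * corner K d + corner K d * b * ePrime K d +
    (ePrime K d * (b * corner K d) + ePrime K d * b * ePrime K d) := by
  rw [ePrime_eq]
  noncomm_ring

lemma e_mul_eq_iff {i : ℕ} {b : I₁ K} :
    e K i i * b = b ↔ ∀ k l : ℕ, k ≠ i → entry k l b = 0 := by
  constructor
  · intro h k l hk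
    rw [← h, entry_e_mul, if_neg hk]
  · intro h
    refine ext_entry fun k l => ?_
    rw [entry_e_mul]
    split_ifs with hk
    · rw [hk]
    · rw [h k l hk]

lemma mul_e_eq_iff {j : ℕ} {b : I₁ K} :
    b * e K j j = b ↔ ∀ k l : ℕ, l ≠ j → entry k l b = 0 := by
  constructor
  · intro h k l hk
    rw [← h, entry_mul_e, if_neg hk]
  · intro h
    refine ext_entry fun k l => ?_
    rw [entry_mul_e]
    split_ifs with hk
    · rw [hk]
    · rw [h k l hk]

lemma mem_H0_iff {d : ℤ} {b : I₁ K} :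
    b ∈ H0 K d ↔ corner K d * b = b ∧ b * e K 0 0 = b := by
  rw [corner_mul_eq_iff, mul_e_eq_iff]
  constructor
  · intro h
    induction h using Submodule.span_induction with
    | mem y hy =>
      obtain ⟨k, hk, rfl⟩ := hy
      exact ⟨fun i j hi => by rw [entry_e, if_neg (by omega)],
        fun i j hj => by rw [entry_e, if_neg (by omega)]⟩
    | zero => exact ⟨fun i j _ => map_zero _, fun i j _ => map_zero _⟩
    | add y z _ _ hy hz =>
      exact ⟨fun i j h => by rw [map_add, hy.1 i j h, hz.1 i j h, add_zero],
        fun i j h => by rw [map_add, hy.2 i j h, hz.2 i j h, add_zero]⟩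
    | smul r y _ hy =>
      exact ⟨fun i j h => by rw [map_smul, hy.1 i j h, smul_zero],
        fun i j h => by rw [map_smul, hy.2 i j h, smul_zero]⟩
  · rintro ⟨h1, h2⟩
    rw [eq_sum_e (d + 1).toNat 1 (b := b) fun i j hij => hij.elim (fun h => h1 i j (by omega))
      fun h => h2 i j (by omega)]
    refine Submodule.sum_mem _ fun i hi => Submodule.sum_mem _ fun j hj =>
      Submodule.smul_mem _ _ (Submodule.subset_span ⟨i, ?_, ?_⟩)
    · rw [Finset.mem_range] at hi; omega
    · rw [Finset.mem_range] at hj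
      rw [show j = 0 by omega]

lemma mem_V0_iff {d : ℤ} {b : I₁ K} :
    b ∈ V0 K d ↔ b * corner K d = b ∧ e K 0 0 * b = b := by
  rw [mul_corner_eq_iff, e_mul_eq_iff]
  constructor
  · intro h
    induction h using Submodule.span_induction with
    | mem y hy =>
      obtain ⟨k, hk, rfl⟩ := hy
      exact ⟨fun i j hi => by rw [entry_e, if_neg (by omega)],
        fun i j hj => by rw [entry_e, if_neg (by omega)]⟩
    | zero => exact ⟨fun i j _ => map_zero _, fun i j _ => map_zero _⟩
    | add y z _ _ hy hz =>
      exact ⟨fun i j h => by rw [map_add, hy.1 i j h, hz.1 i j h, add_zero],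
        fun i j h => by rw [map_add, hy.2 i j h, hz.2 i j h, add_zero]⟩
    | smul r y _ hy =>
      exact ⟨fun i j h => by rw [map_smul, hy.1 i j h, smul_zero],
        fun i j h => by rw [map_smul, hy.2 i j h, smul_zero]⟩
  · rintro ⟨h1, h2⟩
    rw [eq_sum_e 1 (d + 1).toNat (b := b) fun i j hij => hij.elim (fun h => h2 i j (by omega))
      fun h => h1 i j (by omega)]
    refine Submodule.sum_mem _ fun i hi => Submodule.sum_mem _ fun j hj =>
      Submodule.smul_mem _ _ (Submodule.subset_span ⟨j, ?_, ?_⟩)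
    · rw [Finset.mem_range] at hj; omega
    · rw [Finset.mem_range] at hi
      rw [show i = 0 by omega]

/-- Right multiplication by e_{0j} and e_{j0} moves column 0 to column j and back, and commutes with
left multiplication by g. -/
lemma mem_kerLeft_iff {d : ℤ} {g : I₁ K} {j : ℕ} {b : I₁ K} :
    b ∈ kerLeft d g j ↔ corner K d * b = b ∧ b * e K j j = b ∧ g * b = 0 := by
  constructor
  · rintro ⟨h, ⟨hH, hg⟩, rfl⟩
    rw [LinearMap.mulRight_apply]
    have hg : g * h = 0 := hg
    refine ⟨?_, ?_, ?_⟩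
    · rw [← mul_assoc, (mem_H0_iff.1 hH).1]
    · rw [mul_assoc, e_mul_e]
    · rw [← mul_assoc, hg, zero_mul]
  · rintro ⟨h1, h2, h3⟩
    refine ⟨b * e K j 0, ⟨mem_H0_iff.2 ⟨?_, ?_⟩, ?_⟩, ?_⟩
    · rw [← mul_assoc, h1]
    · rw [mul_assoc, e_mul_e]
    · change g * (b * e K j 0) = 0
      rw [← mul_assoc, h3, zero_mul]
    · rw [LinearMap.mulRight_apply, mul_assoc, e_mul_e, h2]

lemma mem_kerRight_iff {d : ℤ} {g : I₁ K} {i : ℕ} {b : I₁ K} :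
    b ∈ kerRight d g i ↔ b * corner K d = b ∧ e K i i * b = b ∧ b * g = 0 := by
  constructor
  · rintro ⟨h, ⟨hV, hg⟩, rfl⟩
    rw [LinearMap.mulLeft_apply]
    have hg : h * g = 0 := hg
    refine ⟨?_, ?_, ?_⟩
    · rw [mul_assoc, (mem_V0_iff.1 hV).1]
    · rw [← mul_assoc, e_mul_e]
    · rw [mul_assoc, hg, mul_zero]
  · rintro ⟨h1, h2, h3⟩
    refine ⟨e K 0 i * b, ⟨mem_V0_iff.2 ⟨?_, ?_⟩, ?_⟩, ?_⟩
    · rw [mul_assoc, h1]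
    · rw [← mul_assoc, e_mul_e]
    · change e K 0 i * b * g = 0
      rw [mul_assoc, h3, mul_zero]
    · rw [LinearMap.mulLeft_apply, ← mul_assoc, e_mul_e, h2]

lemma mem_ePrimeI_iff {d : ℤ} {b : I₁ K} :
    b ∈ (ePrimeI d : Submodule K (I₁ K)) ↔ ePrime K d * b * ePrime K d = b := by
  constructor
  · rintro ⟨c, rfl⟩
    simp only [LinearMap.comp_apply, LinearMap.mulLeft_apply, LinearMap.mulRight_apply]
    rw [← mul_assoc, ← mul_assoc, ePrime_mul_ePrime, mul_assoc _ (ePrime K d) (ePrime K d),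
      ePrime_mul_ePrime, mul_assoc]
  · intro h
    refine ⟨b, ?_⟩
    simp only [LinearMap.comp_apply, LinearMap.mulLeft_apply, LinearMap.mulRight_apply]
    rw [← mul_assoc, h]

omit [CharZero K] in
lemma mem_Fle_degF {f : I₁ K} (hf : f ∈ F K) : f ∈ Fle K (degF f) := by
  rw [degF]
  split_ifs with h
  · rw [h]; exact zero_mem _
  · exact Nat.sInf_mem (s := {n : ℕ | f ∈ Fle K n}) (exists_mem_Fle hf)

/-- Subspaces whose matrices have pairwise disjoint supports are independent. -/
lemma iSupIndep_of_disjoint_support {ι : Type*} (V : ι → Submodule K (I₁ K))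
    (S : ι → ℕ → ℕ → Prop) (hV : ∀ s, ∀ b ∈ V s, ∀ i j, ¬ S s i j → entry i j b = 0)
    (hS : ∀ s t i j, S s i j → S t i j → s = t) : iSupIndep V := by
  rw [iSupIndep_def]
  intro s
  rw [Submodule.disjoint_def]
  intro x hx hx'
  refine ext_entry fun i j => ?_
  rw [map_zero]
  by_cases hs : S s i j
  · have hle : (⨆ t, ⨆ (_ : t ≠ s), V t) ≤ LinearMap.ker (entry (K := K) i j) :=
      iSup₂_le fun t ht b hb => LinearMap.mem_ker.2 (hV t b hb i j fun h => ht (hS _ _ i j h hs))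
    exact LinearMap.mem_ker.1 (hle hx')
  · exact hV s x hx i j hs

end Units

/-! ### Elements of K[H] + F: diagonal outside a finite corner -/

section Diagonal

variable {K : Type*} [Field K] [CharZero K] {α : K[X]} {f a : I₁ K} {d : ℤ}

lemma corner_comm (hf : f ∈ Fle K d) (ha : a = aeval (H K) α + f) :
    corner K d * a = a * corner K d := by
  obtain ⟨h1, h2⟩ := mem_Fle_iff_corner.1 hf
  rw [ha, mul_add, add_mul, h1, h2, corner_aeval_H_comm]

lemma mul_e_of_lt (hf : f ∈ Fle K d) (ha : a = aeval (H K) α + f) {i : ℕ} (hi : d < i) (j : ℕ) :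
    a * e K i j = α.eval ((i : K) + 1) • e K i j := by
  rw [ha, add_mul, aeval_H_mul_e, ← (mem_Fle_iff_corner.1 hf).2, mul_assoc,
    corner_mul_e_of_lt hi, mul_zero, add_zero]

lemma e_mul_of_lt (hf : f ∈ Fle K d) (ha : a = aeval (H K) α + f) {j : ℕ} (hj : d < j) (i : ℕ) :
    e K i j * a = α.eval ((j : K) + 1) • e K i j := by
  rw [ha, mul_add, e_mul_aeval_H, ← (mem_Fle_iff_corner.1 hf).1, ← mul_assoc,
    e_mul_corner_of_lt hj, zero_mul, add_zero]

lemma e_mem_Cen (hf : f ∈ Fle K d) (ha : a = aeval (H K) α + f) {i j : ℕ} (hi : d < i)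
    (hj : d < j) (h : α.eval ((i : K) + 1) = α.eval ((j : K) + 1)) : e K i j ∈ Cen a := by
  rw [mem_Cen_iff, mul_e_of_lt hf ha hi, e_mul_of_lt hf ha hj, h]

/-- Sandwiching ab = ba between e_{ii} and e_{jj} replaces a by its eigenvalues. So a nonzero entry
outside the corner requires α(i + 1) = α(j + 1). -/
lemma entry_eq_of_mem_Cen (hf : f ∈ Fle K d) (ha : a = aeval (H K) α + f) {b : I₁ K}
    (hb : a * b = b * a) {i j : ℕ} (hi : d < i) (hj : d < j) :
    α.eval ((i : K) + 1) * entry i j b = α.eval ((j : K) + 1) * entry i j b := by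
  have h := congrArg (fun x => entry i j (e K i i * x * e K j j)) hb
  simp only [← mul_assoc, e_mul_of_lt hf ha hi i] at h
  rw [mul_assoc _ a, mul_e_of_lt hf ha hj j, smul_mul_assoc, smul_mul_assoc, mul_smul_comm,
    e_mul_mul_e, map_smul, map_smul, map_smul] at h
  simp only [map_smul, entry_e, and_self, if_true, smul_eq_mul, mul_one] at h
  exact h

/-- The orthogonal idempotents `e_{jj}`, `j > d`, in `Cen(a)`. -/
noncomputable def diagIdempotent (hf : f ∈ Fle K d) (ha : a = aeval (H K) α + f) (n : ℕ) : Cen a :=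
  -- `d.toNat + 1` exceeds d also when d = -1, although it then skips the index 0.
  ⟨e K (d.toNat + 1 + n) (d.toNat + 1 + n), e_mem_Cen hf ha (by push_cast; omega)
    (by push_cast; omega) rfl⟩

lemma diagIdempotent_ne_zero (hf : f ∈ Fle K d) (ha : a = aeval (H K) α + f) (n : ℕ) :
    diagIdempotent hf ha n ≠ 0 := fun h => e_ne_zero _ _ (congrArg Subtype.val h)

lemma diagIdempotent_mul_self (hf : f ∈ Fle K d) (ha : a = aeval (H K) α + f) (n : ℕ) :
    diagIdempotent hf ha n * diagIdempotent hf ha n = diagIdempotent hf ha n :=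
  Subtype.ext (e_mul_e _ _ _)

lemma diagIdempotent_mul (hf : f ∈ Fle K d) (ha : a = aeval (H K) α + f) (m n : ℕ) (h : m ≠ n) :
    diagIdempotent hf ha m * diagIdempotent hf ha n = 0 :=
  Subtype.ext (e_mul_e_of_ne (by omega) _ _)

/-- `Cen_F(a)` is infinite dimensional for `a ∈ K[H] + F`. -/
lemma not_finiteDimensional_CenF (hf : f ∈ Fle K d) (ha : a = aeval (H K) α + f) :
    ¬ FiniteDimensional K (CenF a) := by
  intro hfin
  let ε (n : ℕ) : CenF a := ⟨diagIdempotent hf ha n, e_mem_F _ _⟩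
  have hli : LinearIndependent K ε := by
    let coe : CenF a →ₗ[K] I₁ K :=
      { toFun := fun x => ((x : Cen a) : I₁ K)
        map_add' := fun _ _ => rfl
        map_smul' := fun _ _ => rfl }
    rw [linearIndependent_iff']
    intro s g hg i hi
    have h := congrArg (fun x => entry (d.toNat + 1 + i) (d.toNat + 1 + i) (coe x)) hg
    simp only [map_sum, map_smul, map_zero] at h
    rw [Finset.sum_eq_single i] at h
    · have h1 : coe (ε i) = e K (d.toNat + 1 + i) (d.toNat + 1 + i) := rfl
      rwa [h1, entry_e, if_pos ⟨rfl, rfl⟩, smul_eq_mul, mul_one] at h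
    · intro j _ hj
      have h1 : coe (ε j) = e K (d.toNat + 1 + j) (d.toNat + 1 + j) := rfl
      rw [h1, entry_e, if_neg (by omega), smul_zero]
    · exact fun h => absurd hi h
  exact Module.Finite.not_linearIndependent_of_infinite ε hli

lemma infinite_sums_of_diagonal (hf : f ∈ Fle K d) (ha : a = aeval (H K) α + f) :
    HasInfiniteSumOfLeftIdeals (Cen a) ∧ HasInfiniteSumOfRightIdeals (Cen a) :=
  ⟨hasInfiniteSumOfLeftIdeals_of_orthogonal _ (diagIdempotent_ne_zero hf ha)
    (diagIdempotent_mul_self hf ha) (diagIdempotent_mul hf ha),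
  hasInfiniteSumOfRightIdeals_of_orthogonal _ (diagIdempotent_ne_zero hf ha)
    (diagIdempotent_mul_self hf ha) (diagIdempotent_mul hf ha)⟩

end Diagonal

/-! ### The Peirce components of an element of Cen(a) -/

section Summands

variable {K : Type*} [Field K] [CharZero K] {α : K[X]} {f a : I₁ K} {d : ℤ}

/-- a₁₁ is the corner block of a, so it can be traded for a in conditions on elements supported in
the corner rows or columns. -/
lemma a₁₁_eq (hf : f ∈ Fle K d) (ha : a = aeval (H K) α + f) : a₁₁ d α f = a * corner K d := by
  rw [ha, add_mul, (mem_Fle_iff_corner.1 hf).2, a₁₁, corner, Finset.mul_sum]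
  simp only [aeval_H_mul_e]

lemma mem_CenFle_iff (hf : f ∈ Fle K d) (ha : a = aeval (H K) α + f) {b : I₁ K} :
    b ∈ CenFle d (a₁₁ d α f) ↔ b ∈ Fle K d ∧ a * b = b * a := by
  rw [CenFle, Submodule.mem_inf, Subalgebra.mem_toSubmodule, mem_Cen_iff, a₁₁_eq hf ha]
  refine and_congr_right fun hb => ?_
  obtain ⟨h1, h2⟩ := mem_Fle_iff_corner.1 hb
  rw [mul_assoc, h1, ← corner_comm hf ha, ← mul_assoc, h2]

lemma mem_summand_left_iff (hf : f ∈ Fle K d) (ha : a = aeval (H K) α + f) {j : ℕ} (c : K)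
    {b : I₁ K} : b ∈ kerLeft d (a₁₁ d α f - algebraMap K (I₁ K) c) j ↔
      corner K d * b = b ∧ b * e K j j = b ∧ a * b = c • b := by
  rw [mem_kerLeft_iff]
  refine and_congr_right fun h => and_congr_right fun _ => ?_
  rw [sub_mul, a₁₁_eq hf ha, mul_assoc, h, ← Algebra.smul_def, sub_eq_zero]

lemma mem_summand_right_iff (hf : f ∈ Fle K d) (ha : a = aeval (H K) α + f) {i : ℕ} (c : K)
    {b : I₁ K} : b ∈ kerRight d (a₁₁ d α f - algebraMap K (I₁ K) c) i ↔
      b * corner K d = b ∧ e K i i * b = b ∧ b * a = c • b := by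
  rw [mem_kerRight_iff]
  refine and_congr_right fun h => and_congr_right fun _ => ?_
  rw [mul_sub, a₁₁_eq hf ha, ← corner_comm hf ha, ← mul_assoc, h, ← Algebra.commutes,
    ← Algebra.smul_def, sub_eq_zero]

/-- The part of an element of `Cen(a)` in a column to the right of the corner. -/
lemma corner_mul_mul_e_mem (hf : f ∈ Fle K d) (ha : a = aeval (H K) α + f) {b : I₁ K}
    (hb : a * b = b * a) {j : ℕ} (hj : d < j) :
    corner K d * b * e K j j ∈ kerLeft d (a₁₁ d α f - algebraMap K (I₁ K)
      (α.eval ((j : K) + 1))) j := by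
  refine (mem_summand_left_iff hf ha _).2 ⟨?_, ?_, ?_⟩
  · rw [← mul_assoc, ← mul_assoc, corner_mul_corner]
  · rw [mul_assoc, e_mul_e]
  · rw [← mul_assoc, ← mul_assoc, ← corner_comm hf ha, mul_assoc _ a b, hb, mul_assoc, mul_assoc b,
      mul_e_of_lt hf ha hj, mul_smul_comm, mul_smul_comm, mul_assoc]

/-- The part of an element of `Cen(a)` in a row below the corner. -/
lemma e_mul_mul_corner_mem (hf : f ∈ Fle K d) (ha : a = aeval (H K) α + f) {b : I₁ K}
    (hb : a * b = b * a) {i : ℕ} (hi : d < i) :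
    e K i i * (b * corner K d) ∈ kerRight d (a₁₁ d α f - algebraMap K (I₁ K)
      (α.eval ((i : K) + 1))) i := by
  refine (mem_summand_right_iff hf ha _).2 ⟨?_, ?_, ?_⟩
  · rw [mul_assoc, mul_assoc, corner_mul_corner]
  · rw [← mul_assoc, e_mul_e]
  · rw [mul_assoc, mul_assoc, corner_comm hf ha, ← mul_assoc b, ← hb, mul_assoc a, ← mul_assoc,
      e_mul_of_lt hf ha hi, smul_mul_assoc]

/-- The part of an element of `Cen(a)` in the corner. -/
lemma corner_mul_mul_corner_mem (hf : f ∈ Fle K d) (ha : a = aeval (H K) α + f) {b : I₁ K}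
    (hb : a * b = b * a) : corner K d * b * corner K d ∈ CenFle d (a₁₁ d α f) := by
  refine (mem_CenFle_iff hf ha).2 ⟨mem_Fle_iff_corner.2 ⟨?_, ?_⟩, ?_⟩
  · rw [← mul_assoc, ← mul_assoc, corner_mul_corner]
  · rw [mul_assoc, corner_mul_corner]
  · have hE := corner_comm hf ha
    calc a * (corner K d * b * corner K d) = a * corner K d * b * corner K d := by
          simp only [mul_assoc]
      _ = corner K d * (a * b) * corner K d := by rw [← hE]; simp only [mul_assoc]
      _ = corner K d * b * (a * corner K d) := by rw [hb]; simp only [mul_assoc]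
      _ = corner K d * b * corner K d * a := by rw [← hE]; simp only [mul_assoc]

lemma mem_FCen_of_mem_left (hf : f ∈ Fle K d) (ha : a = aeval (H K) α + f) {j : ℕ} (hj : d < j)
    {b : I₁ K} (hb : corner K d * b = b ∧ b * e K j j = b ∧
      a * b = α.eval ((j : K) + 1) • b) : b ∈ FCen K a := by
  refine mem_FCen.2 ⟨hb.1 ▸ mem_F_mul (corner_mem_F d) b, ?_⟩
  rw [hb.2.2, ← hb.2.1, mul_assoc b, e_mul_of_lt hf ha hj, mul_smul_comm]

lemma mem_FCen_of_mem_right (hf : f ∈ Fle K d) (ha : a = aeval (H K) α + f) {i : ℕ} (hi : d < i)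
    {b : I₁ K} (hb : b * corner K d = b ∧ e K i i * b = b ∧
      b * a = α.eval ((i : K) + 1) • b) :
    b ∈ FCen K a ∧ a * b = α.eval ((i : K) + 1) • b := by
  have h : a * b = α.eval ((i : K) + 1) • b := by
    rw [← hb.2.1, ← mul_assoc, mul_e_of_lt hf ha hi, smul_mul_assoc]
  exact ⟨mem_FCen.2 ⟨hb.1 ▸ mul_mem_F b (corner_mem_F d), by rw [h, hb.2.2]⟩, h⟩

end Summands

/-! ### The direct sum decomposition of Cen_F(α + f) -/

section SummandsFCen

universe u

variable {K : Type u} [Field K] [CharZero K] {α : K[X]} {f a : I₁ K} {d : ℤ}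

omit [CharZero K] in
lemma isShiftRoot_iff {i j : ℕ} :
    IsShiftRoot α i j ↔ α.eval (((i + j : ℕ) : K) + 1) = α.eval ((j : K) + 1) := by
  rw [IsShiftRoot, IsRoot.def, eval_sub, eval_comp, eval_add, eval_X, eval_C, sub_eq_zero]
  have : (j : K) + 1 + i = ((i + j : ℕ) : K) + 1 := by push_cast; ring
  rw [this]

omit [CharZero K] in
lemma mul_mem_span_singleton {b : I₁ K} {c : K} (h : a * b = c • b) {x : I₁ K}
    (hx : x ∈ Submodule.span K {b}) : a * x ∈ Submodule.span K {b} := by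
  obtain ⟨r, rfl⟩ := Submodule.mem_span_singleton.1 hx
  rw [mul_smul_comm, h]
  exact Submodule.smul_mem _ _ (Submodule.smul_mem _ _ (Submodule.mem_span_singleton_self b))

lemma summand₂_le_FCen (hf : f ∈ Fle K d) (ha : a = aeval (H K) α + f) (s : Index₂ d α) :
    summand₂ d α f s ≤ FCen K a := by
  have hspan (i j : ℕ) (hi : d < i) (hj : d < j)
      (h : α.eval ((i : K) + 1) = α.eval ((j : K) + 1)) :
      Submodule.span K {e K i j} ≤ FCen K a := by
    rw [Submodule.span_singleton_le_iff_mem]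
    exact ⟨e_mem_F i j, e_mem_Cen hf ha hi hj h⟩
  rcases s with ⟨j, hj⟩ | ⟨i, j, hi, hj, h⟩ | ⟨i, j, hi, hj, h⟩ | _ | ⟨j, hj⟩ | ⟨i, hi⟩
  · exact hspan j j hj hj rfl
  · exact hspan (i + j) j (by push_cast; omega) hj (isShiftRoot_iff.1 h)
  · exact hspan j (i + j) hj (by push_cast; omega) (isShiftRoot_iff.1 h).symm
  · intro b hb
    obtain ⟨h1, h2⟩ := (mem_CenFle_iff hf ha).1 hb
    exact mem_FCen.2 ⟨Fle_le_F d h1, h2⟩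
  · exact fun b hb => mem_FCen_of_mem_left hf ha hj ((mem_summand_left_iff hf ha _).1 hb)
  · exact fun b hb => (mem_FCen_of_mem_right hf ha hi ((mem_summand_right_iff hf ha _).1 hb)).1

lemma mul_mem_summand₂ (hf : f ∈ Fle K d) (ha : a = aeval (H K) α + f) (s : Index₂ d α) :
    ∀ b ∈ summand₂ d α f s, a * b ∈ summand₂ d α f s := by
  intro b hb
  rcases s with ⟨j, hj⟩ | ⟨i, j, hi, hj, h⟩ | ⟨i, j, hi, hj, h⟩ | _ | ⟨j, hj⟩ | ⟨i, hi⟩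
  · exact mul_mem_span_singleton (mul_e_of_lt hf ha hj j) hb
  · exact mul_mem_span_singleton (mul_e_of_lt hf ha (by push_cast; omega) j) hb
  · exact mul_mem_span_singleton (mul_e_of_lt hf ha hj _) hb
  · obtain ⟨h1, h2⟩ := (mem_CenFle_iff hf ha).1 hb
    obtain ⟨h3, h4⟩ := mem_Fle_iff_corner.1 h1
    refine (mem_CenFle_iff hf ha).2 ⟨mem_Fle_iff_corner.2 ⟨?_, ?_⟩, ?_⟩
    · rw [← mul_assoc, corner_comm hf ha, mul_assoc, h3]
    · rw [mul_assoc, h4]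
    · rw [mul_assoc, ← h2]
  · change b ∈ kerLeft _ _ _ at hb
    change a * b ∈ kerLeft _ _ _
    rw [((mem_summand_left_iff hf ha _).1 hb).2.2]
    exact Submodule.smul_mem _ _ hb
  · change b ∈ kerRight _ _ _ at hb
    change a * b ∈ kerRight _ _ _
    rw [(mem_FCen_of_mem_right hf ha hi ((mem_summand_right_iff hf ha _).1 hb)).2]
    exact Submodule.smul_mem _ _ hb

/-- The positions of the nonzero matrix entries of the summands of `Cen_F(α + f)`. -/
def Index₂.support : Index₂ d α → ℕ → ℕ → Prop
  | .diag j _ => fun p q => p = j ∧ q = j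
  | .lower i j _ _ _ => fun p q => p = i + j ∧ q = j
  | .upper i j _ _ _ => fun p q => p = j ∧ q = i + j
  | .corner => fun p q => (p : ℤ) ≤ d ∧ (q : ℤ) ≤ d
  | .left j _ => fun p q => (p : ℤ) ≤ d ∧ q = j
  | .right i _ => fun p q => p = i ∧ (q : ℤ) ≤ d

lemma iSupIndep_summand₂ (hf : f ∈ Fle K d) (ha : a = aeval (H K) α + f) :
    iSupIndep (summand₂ d α f) := by
  refine iSupIndep_of_disjoint_support _ Index₂.support ?_ ?_
  · have hspan (k l : ℕ) (b : I₁ K) (hb : b ∈ Submodule.span K {e K k l}) (p q : ℕ)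
        (h : ¬ (p = k ∧ q = l)) : entry p q b = 0 := by
      obtain ⟨r, rfl⟩ := Submodule.mem_span_singleton.1 hb
      rw [map_smul, entry_e, if_neg h, smul_zero]
    rintro (⟨j, hj⟩ | ⟨i, j, hi, hj, h⟩ | ⟨i, j, hi, hj, h⟩ | _ | ⟨j, hj⟩ | ⟨i, hi⟩) b hb p q hpq
    · exact hspan _ _ b hb p q hpq
    · exact hspan _ _ b hb p q hpq
    · exact hspan _ _ b hb p q hpq
    · have hpq : ¬ ((p : ℤ) ≤ d ∧ (q : ℤ) ≤ d) := hpq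
      exact mem_Fle_iff.1 ((mem_CenFle_iff hf ha).1 hb).1 p q (by omega)
    · have hpq : ¬ ((p : ℤ) ≤ d ∧ q = j) := hpq
      obtain ⟨h1, h2, -⟩ := (mem_summand_left_iff hf ha _).1 hb
      by_cases hp : d < p
      · exact corner_mul_eq_iff.1 h1 p q hp
      · exact mul_e_eq_iff.1 h2 p q (by omega)
    · have hpq : ¬ (p = i ∧ (q : ℤ) ≤ d) := hpq
      obtain ⟨h1, h2, -⟩ := (mem_summand_right_iff hf ha _).1 hb
      by_cases hq : d < q
      · exact mul_corner_eq_iff.1 h1 p q hq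
      · exact e_mul_eq_iff.1 h2 p q (by omega)
  -- A matrix position determines its summand; the condition i ≥ 1 keeps the lower and upper units
  -- off the diagonal.
  · rintro (⟨j, hj⟩ | ⟨i, j, hi, hj, h⟩ | ⟨i, j, hi, hj, h⟩ | _ | ⟨j, hj⟩ | ⟨i, hi⟩)
      (⟨j', hj'⟩ | ⟨i', j', hi', hj', h'⟩ | ⟨i', j', hi', hj', h'⟩ | _ | ⟨j', hj'⟩ | ⟨i', hi'⟩)
      p q hs ht <;> simp only [Index₂.support] at hs ht <;> first
      | rfl
      | (exfalso; omega)
      | (obtain rfl : j = j' := by omega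
         rfl)
      | (obtain rfl : j = j' := by omega
         obtain rfl : i = i' := by omega
         rfl)
      | (obtain rfl : i = i' := by omega
         rfl)

/-- Each Peirce block of a centralizing finite matrix is cut into columns, rows or single entries,
and every piece commutes with a by itself because a is diagonal outside the corner. -/
lemma iSup_summand₂ (hf : f ∈ Fle K d) (ha : a = aeval (H K) α + f) :
    (⨆ s, summand₂ d α f s) = FCen K a := by
  refine le_antisymm (iSup_le (summand₂_le_FCen hf ha)) fun b hb => ?_
  obtain ⟨hbF, hb⟩ := mem_FCen.1 hb
  obtain ⟨n, hn⟩ := exists_mem_Fle hbF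
  rw [mem_Fle_iff] at hn
  have hmem {x : I₁ K} (s : Index₂ d α) (h : x ∈ summand₂ d α f s) : x ∈ ⨆ s, summand₂ d α f s :=
    Submodule.mem_iSup_of_mem s h
  rw [peirce d b]
  refine add_mem (add_mem (hmem .corner (corner_mul_mul_corner_mem hf ha hb)) ?_)
    (add_mem ?_ ?_)
  · rw [mul_ePrime_eq_sum (n := n)]
    · refine Submodule.sum_mem _ fun j hj => ?_
      exact hmem (.left j (Finset.mem_filter.1 hj).2)
        (corner_mul_mul_e_mem hf ha hb (Finset.mem_filter.1 hj).2)
    · intro i j hj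
      rw [entry_corner_mul, hn i j (Or.inr (by exact_mod_cast hj)), ite_self]
  · rw [ePrime_mul_eq_sum (n := n)]
    · refine Submodule.sum_mem _ fun i hi => ?_
      exact hmem (.right i (Finset.mem_filter.1 hi).2)
        (e_mul_mul_corner_mem hf ha hb (Finset.mem_filter.1 hi).2)
    · intro i j hi
      rw [entry_mul_corner, hn i j (Or.inl (by exact_mod_cast hi)), ite_self]
  · rw [mul_ePrime_eq_sum (n := n), ePrime_mul_eq_sum (n := n)]
    · refine Submodule.sum_mem _ fun j hj => ?_
      rw [Finset.sum_mul]
      refine Submodule.sum_mem _ fun i hi => ?_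
      rw [e_mul_mul_e]
      have hi := (Finset.mem_filter.1 hi).2
      have hj := (Finset.mem_filter.1 hj).2
      by_cases h0 : entry i j b = 0
      · rw [h0, zero_smul]
        exact zero_mem _
      refine Submodule.smul_mem _ _ ?_
      have hα := mul_right_cancel₀ h0 (entry_eq_of_mem_Cen hf ha hb hi hj)
      -- A nonzero outer entry has α(i + 1) = α(j + 1). Off the diagonal this says that the smaller
      -- index plus 1 is a root of α(H + |i - j|) - α(H).
      rcases lt_trichotomy i j with hij | rfl | hij
      · obtain ⟨k, rfl⟩ := Nat.exists_eq_add_of_lt hij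
        have heq : i + k + 1 = (k + 1) + i := by ring
        rw [heq] at hα ⊢
        exact hmem (.upper (k + 1) i (by omega) hi (isShiftRoot_iff.2 hα.symm))
          (Submodule.mem_span_singleton_self _)
      · exact hmem (.diag i hi) (Submodule.mem_span_singleton_self _)
      · obtain ⟨k, rfl⟩ := Nat.exists_eq_add_of_lt hij
        have heq : j + k + 1 = (k + 1) + j := by ring
        rw [heq] at hα ⊢
        exact hmem (.lower (k + 1) j (by omega) hj (isShiftRoot_iff.2 hα))
          (Submodule.mem_span_singleton_self _)
    · exact fun i j hi => hn i j (Or.inl (by exact_mod_cast hi))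
    · intro i j hj
      rw [entry_ePrime_mul, hn i j (Or.inr (by exact_mod_cast hj)), ite_self]

lemma infinite_summand₂ : {s | summand₂ d α f s ≠ ⊥}.Infinite := by
  refine Set.infinite_of_injective_forall_mem
    (f := fun n : ℕ => Index₂.diag (α := α) (d.toNat + 1 + n) (by push_cast; omega)) ?_ ?_
  · intro m n hmn
    have := (Index₂.diag.injEq _ _ _ _).mp hmn
    omega
  · intro n h
    exact e_ne_zero _ _ ((Submodule.span_singleton_eq_bot).1 h)

end SummandsFCen

/-! ### The case a ∈ K[H] + F with nonconstant K[H]-part -/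

section ModuloF

universe u

variable {K : Type u} [Field K] [CharZero K] {α : K[X]} {f a : I₁ K} {d : ℤ}

lemma aeval_H_mem_F {p : K[X]} (h : aeval (H K) p ∈ F K) : p = 0 := by
  obtain ⟨N, hN⟩ := mem_F_iff.1 h
  refine eq_of_eventually_eval_eq N fun n hn => ?_
  have := hN n n (by omega)
  rwa [entry_aeval_H, if_pos rfl, ← eval_zero (R := K) (x := (n : K) + 1)] at this

/-- `Cen(a) ⊆ K[H] + F` for `a ∈ K[H] + F` with nonconstant `K[H]`-part. -/
lemma exists_sub_aeval_H_mem_F (hf : f ∈ Fle K d) (ha : a = aeval (H K) α + f)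
    (hα : 0 < α.natDegree) {b : I₁ K} (hb : a * b = b * a) :
    ∃ p : K[X], b - aeval (H K) p ∈ F K := by
  obtain ⟨p, l, rfl⟩ := exists_canonical b
  refine ⟨p 0, canonical_sub_mem_F l fun t ht => ?_⟩
  obtain ⟨N, hN⟩ := canonical_eventually p l
  -- On the t-th diagonal the column index is j = i - t, so commuting with a makes this product
  -- vanish at almost all row indices.
  have hmul : (α - α.comp (X - C (t : K))) * p t = 0 := by
    refine eq_of_eventually_eval_eq (N + d.natAbs + t.natAbs + 1) fun i hi => ?_
    obtain ⟨j, hj⟩ := Int.eq_ofNat_of_zero_le (a := (i : ℤ) - t) (by omega)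
    have h1 := entry_eq_of_mem_Cen hf ha hb (i := i) (j := j) (by omega) (by omega)
    rw [hN i j (by omega), show (i : ℤ) - j = t by omega] at h1
    have hjt : (j : K) = (i : K) - (t : K) := by
      exact_mod_cast congrArg (Int.cast (R := K)) hj.symm
    rw [eval_mul, eval_sub, eval_comp, eval_sub, eval_X, eval_C, eval_zero,
      show (i : K) + 1 - t = j + 1 by rw [hjt]; ring, sub_mul, h1, sub_self]
  refine (mul_eq_zero.1 hmul).resolve_left fun h => hα.ne' ?_
  rw [sub_eq_zero] at h
  -- A periodic polynomial is constant: the case γ = 1 of `eq_smul_of_shift_eq`.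
  have hconst {m : ℕ} (hm : 0 < m) (h : α.comp (X - C (m : K)) = α) : α.natDegree = 0 := by
    obtain ⟨c, hc⟩ := eq_smul_of_shift_eq hm one_ne_zero (β := α) (γ := 1) (by
      rw [h, one_comp])
    rw [hc, smul_eq_C_mul, mul_one, natDegree_C]
  rcases lt_or_gt_of_ne ht with hneg | hpos
  · obtain ⟨m, hm⟩ := Int.eq_ofNat_of_zero_le (a := -t) (by omega)
    refine hconst (m := m) (by omega) ?_
    have hmt : (m : K) = -(t : K) := by exact_mod_cast congrArg (Int.cast (R := K)) hm.symm
    conv_lhs => rw [h]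
    rw [comp_assoc, hmt]
    simp
  · obtain ⟨m, rfl⟩ := Int.eq_ofNat_of_zero_le hpos.le
    exact hconst (m := m) (by omega) (by simpa using h.symm)

omit [CharZero K] in
lemma aeval_H_comm (p q : K[X]) :
    aeval (H K) p * aeval (H K) q = aeval (H K) q * aeval (H K) p := by
  rw [← map_mul, ← map_mul, mul_comm]

lemma ePrime_mul_aeval_H_mem_Cen (hf : f ∈ Fle K d) (ha : a = aeval (H K) α + f) (p : K[X]) :
    ePrime K d * aeval (H K) p ∈ Cen a := by
  obtain ⟨h1, h2⟩ := mem_Fle_iff_corner.1 hf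
  have h1 : ePrime K d * f = 0 := by rw [ePrime_eq, sub_mul, h1, one_mul, sub_self]
  have h2 : f * ePrime K d = 0 := by rw [ePrime_eq, mul_sub, h2, mul_one, sub_self]
  have h3 (q : K[X]) : ePrime K d * aeval (H K) q = aeval (H K) q * ePrime K d := by
    rw [ePrime_eq, sub_mul, mul_sub, corner_aeval_H_comm, one_mul, mul_one]
  rw [mem_Cen_iff, ha, add_mul, mul_add, ← mul_assoc f, h2, zero_mul, add_zero, h3 p,
    mul_assoc _ _ f, h1, mul_zero, add_zero, ← mul_assoc, aeval_H_comm, mul_assoc, mul_assoc, h3]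

lemma sub_ePrime_mul_mem_F {b : I₁ K} {p : K[X]} (h : b - aeval (H K) p ∈ F K) :
    b - ePrime K d * aeval (H K) p ∈ F K := by
  have : b - ePrime K d * aeval (H K) p =
      b - aeval (H K) p + corner K d * aeval (H K) p := by
    rw [ePrime_eq]
    noncomm_ring
  rw [this]
  exact add_mem h (mem_F_mul (corner_mem_F d) _)

omit [CharZero K] in
lemma mem_ePrimeKH {b : I₁ K} :
    b ∈ (ePrimeKH d : Submodule K (I₁ K)) ↔ ∃ p : K[X], b = ePrime K d * aeval (H K) p := by
  constructor
  · rintro ⟨x, hx, rfl⟩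
    rw [KH, SetLike.mem_coe, Subalgebra.mem_toSubmodule,
      Algebra.adjoin_singleton_eq_range_aeval] at hx
    obtain ⟨p, rfl⟩ := hx
    exact ⟨p, rfl⟩
  · rintro ⟨p, rfl⟩
    exact ⟨aeval (H K) p, aeval_mem_adjoin_singleton K (H K), rfl⟩

/-- e_d' p(H) is congruent to p(H) modulo F, and K[H] meets F only in 0. -/
lemma disjoint_ePrimeKH (V : Submodule K (I₁ K)) : Disjoint (ePrimeKH d) (F K ⊓ V) := by
  rw [Submodule.disjoint_def]
  intro x hx hF
  obtain ⟨p, rfl⟩ := mem_ePrimeKH.1 hx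
  have : aeval (H K) p ∈ F K := by
    have h : aeval (H K) p = ePrime K d * aeval (H K) p + corner K d * aeval (H K) p := by
      rw [ePrime_eq]
      noncomm_ring
    rw [h]
    exact add_mem hF.1 (mem_F_mul (corner_mem_F d) _)
  rw [aeval_H_mem_F this, map_zero, mul_zero]

lemma ePrimeKH_sup_FCen (hf : f ∈ Fle K d) (ha : a = aeval (H K) α + f) (hα : 0 < α.natDegree) :
    ePrimeKH d ⊔ FCen K a = Subalgebra.toSubmodule (Cen a) := by
  refine le_antisymm (sup_le ?_ inf_le_right) fun b hb => ?_
  · intro b hb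
    obtain ⟨p, rfl⟩ := mem_ePrimeKH.1 hb
    exact ePrime_mul_aeval_H_mem_Cen hf ha p
  · obtain ⟨p, hp⟩ := exists_sub_aeval_H_mem_F hf ha hα (mem_Cen_iff.1 hb)
    rw [← add_sub_cancel (ePrime K d * aeval (H K) p) b]
    exact Submodule.add_mem_sup (mem_ePrimeKH.2 ⟨p, rfl⟩)
      ⟨sub_ePrime_mul_mem_F hp, sub_mem hb (ePrime_mul_aeval_H_mem_Cen hf ha p)⟩

/-- The level function of the case `a ∈ K[H] + F`: the degree of the `K[H]`-part. -/
lemma isLevel_natDegree (hf : f ∈ Fle K d) (ha : a = aeval (H K) α + f) (hα : 0 < α.natDegree) :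
    IsLevel K (CenF a) fun x n =>
      ∃ p : K[X], p ≠ 0 ∧ p.natDegree = n ∧ (x : I₁ K) - aeval (H K) p ∈ F K := by
  constructor
  · exact fun hx y => CenF_mul_mem hx y
  · intro x hx
    obtain ⟨p, hp⟩ := exists_sub_aeval_H_mem_F hf ha hα (mem_Cen_iff.1 x.2)
    refine ⟨_, p, ?_, rfl, hp⟩
    rintro rfl
    rw [map_zero, sub_zero] at hp
    exact hx hp
  · rintro x n ⟨p, hp0, -, hp⟩ hx
    refine hp0 (aeval_H_mem_F ?_)
    have := sub_mem (mem_CenF_iff.1 hx) hp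
    rwa [sub_sub_cancel] at this
  · exact ⟨1, one_ne_zero, natDegree_one, by simp⟩
  · rintro x y m n ⟨p, hp0, rfl, hp⟩ ⟨q, hq0, rfl, hq⟩
    refine ⟨p * q, mul_ne_zero hp0 hq0, natDegree_mul hp0 hq0, ?_⟩
    have : ((x * y : Cen a) : I₁ K) - aeval (H K) (p * q) =
        (x - aeval (H K) p) * y + aeval (H K) p * (y - aeval (H K) q) := by
      rw [map_mul, MulMemClass.coe_mul]
      noncomm_ring
    rw [this]
    exact add_mem (mem_F_mul hp _) (mul_mem_F _ hq)
  · rintro x n c hc ⟨p, hp0, rfl, hp⟩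
    refine ⟨c • p, smul_ne_zero hc hp0, natDegree_smul p hc, ?_⟩
    have := (F K).smul_mem c hp
    rwa [smul_sub, ← map_smul] at this
  · rintro x y m n ⟨p, hp0, rfl, hp⟩ ⟨q, hq0, rfl, hq⟩ hlt
    have hd := natDegree_add_eq_left_of_natDegree_lt hlt
    refine ⟨p + q, ?_, hd, ?_⟩
    · intro h
      rw [h, natDegree_zero] at hd
      omega
    · have := add_mem hp hq
      rw [map_add]
      convert this using 1
      rw [AddMemClass.coe_add]
      abel
  · rintro x y n ⟨p, hp0, hpn, hp⟩ ⟨q, hq0, hqn, hq⟩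
    have hlc := leadingCoeff_ne_zero.2 hq0
    set c := p.leadingCoeff / q.leadingCoeff with hc
    have hc0 : c ≠ 0 := div_ne_zero (leadingCoeff_ne_zero.2 hp0) hlc
    have hmem : ((x - c • y : Cen a) : I₁ K) - aeval (H K) (p - c • q) ∈ F K := by
      have := sub_mem hp ((F K).smul_mem c hq)
      rw [map_sub, map_smul]
      convert this using 1
      rw [smul_sub, AddSubgroupClass.coe_sub, Subalgebra.coe_smul]
      abel
    refine ⟨c, ?_⟩
    by_cases hz : p - c • q = 0
    · left
      rw [hz, map_zero, sub_zero] at hmem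
      exact hmem
    · refine Or.inr ⟨_, ?_, p - c • q, hz, rfl, hmem⟩
      rw [← hpn]
      refine natDegree_lt_natDegree hz (degree_sub_lt_left ?_ hp0 ?_)
      · rw [degree_smul_of_smul_regular _ (IsSMulRegular.of_ne_zero hc0), degree_eq_natDegree hp0,
          degree_eq_natDegree hq0, hpn, hqn]
      · rw [leadingCoeff_smul_of_smul_regular _ (IsSMulRegular.of_ne_zero hc0), smul_eq_mul, hc,
          div_mul_cancel₀ _ hlc]

lemma mul_mem_Fle (hf : f ∈ Fle K d) (ha : a = aeval (H K) α + f) {n : ℕ} (hn : d ≤ n) {b : I₁ K}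
    (hb : b ∈ Fle K n) : a * b ∈ Fle K n := by
  refine mem_Fle_iff_corner.2 ⟨?_, ?_⟩
  · rw [← mul_assoc, corner_comm (Fle_mono hn hf) ha, mul_assoc, (mem_Fle_iff_corner.1 hb).1]
  · rw [mul_assoc, (mem_Fle_iff_corner.1 hb).2]

/-- Left multiplication by a preserves the finite dimensional spaces F_{≤ n} with n ≥ d, which
exhaust F. -/
lemma CenF_subset_torsion (hf : f ∈ Fle K d) (ha : a = aeval (H K) α + f) {x : Cen a}
    (hx : x ∈ CenF a) : x ∈ torsion a := by
  obtain ⟨n, hn⟩ := exists_mem_Fle (mem_CenF_iff.1 hx)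
  refine mem_torsion_of_mem_invariant (Fle K (n + d.toNat : ℕ))
    (fun w hw => mul_mem_Fle hf ha (by push_cast; omega) hw) (Fle_mono (by push_cast; omega) hn)

/-- `Cen(a)` is not finitely generated as an algebra if it lies in `K[H] + F`. -/
lemma not_finiteType (hf : f ∈ Fle K d) (ha : a = aeval (H K) α + f) (hα : 0 < α.natDegree) :
    ¬ Algebra.FiniteType K (Cen a) := by
  rintro ⟨S, hS⟩
  have hex (x : Cen a) : ∃ (p : K[X]) (n : ℕ), (x : I₁ K) - aeval (H K) p ∈ Fle K n := by
    obtain ⟨p, hp⟩ := exists_sub_aeval_H_mem_F hf ha hα (mem_Cen_iff.1 x.2)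
    exact ⟨p, exists_mem_Fle hp⟩
  choose P n hn using hex
  -- K[H] + F_{≤ N} is closed under products and contains all the chosen generators, but it misses
  -- the element e_{N+1,N+1} of Cen(a).
  set N := S.sup n + d.toNat with hN
  have hall (x : Cen a) : ∃ p : K[X], (x : I₁ K) - aeval (H K) p ∈ Fle K N := by
    have hx : x ∈ Algebra.adjoin K (S : Set (Cen a)) := by rw [hS]; trivial
    induction hx using Algebra.adjoin_induction with
    | mem x hx =>
      have := Finset.le_sup (f := n) hx
      exact ⟨P x, Fle_mono (by omega) (hn x)⟩
    | algebraMap r => exact ⟨C r, by simp⟩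
    | add x y _ _ hx hy =>
      obtain ⟨p, hp⟩ := hx
      obtain ⟨q, hq⟩ := hy
      refine ⟨p + q, ?_⟩
      rw [map_add, AddMemClass.coe_add, add_sub_add_comm]
      exact add_mem hp hq
    | mul x y _ _ hx hy =>
      obtain ⟨p, hp⟩ := hx
      obtain ⟨q, hq⟩ := hy
      refine ⟨p * q, ?_⟩
      obtain ⟨h1, h2⟩ := mem_Fle_iff_corner.1 hp
      obtain ⟨h3, h4⟩ := mem_Fle_iff_corner.1 hq
      have : ((x * y : Cen a) : I₁ K) - aeval (H K) (p * q) =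
          (x - aeval (H K) p) * aeval (H K) q + (x - aeval (H K) p) * (y - aeval (H K) q) +
            aeval (H K) p * (y - aeval (H K) q) := by
        rw [map_mul, MulMemClass.coe_mul]
        noncomm_ring
      rw [this]
      refine add_mem (add_mem ?_ ?_) ?_ <;> refine mem_Fle_iff_corner.2 ⟨?_, ?_⟩
      · rw [← mul_assoc, h1]
      · rw [mul_assoc, ← corner_aeval_H_comm, ← mul_assoc, h2]
      · rw [← mul_assoc, h1]
      · rw [mul_assoc, h4]
      · rw [← mul_assoc, corner_aeval_H_comm, mul_assoc, h3]
      · rw [mul_assoc, h4]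
  obtain ⟨p, hp⟩ := hall ⟨e K (N + 1) (N + 1), e_mem_Cen hf ha (by push_cast; omega)
    (by push_cast; omega) rfl⟩
  rw [mem_Fle_iff] at hp
  have hp0 : p = 0 := by
    refine eq_of_eventually_eval_eq (N + 2) fun i hi => ?_
    have := hp i i (Or.inl (by omega))
    rw [map_sub, entry_aeval_H, if_pos rfl, entry_e, if_neg (by omega), zero_sub, neg_eq_zero]
      at this
    rw [this, eval_zero]
  have := hp (N + 1) (N + 1) (Or.inl (by push_cast; omega))
  rw [hp0, map_zero, sub_zero, entry_e, if_pos ⟨rfl, rfl⟩] at this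
  exact one_ne_zero this

theorem centralizer_of_mem_KH_sup_F (a : I₁ K) (α : K[X]) (f : I₁ K) (d : ℤ) (hfF : f ∈ F K)
    (ha : a = aeval (H K) α + f) (hnot : a ∉ scalars K ⊔ F K) (hd : d = degF f) :
    ¬ Module.Finite (Kadj a) (Cen a) ∧ cenRank a = (α.natDegree : Cardinal) ∧
    ¬ Algebra.FiniteType K (Cen a) ∧
    ¬ IsNoetherianRing (Cen a) ∧ ¬ IsNoetherianRing (Cen a)ᵐᵒᵖ ∧
    HasInfiniteSumOfLeftIdeals (Cen a) ∧ HasInfiniteSumOfRightIdeals (Cen a) ∧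
    Nonempty (Cen a ≃ₗ[Kadj a] (Fin α.natDegree → Kadj a) × CenF a) ∧
    Disjoint (ePrimeKH d) (F K ⊓ Subalgebra.toSubmodule (Cen a)) ∧
    ePrimeKH d ⊔ (F K ⊓ Subalgebra.toSubmodule (Cen a)) = Subalgebra.toSubmodule (Cen a) ∧
    iSupIndep (summand₂ d α f) ∧
    (⨆ s, summand₂ d α f s) = F K ⊓ Subalgebra.toSubmodule (Cen a) ∧
    (∀ s, ∀ b ∈ summand₂ d α f s, a * b ∈ summand₂ d α f s) ∧
    {s | summand₂ d α f s ≠ ⊥}.Infinite ∧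
    commutant K (Cen a) ≤ (CenF a).restrictScalars K ∧
    ¬ FiniteDimensional K (CenF a) ∧
    (CenF a : Set (Cen a)) = torsion a := by
  have hf : f ∈ Fle K d := hd ▸ mem_Fle_degF hfF
  -- A constant α would put a into K + F.
  have hα : 0 < α.natDegree := by
    refine Nat.pos_of_ne_zero fun h => hnot ?_
    rw [natDegree_eq_zero] at h
    obtain ⟨c, rfl⟩ := h
    rw [ha, aeval_C]
    exact Submodule.add_mem_sup (Subalgebra.algebraMap_mem _ c) hfF
  obtain ⟨hleft, hright⟩ := infinite_sums_of_diagonal hf ha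
  have hnoeth := not_isNoetherianRing_of_left hleft
  obtain ⟨ρ, -, -, hall, hrank, hiso, hcomm, htor⟩ := centralizer_structure_of_level
    (isLevel_natDegree hf ha hα) ⟨α, fun h => by simp [h] at hα, rfl, by
      rw [self, ha, add_sub_cancel_left]; exact hfF⟩ hα fun x hx => CenF_subset_torsion hf ha hx
  -- Every level occurs: e_d' H^n lies in Cen(a) and has K[H]-part H^n. So the subgroup of classes
  -- is all of ℤ/deg α.
  have hρ : ρ = α.natDegree := hall fun n =>
    ⟨⟨_, ePrime_mul_aeval_H_mem_Cen hf ha (X ^ n)⟩, X ^ n, pow_ne_zero _ X_ne_zero,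
      natDegree_X_pow n, by
        have := sub_ePrime_mul_mem_F (d := d) (b := aeval (H K) (X ^ n : K[X])) (p := X ^ n)
          (by simp)
        rw [← neg_mem_iff, neg_sub]
        exact this⟩
  rw [hρ] at hrank hiso
  exact ⟨fun _ => hnoeth (isNoetherianRing_of_finite a), hrank, not_finiteType hf ha hα, hnoeth,
    not_isNoetherianRing_op_of_right hright, hleft, hright, hiso, disjoint_ePrimeKH _,
    ePrimeKH_sup_FCen hf ha hα, iSupIndep_summand₂ hf ha, iSup_summand₂ hf ha,
    mul_mem_summand₂ hf ha, infinite_summand₂, hcomm, not_finiteDimensional_CenF hf ha, htor⟩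

end ModuloF

/-! ### The case a ∈ (K + F) ∖ K -/

section ScalarPlusF

universe u

variable {K : Type u} [Field K] [CharZero K] {f : I₁ K} {d : ℤ}

lemma mul_e_eq_zero (hf : f ∈ Fle K d) {i : ℕ} (hi : d < i) (j : ℕ) : f * e K i j = 0 := by
  rw [← (mem_Fle_iff_corner.1 hf).2, mul_assoc, corner_mul_e_of_lt hi, mul_zero]

lemma e_mul_eq_zero (hf : f ∈ Fle K d) {j : ℕ} (hj : d < j) (i : ℕ) : e K i j * f = 0 := by
  rw [← (mem_Fle_iff_corner.1 hf).1, ← mul_assoc, e_mul_corner_of_lt hj, zero_mul]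

lemma mul_ePrime_eq_zero (hf : f ∈ Fle K d) : f * ePrime K d = 0 := by
  rw [ePrime_eq, mul_sub, (mem_Fle_iff_corner.1 hf).2, mul_one, sub_self]

lemma ePrime_mul_eq_zero (hf : f ∈ Fle K d) : ePrime K d * f = 0 := by
  rw [ePrime_eq, sub_mul, (mem_Fle_iff_corner.1 hf).1, one_mul, sub_self]

lemma ePrime_mul_mul_ePrime_mem_Cen (hf : f ∈ Fle K d) (b : I₁ K) :
    ePrime K d * b * ePrime K d ∈ Cen f := by
  rw [mem_Cen_iff, mul_assoc, ← mul_assoc f, mul_ePrime_eq_zero hf, zero_mul,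
    mul_assoc (ePrime K d), mul_assoc b, ePrime_mul_eq_zero hf, mul_zero, mul_zero]

lemma summand₃_le_Cen (hf : f ∈ Fle K d) (s : Index₃ d) :
    summand₃ d f s ≤ Subalgebra.toSubmodule (Cen f) := by
  intro b hb
  rcases s with _ | ⟨j, hj⟩ | ⟨i, hi⟩ | _
  · exact hb.2
  · obtain ⟨-, h2, h3⟩ := mem_kerLeft_iff.1 hb
    refine mem_Cen_iff.2 ?_
    rw [h3, ← h2, mul_assoc, e_mul_eq_zero hf hj, mul_zero]
  · obtain ⟨-, h2, h3⟩ := mem_kerRight_iff.1 hb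
    refine mem_Cen_iff.2 ?_
    rw [h3, ← h2, ← mul_assoc, mul_e_eq_zero hf hi, zero_mul]
  · have h : ePrime K d * b * ePrime K d = b := mem_ePrimeI_iff.1 hb
    rw [← h]
    exact ePrime_mul_mul_ePrime_mem_Cen hf b

/-- The positions of the nonzero matrix entries of the summands of `Cen(c + f)`. -/
def Index₃.support : Index₃ d → ℕ → ℕ → Prop
  | .corner => fun p q => (p : ℤ) ≤ d ∧ (q : ℤ) ≤ d
  | .left j _ => fun p q => (p : ℤ) ≤ d ∧ q = j
  | .right i _ => fun p q => p = i ∧ (q : ℤ) ≤ d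
  | .big => fun p q => d < (p : ℤ) ∧ d < (q : ℤ)

lemma iSupIndep_summand₃ : iSupIndep (summand₃ d f) := by
  refine iSupIndep_of_disjoint_support _ Index₃.support ?_ ?_
  · rintro (_ | ⟨j, hj⟩ | ⟨i, hi⟩ | _) b hb p q hpq
    · have hpq : ¬ ((p : ℤ) ≤ d ∧ (q : ℤ) ≤ d) := hpq
      exact mem_Fle_iff.1 hb.1 p q (by omega)
    · have hpq : ¬ ((p : ℤ) ≤ d ∧ q = j) := hpq
      obtain ⟨h1, h2, -⟩ := mem_kerLeft_iff.1 hb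
      by_cases hp : d < p
      · exact corner_mul_eq_iff.1 h1 p q hp
      · exact mul_e_eq_iff.1 h2 p q (by omega)
    · have hpq : ¬ (p = i ∧ (q : ℤ) ≤ d) := hpq
      obtain ⟨h1, h2, -⟩ := mem_kerRight_iff.1 hb
      by_cases hq : d < q
      · exact mul_corner_eq_iff.1 h1 p q hq
      · exact e_mul_eq_iff.1 h2 p q (by omega)
    · have hpq : ¬ (d < (p : ℤ) ∧ d < (q : ℤ)) := hpq
      have h : ePrime K d * b * ePrime K d = b := mem_ePrimeI_iff.1 hb
      rw [← h, entry_mul_ePrime, entry_ePrime_mul]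
      by_cases hp : d < (p : ℤ)
      · rw [if_neg (by omega)]
      · rw [if_neg hp, ite_self]
  · rintro (_ | ⟨j, hj⟩ | ⟨i, hi⟩ | _) (_ | ⟨j', hj'⟩ | ⟨i', hi'⟩ | _) p q hs ht <;>
      simp only [Index₃.support] at hs ht <;> first
      | rfl
      | (exfalso; omega)
      | (obtain rfl : j = j' := by omega
         rfl)
      | (obtain rfl : i = i' := by omega
         rfl)

/-- As f vanishes outside the corner, the outer block is unconstrained, while the off-diagonal
blocks need only be killed by f from the side of the corner. These two blocks are finite matrices
because the corner idempotent lies in F. -/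
lemma iSup_summand₃ (hf : f ∈ Fle K d) :
    (⨆ s, summand₃ d f s) = Subalgebra.toSubmodule (Cen f) := by
  refine le_antisymm (iSup_le (summand₃_le_Cen hf)) fun b hb => ?_
  have hb : f * b = b * f := mem_Cen_iff.1 hb
  obtain ⟨hf1, hf2⟩ := mem_Fle_iff_corner.1 hf
  have hmem {x : I₁ K} (s : Index₃ d) (h : x ∈ summand₃ d f s) : x ∈ ⨆ s, summand₃ d f s :=
    Submodule.mem_iSup_of_mem s h
  rw [peirce d b]
  refine add_mem (add_mem (hmem .corner ⟨mem_Fle_iff_corner.2 ⟨?_, ?_⟩, mem_Cen_iff.2 ?_⟩) ?_)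
    (add_mem ?_ (hmem .big ⟨b, by simp [mul_assoc]⟩))
  · rw [← mul_assoc, ← mul_assoc, corner_mul_corner]
  · rw [mul_assoc, corner_mul_corner]
  · calc f * (corner K d * b * corner K d) = f * corner K d * b * corner K d := by
          simp only [mul_assoc]
      _ = corner K d * f * b * corner K d := by rw [hf1, hf2]
      _ = corner K d * (f * b) * corner K d := by simp only [mul_assoc]
      _ = corner K d * b * (f * corner K d) := by rw [hb]; simp only [mul_assoc]
      _ = corner K d * b * (corner K d * f) := by rw [hf1, hf2]
      _ = corner K d * b * corner K d * f := by simp only [mul_assoc]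
  · obtain ⟨n, hn⟩ := exists_mem_Fle (mem_F_mul (corner_mem_F d) b)
    rw [mul_ePrime_eq_sum (n := n) fun i j hj => mem_Fle_iff.1 hn i j
      (Or.inr (by exact_mod_cast hj))]
    refine Submodule.sum_mem _ fun j hj => ?_
    have hj := (Finset.mem_filter.1 hj).2
    refine hmem (.left j hj) (mem_kerLeft_iff.2 ⟨?_, ?_, ?_⟩)
    · rw [← mul_assoc, ← mul_assoc, corner_mul_corner]
    · rw [mul_assoc, e_mul_e]
    · rw [← mul_assoc, ← mul_assoc, hf2, hb, mul_assoc, mul_e_eq_zero hf hj, mul_zero]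
  · obtain ⟨n, hn⟩ := exists_mem_Fle (mul_mem_F b (corner_mem_F d))
    rw [ePrime_mul_eq_sum (n := n) fun i j hi => mem_Fle_iff.1 hn i j
      (Or.inl (by exact_mod_cast hi))]
    refine Submodule.sum_mem _ fun i hi => ?_
    have hi := (Finset.mem_filter.1 hi).2
    refine hmem (.right i hi) (mem_kerRight_iff.2 ⟨?_, ?_, ?_⟩)
    · rw [mul_assoc, mul_assoc, corner_mul_corner]
    · rw [← mul_assoc, e_mul_e]
    · rw [mul_assoc, mul_assoc, hf1, ← hb, ← mul_assoc, e_mul_eq_zero hf hi, zero_mul]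

/-- The map `b ↦ ∫ ^ n b ∂ ^ n`, an isomorphism of `𝕀₁` onto `e_d' 𝕀₁ e_d'` for `d = n - 1`. -/
noncomputable def shift (n : ℕ) (b : I₁ K) : I₁ K := int K ^ n * b * del K ^ n

lemma del_pow_mul_int_pow (n : ℕ) : del K ^ n * int K ^ n = 1 := by
  induction n with
  | zero => simp
  | succ n ih => rw [pow_succ, pow_succ', mul_assoc, ← mul_assoc (del K), del_mul_int, one_mul, ih]

lemma shift_mul (n : ℕ) (b c : I₁ K) : shift n (b * c) = shift n b * shift n c := by
  have h : shift n b * shift n c =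
      int K ^ n * b * (del K ^ n * int K ^ n) * c * del K ^ n := by
    simp only [shift, mul_assoc]
  rw [h, del_pow_mul_int_pow, mul_one, shift, mul_assoc _ b c]

lemma shift_one (n : ℕ) : shift n (1 : I₁ K) = ePrime K ((n : ℤ) - 1) := by
  refine ext_entry fun i j => ?_
  rw [shift, mul_one, entry_int_pow_mul_del_pow, ← mul_one (ePrime K _), entry_ePrime_mul,
    entry_one]
  by_cases h : (n : ℤ) - 1 < i
  · rw [if_pos h]
    exact if_congr (by omega) rfl rfl
  · rw [if_neg h, if_neg (by omega)]

lemma shift_surjOn (n : ℕ) {b : I₁ K}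
    (hb : ePrime K ((n : ℤ) - 1) * b * ePrime K ((n : ℤ) - 1) = b) : ∃ c, shift n c = b := by
  refine ⟨del K ^ n * b * int K ^ n, ?_⟩
  rw [← hb, ← shift_one]
  simp only [shift, mul_one]
  have h := del_pow_mul_int_pow (K := K) n
  calc int K ^ n * (del K ^ n * (int K ^ n * del K ^ n * b * (int K ^ n * del K ^ n)) *
        int K ^ n) * del K ^ n = int K ^ n * (del K ^ n * int K ^ n) * del K ^ n * b * int K ^ n *
        (del K ^ n * int K ^ n) * del K ^ n := by simp only [mul_assoc]
    _ = _ := by rw [h]; simp only [mul_assoc, mul_one]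

lemma shift_mem_ePrimeI (n : ℕ) (b : I₁ K) :
    ePrime K ((n : ℤ) - 1) * shift n b * ePrime K ((n : ℤ) - 1) = shift n b := by
  rw [← shift_one, ← shift_mul, ← shift_mul, one_mul, mul_one]

lemma shift_mem_F_iff (n : ℕ) (b : I₁ K) : shift n b ∈ F K ↔ b ∈ F K := by
  constructor
  · intro h
    have h' : b = del K ^ n * shift n b * int K ^ n := by
      rw [shift]
      simp only [← mul_assoc]
      rw [del_pow_mul_int_pow, one_mul, mul_assoc, del_pow_mul_int_pow, mul_one]
    rw [h']
    exact mem_F_mul (mul_mem_F _ h) _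
  · exact fun h => mem_F_mul (mul_mem_F _ h) _

omit [CharZero K] in
lemma del_mul_xOp_sub : del K * xOp K - xOp K * del K = 1 := by
  refine toEnd_injective (LinearMap.ext fun p => ?_)
  rw [map_sub, map_mul, map_mul, map_one, toEnd_del, toEnd_xOp, LinearMap.sub_apply,
    Module.End.mul_apply, Module.End.mul_apply, LinearMap.mulLeft_apply, LinearMap.mulLeft_apply,
    derivative_mul, derivative_X, one_mul, add_sub_cancel_right, Module.End.one_apply]

instance CenFle_finiteDimensional (g : I₁ K) : FiniteDimensional K (CenFle d g) :=
  Submodule.finiteDimensional_of_le inf_le_left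

lemma kerLeft_finiteDimensional (g : I₁ K) (j : ℕ) : FiniteDimensional K (kerLeft d g j) := by
  refine Submodule.finiteDimensional_of_le (S₂ := Fle K (d.toNat + j : ℕ)) fun b hb => ?_
  obtain ⟨h1, h2, -⟩ := mem_kerLeft_iff.1 hb
  refine mem_Fle_iff.2 fun p q hpq => ?_
  by_cases hp : d < p
  · exact corner_mul_eq_iff.1 h1 p q hp
  · exact mul_e_eq_iff.1 h2 p q (by push_cast at hpq; omega)

lemma kerRight_finiteDimensional (g : I₁ K) (i : ℕ) : FiniteDimensional K (kerRight d g i) := by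
  refine Submodule.finiteDimensional_of_le (S₂ := Fle K (d.toNat + i : ℕ)) fun b hb => ?_
  obtain ⟨h1, h2, -⟩ := mem_kerRight_iff.1 hb
  refine mem_Fle_iff.2 fun p q hpq => ?_
  by_cases hq : d < q
  · exact mul_corner_eq_iff.1 h1 p q hq
  · exact e_mul_eq_iff.1 h2 p q (by push_cast at hpq; omega)

/-- `Cen(f)` is a finitely generated algebra for `f ∈ F`. -/
lemma finiteType_Cen_of_mem_F (hd : 0 ≤ d) (hf : f ∈ Fle K d) : Algebra.FiniteType K (Cen f) := by
  classical
  obtain ⟨n, hn⟩ := Int.eq_ofNat_of_zero_le (a := d + 1) (by omega)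
  have hdn : d = (n : ℤ) - 1 := by rw [← show d + 1 = (n : ℤ) from hn]; ring
  have hlt : d < (n : ℤ) := by omega
  have fg {V : Submodule K (I₁ K)} (hV : FiniteDimensional K V) :
      ∃ t : Finset (I₁ K), Submodule.span K (t : Set (I₁ K)) = V := Module.Finite.iff_fg.1 hV
  obtain ⟨t₁, h₁⟩ := fg (inferInstance : FiniteDimensional K (CenFle d f))
  obtain ⟨t₂, h₂⟩ := fg (kerLeft_finiteDimensional (d := d) f n)
  obtain ⟨t₃, h₃⟩ := fg (kerRight_finiteDimensional (d := d) f n)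
  have hshift (b : I₁ K) : shift n b ∈ Cen f := by
    rw [← shift_mem_ePrimeI, ← hdn]
    exact ePrime_mul_mul_ePrime_mem_Cen hf _
  rw [← Subalgebra.fg_iff_finiteType]
  -- With n = d + 1 the first index outside the corner, generators are bases of the corner and of
  -- the single column and row n, and the images of x, ∂, ∫, 1. The last is needed since `shift n`
  -- sends 1 to e_d'.
  refine ⟨t₁ ∪ t₂ ∪ t₃ ∪ {shift n (xOp K), shift n (del K), shift n (int K), shift n 1},
    le_antisymm (Algebra.adjoin_le ?_) ?_⟩
  · have hle {t : Finset (I₁ K)} (s : Index₃ d)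
        (h : Submodule.span K (t : Set (I₁ K)) = summand₃ d f s) (x : I₁ K) (hx : x ∈ t) :
        x ∈ Cen f :=
      summand₃_le_Cen hf s (h ▸ Submodule.subset_span hx)
    intro x hx
    simp only [Finset.coe_union, Set.mem_union, Finset.mem_coe] at hx
    rcases hx with ((hx | hx) | hx) | hx
    · exact hle .corner h₁ x hx
    · exact hle (.left n hlt) h₂ x hx
    · exact hle (.right n hlt) h₃ x hx
    · simp only [Finset.mem_insert, Finset.mem_singleton] at hx
      rcases hx with rfl | rfl | rfl | rfl <;> exact hshift _
  · set B := Algebra.adjoin K ((t₁ ∪ t₂ ∪ t₃ ∪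
      {shift n (xOp K), shift n (del K), shift n (int K), shift n 1} : Finset (I₁ K)) :
      Set (I₁ K)) with hB
    have hgen {x : I₁ K} (hx : x ∈ t₁ ∪ t₂ ∪ t₃ ∪
        {shift n (xOp K), shift n (del K), shift n (int K), shift n 1}) : x ∈ B :=
      Algebra.subset_adjoin hx
    have hspan {t : Finset (I₁ K)} {V : Submodule K (I₁ K)}
        (h : Submodule.span K (t : Set (I₁ K)) = V) (ht : ∀ x ∈ t, x ∈ B) : ∀ x ∈ V, x ∈ B := by
      intro x hx
      rw [← h] at hx
      exact (Submodule.span_le (p := Subalgebra.toSubmodule B)).2 ht hx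
    have hsh (b : I₁ K) : shift n b ∈ B := by
      induction b using generator_induction with
      | hx => exact hgen (by simp)
      | hd => exact hgen (by simp)
      | hi => exact hgen (by simp)
      | hs r =>
        have : shift n (algebraMap K (I₁ K) r) = r • shift n 1 := by
          rw [Algebra.algebraMap_eq_smul_one, shift, shift, mul_smul_comm, smul_mul_assoc]
        rw [this]
        exact B.smul_mem (hgen (by simp)) r
      | hadd b c hb hc =>
        have : shift n (b + c) = shift n b + shift n c := by
          rw [shift, mul_add, add_mul, shift, shift]
        rw [this]
        exact add_mem hb hc
      | hmul b c hb hc => rw [shift_mul]; exact mul_mem hb hc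
    have hbig (b : I₁ K) (hb : ePrime K d * b * ePrime K d = b) : b ∈ B := by
      rw [hdn] at hb
      obtain ⟨c, rfl⟩ := shift_surjOn n hb
      exact hsh c
    have hunit (i j : ℕ) (hi : d < i) (hj : d < j) : e K i j ∈ B := by
      refine hbig _ ?_
      rw [ePrime_eq, sub_mul, corner_mul_e_of_lt hi, one_mul, sub_zero, mul_sub,
        e_mul_corner_of_lt hj, mul_one, sub_zero]
    have hle : (⨆ s, summand₃ d f s) ≤ Subalgebra.toSubmodule B := by
      refine iSup_le fun s => ?_
      rcases s with _ | ⟨j, hj⟩ | ⟨i, hi⟩ | _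
      · exact hspan h₁ fun x hx => hgen (by simp [hx])
      · intro b hb
        obtain ⟨hb1, hb2, hb3⟩ := mem_kerLeft_iff.1 hb
        -- A column j is moved to column n, treated there, and moved back by e_{nj}, which lies in
        -- the outer block.
        have hbn : b * e K j n ∈ B := by
          refine hspan h₂ (fun x hx => hgen (by simp [hx])) _ (mem_kerLeft_iff.2 ⟨?_, ?_, ?_⟩)
          · rw [← mul_assoc, hb1]
          · rw [mul_assoc, e_mul_e]
          · rw [← mul_assoc, hb3, zero_mul]
        have := mul_mem hbn (hunit n j hlt hj)
        rwa [mul_assoc, e_mul_e, hb2] at this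
      · intro b hb
        obtain ⟨hb1, hb2, hb3⟩ := mem_kerRight_iff.1 hb
        have hbn : e K n i * b ∈ B := by
          refine hspan h₃ (fun x hx => hgen (by simp [hx])) _ (mem_kerRight_iff.2 ⟨?_, ?_, ?_⟩)
          · rw [mul_assoc, hb1]
          · rw [← mul_assoc, e_mul_e]
          · rw [mul_assoc, hb3, mul_zero]
        have := mul_mem (hunit i n hi hlt) hbn
        rwa [← mul_assoc, e_mul_e, hb2] at this
      · exact fun b hb => hbig b (mem_ePrimeI_iff.1 hb)
    rw [iSup_summand₃ hf] at hle
    exact hle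

omit [CharZero K] in
lemma Cen_algebraMap_add (c : K) (f : I₁ K) : Cen (algebraMap K (I₁ K) c + f) = Cen f := by
  ext b
  rw [mem_Cen_iff, mem_Cen_iff, add_mul, mul_add, Algebra.commutes, add_right_inj]

/-- An element of `K + F` is algebraic over `K`. -/
lemma exists_aeval_eq_zero (c : K) (hf : f ∈ F K) :
    ∃ p : K[X], p ≠ 0 ∧ aeval (algebraMap K (I₁ K) c + f) p = 0 := by
  -- f is a torsion element of its own centralizer (α = 0), so q(f)f = 0; substituting t - c
  -- transfers this to c + f.
  obtain ⟨q, hq0, hq⟩ : self f ∈ torsion f :=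
    CenF_subset_torsion (α := 0) (mem_Fle_degF hf) (by simp) hf
  have hq : aeval f q * f = 0 := by
    have := congrArg Subtype.val hq
    rwa [MulMemClass.coe_mul, coe_aeval_self] at this
  refine ⟨(q * X).comp (X - C c), comp_X_sub_C_ne_zero (mul_ne_zero hq0 X_ne_zero) c, ?_⟩
  rw [aeval_comp, map_sub, aeval_X, aeval_C, add_sub_cancel_left, map_mul, aeval_X, hq]

theorem centralizer_of_mem_scalars_sup_F (a : I₁ K) (c : K) (f : I₁ K) (d : ℤ) (hfF : f ∈ F K)
    (hf0 : f ≠ 0) (ha : a = algebraMap K (I₁ K) c + f) (hd : d = degF f) :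
    Algebra.FiniteType K (Cen a) ∧
    ¬ IsNoetherianRing (Cen a) ∧ ¬ IsNoetherianRing (Cen a)ᵐᵒᵖ ∧
    HasInfiniteSumOfLeftIdeals (Cen a) ∧ HasInfiniteSumOfRightIdeals (Cen a) ∧
    ¬ Module.Finite (Kadj a) (Cen a) ∧
    iSupIndep (summand₃ d f) ∧
    (⨆ s, summand₃ d f s) = Subalgebra.toSubmodule (Cen a) ∧
    ¬ commutant K (Cen a) ≤ (CenF a).restrictScalars K ∧
    ¬ FiniteDimensional K (CenF a) ∧
    torsion a = Set.univ ∧ torsion a ≠ (CenF a : Set (Cen a)) := by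
  have hf : f ∈ Fle K d := hd ▸ mem_Fle_degF hfF
  have hd0 : 0 ≤ d := by
    rw [hd, degF, if_neg hf0]
    exact Int.natCast_nonneg _
  -- A scalar is a constant element of K[H], so the diagonal idempotents outside the corner are
  -- available here too.
  have ha' : a = aeval (H K) (C c) + f := by rw [aeval_C, ha]
  have hCen : Cen a = Cen f := by rw [ha, Cen_algebraMap_add]
  obtain ⟨hleft, hright⟩ := infinite_sums_of_diagonal hf ha'
  have hnoeth := not_isNoetherianRing_of_left hleft
  have htor : torsion a = Set.univ := by
    obtain ⟨p, hp0, hp⟩ := exists_aeval_eq_zero c hfF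
    rw [← ha] at hp
    refine Set.eq_univ_of_forall fun x => ⟨p, hp0, Subtype.ext ?_⟩
    rw [MulMemClass.coe_mul, coe_aeval_self, hp, zero_mul]
    rfl
  refine ⟨?_, hnoeth, not_isNoetherianRing_op_of_right hright, hleft, hright,
    fun _ => hnoeth (isNoetherianRing_of_finite a), iSupIndep_summand₃, ?_, ?_,
    not_finiteDimensional_CenF hf ha', htor, ?_⟩
  · rw [hCen]
    exact finiteType_Cen_of_mem_F hd0 hf
  · rw [hCen, iSup_summand₃ hf]
  · intro hle
    obtain ⟨n, hn⟩ := Int.eq_ofNat_of_zero_le (a := d + 1) (by omega)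
    have hdn : d = (n : ℤ) - 1 := by rw [← show d + 1 = (n : ℤ) from hn]; ring
    have hshift (b : I₁ K) : shift n b ∈ Cen a := by
      rw [hCen, ← shift_mem_ePrimeI, ← hdn]
      exact ePrime_mul_mul_ePrime_mem_Cen hf _
    -- The copies of ∂ and x in e_d' 𝕀₁ e_d' have commutator e_d', the copy of 1, which is not in F.
    have hmem : shift n (del K) * shift n (xOp K) - shift n (xOp K) * shift n (del K) ∈ F K :=
      hle (Submodule.subset_span ⟨⟨_, hshift (del K)⟩, ⟨_, hshift (xOp K)⟩, rfl⟩)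
    rw [← shift_mul, ← shift_mul] at hmem
    have hsub : shift n (del K * xOp K) - shift n (xOp K * del K) = shift n 1 := by
      rw [← del_mul_xOp_sub (K := K)]
      simp only [shift, mul_sub, sub_mul]
    rw [hsub, shift_mem_F_iff] at hmem
    exact one_notMem_F hmem
  · rw [htor]
    intro h
    have : (1 : Cen a) ∈ (CenF a : Set (Cen a)) := h ▸ Set.mem_univ _
    exact one_notMem_F this

end ScalarPlusF

end IntDiff

theorem theorem5 {K : Type*} [Field K] [CharZero K] (a : I₁ K) :
    -- the case `a ∉ K[H] + F`
    (a ∉ KH K ⊔ F K →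
      ∃ ρ : ℕ, 1 ≤ ρ ∧
        Module.Finite (Kadj a) (Cen a) ∧ cenRank a = (ρ : Cardinal) ∧
        Algebra.FiniteType K (Cen a) ∧
        IsNoetherianRing (Cen a) ∧ IsNoetherianRing (Cen a)ᵐᵒᵖ ∧
        Nonempty (Cen a ≃ₗ[Kadj a] (Fin ρ → Kadj a) × CenF a) ∧
        (∀ n : ℕ, 0 < n → IsPiMinus a (-(n : ℤ)) → ρ ∣ n) ∧
        (∀ m : ℕ, 0 < m → IsPiPlus a (m : ℤ) → ρ ∣ m) ∧
        commutant K (Cen a) ≤ (CenF a).restrictScalars K ∧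
        FiniteDimensional K (CenF a) ∧
        (CenF a : Set (Cen a)) = torsion a) ∧
    -- the case `a = α + f ∈ (K[H] + F) ∖ (K + F)`
    (∀ (α : K[X]) (f : I₁ K) (d : ℤ), f ∈ F K → a = aeval (H K) α + f →
      a ∉ scalars K ⊔ F K → d = degF f →
        ¬ Module.Finite (Kadj a) (Cen a) ∧ cenRank a = (α.natDegree : Cardinal) ∧
        ¬ Algebra.FiniteType K (Cen a) ∧
        ¬ IsNoetherianRing (Cen a) ∧ ¬ IsNoetherianRing (Cen a)ᵐᵒᵖ ∧
        HasInfiniteSumOfLeftIdeals (Cen a) ∧ HasInfiniteSumOfRightIdeals (Cen a) ∧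
        Nonempty (Cen a ≃ₗ[Kadj a] (Fin α.natDegree → Kadj a) × CenF a) ∧
        Disjoint (ePrimeKH d) (F K ⊓ Subalgebra.toSubmodule (Cen a)) ∧
        ePrimeKH d ⊔ (F K ⊓ Subalgebra.toSubmodule (Cen a)) = Subalgebra.toSubmodule (Cen a) ∧
        iSupIndep (summand₂ d α f) ∧
        (⨆ s, summand₂ d α f s) = F K ⊓ Subalgebra.toSubmodule (Cen a) ∧
        (∀ s, ∀ b ∈ summand₂ d α f s, a * b ∈ summand₂ d α f s) ∧
        {s | summand₂ d α f s ≠ ⊥}.Infinite ∧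
        commutant K (Cen a) ≤ (CenF a).restrictScalars K ∧
        ¬ FiniteDimensional K (CenF a) ∧
        (CenF a : Set (Cen a)) = torsion a) ∧
    -- the case `a = c + f ∈ (K + F) ∖ K`
    (∀ (c : K) (f : I₁ K) (d : ℤ), f ∈ F K → f ≠ 0 → a = algebraMap K (I₁ K) c + f →
      d = degF f →
        Algebra.FiniteType K (Cen a) ∧
        ¬ IsNoetherianRing (Cen a) ∧ ¬ IsNoetherianRing (Cen a)ᵐᵒᵖ ∧
        HasInfiniteSumOfLeftIdeals (Cen a) ∧ HasInfiniteSumOfRightIdeals (Cen a) ∧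
        ¬ Module.Finite (Kadj a) (Cen a) ∧
        iSupIndep (summand₃ d f) ∧
        (⨆ s, summand₃ d f s) = Subalgebra.toSubmodule (Cen a) ∧
        ¬ commutant K (Cen a) ≤ (CenF a).restrictScalars K ∧
        ¬ FiniteDimensional K (CenF a) ∧
        torsion a = Set.univ ∧ torsion a ≠ (CenF a : Set (Cen a))) := by
  exact ⟨centralizer_of_notMem_KH_sup_F a, centralizer_of_mem_KH_sup_F a,
    centralizer_of_mem_scalars_sup_F a⟩
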